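/- A function $f:\mathbb{R}\to\mathbb{R}$ is *unimodal* if there is a $c\in\mathbb{R}$ such that $f$ is non-increasing on $(-\infty,c]$ and non-decreasing on $[c,\infty)$. A (continuous) piecewise-linear function is represented by the increasing list of its breakpoints, its values at them, its initial slope and its final slope (the list may also contain points at which the slope does not change; it may be empty, and then the function is affine). The *Unimodal Cost 2-Median problem* is: given such representations of $k$ piecewise-linear unimodal functions $f_1,\dots,f_k:\mathbb{R}\to\mathbb{R}$ with $n$ listed breakpoints in total, find $a,b\in\mathbb{R}$ that minimize $$g(a,b)=\sum_{i=1}^k \min\{f_i(a),f_i(b)\}.$$ **Theorem.** The Unimodal Cost 2-Median problem can be solved in $O((n+k\log k)\log n)$ time on a real RAM. That is: there are a single program, a constant $C$ and an exponent $w$ such that, on every input as above, the program halts and outputs a pair $(a,b)\in\mathbb{R}^2$ with $g(a,b)\le g(a',b')$ for all $a',b'\in\mathbb{R}$, and, whenever $n\ge 2$, it does so after at most $C\,(n+k\log k)\log n$ steps. Here the real RAM has finitely many integer variables, real variables, and arrays of integers and of reals that are addressed by integers. Every exact real operation $+,-,\times,/$ (with the convention $x/0=0$), integer addition, truncated subtraction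 and halving (rounded down), memory access, comparison, assignment and branch takes one step. Constants in a program are natural numbers and rationals, there is no rounding of reals to integers, and all integers stored during the run are at most $(n+k+2)^w$, that is, have $O(\log(n+k+2))$ bits. The input is stored as $k$, the concatenated lists of breakpoints and of values, the starting positions of the functions in these lists, and the initial and final slopes; the rest of the memory is arbitrary at the start. -/

import Mathlib

/-! Unimodal and piecewise-linear functions, and the cost of the 2-median problem. -/

/-- `f` is non-increasing up to some point `c` and non-decreasing from `c` on. -/
def Unimodal (f : ℝ → ℝ) : Prop :=
  ∃ c : ℝ, (∀ x y : ℝ, x ≤ y → y ≤ c → f y ≤ f x) ∧ (∀ x y : ℝ, c ≤ x → x ≤ y → f x ≤ f y)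

/-- `g(a, b) = ∑ i, min (f i a) (f i b)`. -/
noncomputable def twoMedianCost {k : ℕ} (f : Fin k → ℝ → ℝ) (a b : ℝ) : ℝ :=
  ∑ i, min (f i a) (f i b)

/-- The data by which a piecewise-linear function is given: its `size` breakpoints `x`,
the values `y` there, the initial slope and the final slope. -/
structure PLData where
  size : ℕ
  x : Fin size → ℝ
  y : Fin size → ℝ
  initialSlope : ℝ
  finalSlope : ℝ

/-- `f` is the (continuous) piecewise-linear function given by `D`: the breakpoints are listed in
increasing order, `f` takes the listed values there, is interpolated linearly between consecutive
breakpoints, has the initial slope up to the first and the final slope from the last breakpoint on.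
If there are no breakpoints, this says that `f` is affine on the whole line. -/
structure PLData.Represents (D : PLData) (f : ℝ → ℝ) : Prop where
  strictMono : StrictMono D.x
  value : ∀ j, f (D.x j) = D.y j
  left : ∀ u v : ℝ, (∀ j, u ≤ D.x j) → (∀ j, v ≤ D.x j) → f v - f u = D.initialSlope * (v - u)
  right : ∀ u v : ℝ, (∀ j, D.x j ≤ u) → (∀ j, D.x j ≤ v) → f v - f u = D.finalSlope * (v - u)
  between : ∀ j j' : Fin D.size, (j : ℕ) + 1 = j' → ∀ u ∈ Set.Icc (D.x j) (D.x j'),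
    f u = D.y j + (D.y j' - D.y j) / (D.x j' - D.x j) * (u - D.x j)

/-- The total number of breakpoints. -/
def totalBreakpoints {k : ℕ} (D : Fin k → PLData) : ℕ := ∑ i, (D i).size

/-- The number of breakpoints of the functions before the `i`-th (counted from 0). -/
def breakpointOffset {k : ℕ} (D : Fin k → PLData) (i : ℕ) : ℕ :=
  ∑ j : Fin k, if (j : ℕ) < i then (D j).size else 0

namespace RealRAM

/-! A real RAM. Its memory consists of integer variables, real variables, arrays of integers and
arrays of reals. A program names finitely many variables and arrays; array cells are
addressed indirectly, by computed integers. Every arithmetic operation, memory access, comparison,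
assignment and branch costs one step. There is no rounding of reals and no conversion of reals
to integers. -/

structure State where
  ivar : ℕ → ℕ
  rvar : ℕ → ℝ
  iarr : ℕ → ℕ → ℕ
  rarr : ℕ → ℕ → ℝ

def State.setIVar (σ : State) (v : ℕ) (a : ℕ) : State :=
  { σ with ivar := Function.update σ.ivar v a }

noncomputable def State.setRVar (σ : State) (v : ℕ) (a : ℝ) : State :=
  { σ with rvar := Function.update σ.rvar v a }

def State.setIArr (σ : State) (A i : ℕ) (a : ℕ) : State :=
  { σ with iarr := Function.update σ.iarr A (Function.update (σ.iarr A) i a) }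

noncomputable def State.setRArr (σ : State) (A i : ℕ) (a : ℝ) : State :=
  { σ with rarr := Function.update σ.rarr A (Function.update (σ.rarr A) i a) }

/-- Integer expressions; `arr A e` is the entry of the integer array `A` with index `e`. -/
inductive IExp where
  | const (c : ℕ)
  | var (v : ℕ)
  | arr (A : ℕ) (e : IExp)
  | add (e e' : IExp)
  | sub (e e' : IExp)
  | half (e : IExp)

/-- Integers are non-negative: subtraction is truncated at 0, halving rounds down. -/
def IExp.eval (σ : State) : IExp → ℕ
  | const c => c
  | var v => σ.ivar v
  | arr A e => σ.iarr A (e.eval σ)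
  | add e e' => e.eval σ + e'.eval σ
  | sub e e' => e.eval σ - e'.eval σ
  | half e => e.eval σ / 2

/-- One step for every node of the expression. -/
def IExp.cost : IExp → ℕ
  | const _ => 1
  | var _ => 1
  | arr _ e => e.cost + 1
  | add e e' => e.cost + e'.cost + 1
  | sub e e' => e.cost + e'.cost + 1
  | half e => e.cost + 1

/-- Real expressions; the constants are rational. -/
inductive RExp where
  | const (q : ℚ)
  | var (v : ℕ)
  | arr (A : ℕ) (e : IExp)
  | add (e e' : RExp)
  | sub (e e' : RExp)
  | mul (e e' : RExp)
  | div (e e' : RExp)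

/-- Exact real arithmetic; a quotient by 0 is 0. -/
noncomputable def RExp.eval (σ : State) : RExp → ℝ
  | const q => (q : ℝ)
  | var v => σ.rvar v
  | arr A e => σ.rarr A (e.eval σ)
  | add e e' => e.eval σ + e'.eval σ
  | sub e e' => e.eval σ - e'.eval σ
  | mul e e' => e.eval σ * e'.eval σ
  | div e e' => e.eval σ / e'.eval σ

def RExp.cost : RExp → ℕ
  | const _ => 1
  | var _ => 1
  | arr _ e => e.cost + 1
  | add e e' => e.cost + e'.cost + 1
  | sub e e' => e.cost + e'.cost + 1
  | mul e e' => e.cost + e'.cost + 1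
  | div e e' => e.cost + e'.cost + 1

/-- Tests: comparisons of integers and of reals, and their Boolean combinations. -/
inductive Test where
  | ile (e e' : IExp)
  | rle (e e' : RExp)
  | not (b : Test)
  | and (b b' : Test)

def Test.holds (σ : State) : Test → Prop
  | ile e e' => e.eval σ ≤ e'.eval σ
  | rle e e' => e.eval σ ≤ e'.eval σ
  | not b => ¬ b.holds σ
  | and b b' => b.holds σ ∧ b'.holds σ

def Test.cost : Test → ℕ
  | ile e e' => e.cost + e'.cost + 1
  | rle e e' => e.cost + e'.cost + 1
  | not b => b.cost + 1
  | and b b' => b.cost + b'.cost + 1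

/-- Programs: assignments to variables (`iset`, `rset`) and to array entries (`iput`, `rput`, with
array name, index and new value), sequencing, branching and while-loops. -/
inductive Program where
  | skip
  | iset (v : ℕ) (e : IExp)
  | rset (v : ℕ) (e : RExp)
  | iput (A : ℕ) (i : IExp) (e : IExp)
  | rput (A : ℕ) (i : IExp) (e : RExp)
  | seq (P Q : Program)
  | branch (b : Test) (P Q : Program)
  | loop (b : Test) (P : Program)

/-- `Exec W P σ t σ'`: on a machine whose integer memory cells hold only integers up to `W`, the
program `P` started in the state `σ` halts in the state `σ'` after exactly `t` steps. (The machine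
gets stuck if a larger integer is to be stored.) -/
inductive Exec (W : ℕ) : Program → State → ℕ → State → Prop
  | skip (σ : State) : Exec W Program.skip σ 1 σ
  | iset (v : ℕ) (e : IExp) (σ : State) (h : e.eval σ ≤ W) :
      Exec W (Program.iset v e) σ (e.cost + 1)
        (σ.setIVar v (e.eval σ))
  | rset (v : ℕ) (e : RExp) (σ : State) :
      Exec W (Program.rset v e) σ (e.cost + 1)
        (σ.setRVar v (e.eval σ))
  | iput (A : ℕ) (i e : IExp) (σ : State) (h : e.eval σ ≤ W) :
      Exec W (Program.iput A i e) σ (i.cost + e.cost + 1)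
        (σ.setIArr A (i.eval σ) (e.eval σ))
  | rput (A : ℕ) (i : IExp) (e : RExp) (σ : State) :
      Exec W (Program.rput A i e) σ (i.cost + e.cost + 1)
        (σ.setRArr A (i.eval σ) (e.eval σ))
  | seq (P Q : Program) (σ σ' σ'' : State) (s t : ℕ)
      (hP : Exec W P σ s σ') (hQ : Exec W Q σ' t σ'') :
      Exec W (Program.seq P Q) σ (s + t) σ''
  | branchTrue (b : Test) (P Q : Program) (σ σ' : State) (t : ℕ)
      (hb : b.holds σ) (hP : Exec W P σ t σ') :
      Exec W (Program.branch b P Q) σ (b.cost + 1 + t) σ'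
  | branchFalse (b : Test) (P Q : Program) (σ σ' : State) (t : ℕ)
      (hb : ¬ b.holds σ) (hQ : Exec W Q σ t σ') :
      Exec W (Program.branch b P Q) σ (b.cost + 1 + t) σ'
  | loopFalse (b : Test) (P : Program) (σ : State) (hb : ¬ b.holds σ) :
      Exec W (Program.loop b P) σ (b.cost + 1) σ
  | loopTrue (b : Test) (P : Program) (σ σ' σ'' : State) (s t : ℕ)
      (hb : b.holds σ) (hP : Exec W P σ s σ') (hL : Exec W (Program.loop b P) σ' t σ'') :
      Exec W (Program.loop b P) σ (b.cost + 1 + s + t) σ''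

/-- The state `σ` holds the input `D` (functions counted from 0): the integer variable 0 holds the
number `k` of functions; the real arrays 0 and 1 hold the breakpoints and the values of all
functions, one function after the other; the integer array 0 holds at index `i ≤ k` the position
in these arrays where function `i` starts; the real arrays 2 and 3 hold at index `i < k` the initial
and the final slope of function `i`. The rest of the memory is arbitrary. -/
structure Holds {k : ℕ} (D : Fin k → PLData) (σ : State) : Prop where
  count : σ.ivar 0 = k
  offset : ∀ i : ℕ, i ≤ k → σ.iarr 0 i = breakpointOffset D i
  x : ∀ (i : Fin k) (j : Fin (D i).size), σ.rarr 0 (breakpointOffset D i + j) = (D i).x j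
  y : ∀ (i : Fin k) (j : Fin (D i).size), σ.rarr 1 (breakpointOffset D i + j) = (D i).y j
  initialSlope : ∀ i : Fin k, σ.rarr 2 i = (D i).initialSlope
  finalSlope : ∀ i : Fin k, σ.rarr 3 i = (D i).finalSlope

end RealRAM

/-! The 2-median problem with unimodal piecewise-linear costs, on a real RAM.

**Why an efficient algorithm exists.** An optimal pair can be found among the breakpoints
(`exists_candidate_cost_le`): once it is fixed which functions are charged to `a` and which to `b`,
both sums are minimized separately, and a sum of piecewise-linear functions whose outermost pieces
do not fall away towards infinity is minimal at a breakpoint. A unimodal function with minimum at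
`c` is `f c` plus a non-decreasing part `rise f c` and a non-increasing part `fall f c`. With these
parts, `min (f a) (f b)` is, up to the constant `f c`, at most
`rise a + fall b + min (fall a) (rise b)`, with equality for `a ≤ b` (`min_le_rise_fall`,
`min_eq_rise_fall`). The sum of the right-hand sides, `pairCost`, can therefore be minimized over
all pairs of breakpoints instead of the original cost. The advantage is that it is a Monge array
(`pairCost_monge`) on the whole square, so that the optimal columns increase with the row.

**The algorithm.** The breakpoints are sorted. The rows are processed in `log n` levels; on a level,
they are the odd multiples of a power of two `h`, and the optimal columns for the multiples
of `2 * h` are known. By the Monge property (`Solved.refine`) the optimal column of a row lies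
between those of its two neighbours, so that all pairs that have to be examined on one level form a
monotone staircase path with at most `2 * n` steps (`buildPath_spec`). Along such a path
`fall a - rise b` decreases for every function, so there is one time at which the minimum switches
from `rise b` to `fall a`. Each of the summands is piecewise linear in the candidate,
hence the contribution of one function to the costs along the path is described by changes of three
coefficients at few times: those at which the row or the column enters a new piece, and the time of
the switch (`addFunction_spec`). The latter is found by walking over the pieces and one bisection,
in `O(log n)` steps beyond the number of pieces. The prefix sums of these changes give all the costs
on the path (`evaluate_spec`). A level thus takes `O(n + k log n)` steps (`level_spec`), and all
levels `O((n + k log n) log n)`. This is the required bound, because `k log n` is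
`O(n + k log k)` (`mul_log_le`).

**Programs.** `Runs W P σ T Q` says that `P`, started in `σ`, halts within `T` steps in a state
satisfying `Q`, while no integer above `W` is stored. Sequences of assignments and branches are
unfolded by `simp`; for loops there are `Runs.loop` and its variants. What a program leaves
unchanged is read off from its text by `Frame`. -/

namespace RealRAM

/-! ### A program logic with time bounds -/

infixr:60 " ;; " => Program.seq

/-- `P`, started in `σ`, halts within `T` steps in a state satisfying `Q`. -/
def Runs (W : ℕ) (P : Program) (σ : State) (T : ℕ) (Q : State → Prop) : Prop :=
  ∃ t σ', t ≤ T ∧ Exec W P σ t σ' ∧ Q σ'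

namespace Program

/-- Whether `P` contains an assignment to the integer variable `v`. -/
def setsI (v : ℕ) : Program → Bool
  | iset w _ => Nat.beq v w
  | seq P Q => P.setsI v || Q.setsI v
  | branch _ P Q => P.setsI v || Q.setsI v
  | loop _ P => P.setsI v
  | _ => false

/-- Whether `P` contains an assignment to the real variable `v`. -/
def setsR (v : ℕ) : Program → Bool
  | rset w _ => Nat.beq v w
  | seq P Q => P.setsR v || Q.setsR v
  | branch _ P Q => P.setsR v || Q.setsR v
  | loop _ P => P.setsR v
  | _ => false

/-- Whether `P` contains an assignment to an entry of the integer array `A`. -/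
def putsI (A : ℕ) : Program → Bool
  | iput B _ _ => Nat.beq A B
  | seq P Q => P.putsI A || Q.putsI A
  | branch _ P Q => P.putsI A || Q.putsI A
  | loop _ P => P.putsI A
  | _ => false

/-- Whether `P` contains an assignment to an entry of the real array `A`. -/
def putsR (A : ℕ) : Program → Bool
  | rput B _ _ => Nat.beq A B
  | seq P Q => P.putsR A || Q.putsR A
  | branch _ P Q => P.putsR A || Q.putsR A
  | loop _ P => P.putsR A
  | _ => false

/-- Run `P` for `v = 0, 1, …` as long as `v` is less than `e`. -/
def forUp (v : ℕ) (e : IExp) (P : Program) : Program :=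
  iset v (.const 0) ;;
  loop (.not (.ile e (.var v))) (P ;; iset v (.add (.var v) (.const 1)))

end Program

/-- The variables and arrays to which `P` assigns nothing agree in `σ` and `σ'`. -/
structure Frame (P : Program) (σ σ' : State) : Prop where
  ivar : ∀ v, P.setsI v = false → σ'.ivar v = σ.ivar v
  rvar : ∀ v, P.setsR v = false → σ'.rvar v = σ.rvar v
  iarr : ∀ A, P.putsI A = false → σ'.iarr A = σ.iarr A
  rarr : ∀ A, P.putsR A = false → σ'.rarr A = σ.rarr A

theorem Frame.refl (P : Program) (σ : State) : Frame P σ σ :=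
  ⟨fun _ _ => rfl, fun _ _ => rfl, fun _ _ => rfl, fun _ _ => rfl⟩

theorem Frame.trans {P : Program} {σ σ' σ'' : State} (h : Frame P σ σ') (h' : Frame P σ' σ'') :
    Frame P σ σ'' :=
  ⟨fun v hv => (h'.ivar v hv).trans (h.ivar v hv), fun v hv => (h'.rvar v hv).trans (h.rvar v hv),
    fun v hv => (h'.iarr v hv).trans (h.iarr v hv), fun v hv => (h'.rarr v hv).trans (h.rarr v hv)⟩

section StateLemmas
variable (σ : State) (v w : ℕ) (A B i a : ℕ) (x : ℝ)

@[simp] theorem setIVar_ivar : (σ.setIVar v a).ivar w = if w = v then a else σ.ivar w := by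
  simp [State.setIVar, Function.update_apply]
@[simp] theorem setIVar_rvar : (σ.setIVar v a).rvar = σ.rvar := rfl
@[simp] theorem setIVar_iarr : (σ.setIVar v a).iarr = σ.iarr := rfl
@[simp] theorem setIVar_rarr : (σ.setIVar v a).rarr = σ.rarr := rfl
@[simp] theorem setRVar_rvar : (σ.setRVar v x).rvar w = if w = v then x else σ.rvar w := by
  simp [State.setRVar, Function.update_apply]
@[simp] theorem setRVar_ivar : (σ.setRVar v x).ivar = σ.ivar := rfl
@[simp] theorem setRVar_iarr : (σ.setRVar v x).iarr = σ.iarr := rfl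
@[simp] theorem setRVar_rarr : (σ.setRVar v x).rarr = σ.rarr := rfl
@[simp] theorem setIArr_iarr :
    (σ.setIArr A i a).iarr B = if B = A then Function.update (σ.iarr A) i a else σ.iarr B := by
  simp [State.setIArr, Function.update_apply]
@[simp] theorem setIArr_ivar : (σ.setIArr A i a).ivar = σ.ivar := rfl
@[simp] theorem setIArr_rvar : (σ.setIArr A i a).rvar = σ.rvar := rfl
@[simp] theorem setIArr_rarr : (σ.setIArr A i a).rarr = σ.rarr := rfl
@[simp] theorem setRArr_rarr :
    (σ.setRArr A i x).rarr B = if B = A then Function.update (σ.rarr A) i x else σ.rarr B := by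
  simp [State.setRArr, Function.update_apply]
@[simp] theorem setRArr_ivar : (σ.setRArr A i x).ivar = σ.ivar := rfl
@[simp] theorem setRArr_rvar : (σ.setRArr A i x).rvar = σ.rvar := rfl
@[simp] theorem setRArr_iarr : (σ.setRArr A i x).iarr = σ.iarr := rfl

end StateLemmas

theorem Exec.frame {W : ℕ} {P : Program} {σ σ' : State} {t : ℕ} (h : Exec W P σ t σ') :
    Frame P σ σ' := by
  induction h with
  | skip σ => exact Frame.refl _ _
  | iset w e σ hW =>
    refine ⟨fun v hv => ?_, fun _ _ => rfl, fun _ _ => rfl, fun _ _ => rfl⟩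
    have : v ≠ w := fun h => by simp [Program.setsI, h] at hv
    simp [this]
  | rset w e σ =>
    refine ⟨fun _ _ => rfl, fun v hv => ?_, fun _ _ => rfl, fun _ _ => rfl⟩
    have : v ≠ w := fun h => by simp [Program.setsR, h] at hv
    simp [this]
  | iput w i e σ hW =>
    refine ⟨fun _ _ => rfl, fun _ _ => rfl, fun v hv => ?_, fun _ _ => rfl⟩
    have : v ≠ w := fun h => by simp [Program.putsI, h] at hv
    simp [this]
  | rput w i e σ =>
    refine ⟨fun _ _ => rfl, fun _ _ => rfl, fun _ _ => rfl, fun v hv => ?_⟩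
    have : v ≠ w := fun h => by simp [Program.putsR, h] at hv
    simp [this]
  | seq P Q σ σ' σ'' s t hP hQ ihP ihQ =>
    refine ⟨fun v hv => ?_, fun v hv => ?_, fun v hv => ?_, fun v hv => ?_⟩
    · simp only [Program.setsI, Bool.or_eq_false_iff] at hv
      rw [ihQ.ivar v hv.2, ihP.ivar v hv.1]
    · simp only [Program.setsR, Bool.or_eq_false_iff] at hv
      rw [ihQ.rvar v hv.2, ihP.rvar v hv.1]
    · simp only [Program.putsI, Bool.or_eq_false_iff] at hv
      rw [ihQ.iarr v hv.2, ihP.iarr v hv.1]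
    · simp only [Program.putsR, Bool.or_eq_false_iff] at hv
      rw [ihQ.rarr v hv.2, ihP.rarr v hv.1]
  | branchTrue b P Q σ σ' t hb hP ih =>
    refine ⟨fun v hv => ?_, fun v hv => ?_, fun v hv => ?_, fun v hv => ?_⟩
    · simp only [Program.setsI, Bool.or_eq_false_iff] at hv; exact ih.ivar v hv.1
    · simp only [Program.setsR, Bool.or_eq_false_iff] at hv; exact ih.rvar v hv.1
    · simp only [Program.putsI, Bool.or_eq_false_iff] at hv; exact ih.iarr v hv.1
    · simp only [Program.putsR, Bool.or_eq_false_iff] at hv; exact ih.rarr v hv.1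
  | branchFalse b P Q σ σ' t hb hP ih =>
    refine ⟨fun v hv => ?_, fun v hv => ?_, fun v hv => ?_, fun v hv => ?_⟩
    · simp only [Program.setsI, Bool.or_eq_false_iff] at hv; exact ih.ivar v hv.2
    · simp only [Program.setsR, Bool.or_eq_false_iff] at hv; exact ih.rvar v hv.2
    · simp only [Program.putsI, Bool.or_eq_false_iff] at hv; exact ih.iarr v hv.2
    · simp only [Program.putsR, Bool.or_eq_false_iff] at hv; exact ih.rarr v hv.2
  | loopFalse b P σ hb => exact Frame.refl _ _
  | loopTrue b P σ σ' σ'' s t hb hP hL ihP ihL =>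
    exact Frame.trans ⟨ihP.ivar, ihP.rvar, ihP.iarr, ihP.rarr⟩ ihL

section Rules
variable {W : ℕ} {σ : State} {T T' : ℕ} {P P' P'' : Program} {Q Q' : State → Prop}

/-- The conclusion may also use what `P` leaves unchanged. -/
theorem Runs.mono (h : Runs W P σ T Q) (hT : T ≤ T') (hQ : ∀ σ', Frame P σ σ' → Q σ' → Q' σ') :
    Runs W P σ T' Q' := by
  obtain ⟨t, σ', ht, hE, hq⟩ := h
  exact ⟨t, σ', ht.trans hT, hE, hQ σ' hE.frame hq⟩

theorem Runs.mono_time (h : Runs W P σ T Q) (hT : T ≤ T') : Runs W P σ T' Q :=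
  h.mono hT fun _ _ h => h

theorem Runs.seq (h : Runs W P σ T Q)
    (h' : ∀ σ', Frame P σ σ' → Q σ' → Runs W P' σ' T' Q') :
    Runs W (P ;; P') σ (T + T') Q' := by
  obtain ⟨t, σ', ht, hE, hq⟩ := h
  obtain ⟨t', σ'', ht', hE', hq'⟩ := h' σ' hE.frame hq
  exact ⟨t + t', σ'', by omega, .seq _ _ _ _ _ _ _ hE hE', hq'⟩

@[simp] theorem runs_skip : Runs W .skip σ T Q ↔ 1 ≤ T ∧ Q σ := by
  constructor
  · rintro ⟨t, σ', ht, hE, hq⟩; cases hE; exact ⟨ht, hq⟩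
  · rintro ⟨ht, hq⟩; exact ⟨_, _, ht, .skip _, hq⟩

@[simp] theorem runs_iset {v : ℕ} {e : IExp} : Runs W (.iset v e) σ T Q ↔
    e.cost + 1 ≤ T ∧ e.eval σ ≤ W ∧ Q (σ.setIVar v (e.eval σ)) := by
  constructor
  · rintro ⟨t, σ', ht, hE, hq⟩
    cases hE with | iset _ _ _ h => exact ⟨ht, h, hq⟩
  · rintro ⟨ht, h, hq⟩; exact ⟨_, _, ht, .iset _ _ _ h, hq⟩

@[simp] theorem runs_rset {v : ℕ} {e : RExp} : Runs W (.rset v e) σ T Q ↔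
    e.cost + 1 ≤ T ∧ Q (σ.setRVar v (e.eval σ)) := by
  constructor
  · rintro ⟨t, σ', ht, hE, hq⟩
    cases hE with | rset _ _ _ => exact ⟨ht, hq⟩
  · rintro ⟨ht, hq⟩; exact ⟨_, _, ht, .rset _ _ _, hq⟩

@[simp] theorem runs_iput {A : ℕ} {i e : IExp} : Runs W (.iput A i e) σ T Q ↔
    i.cost + e.cost + 1 ≤ T ∧ e.eval σ ≤ W ∧ Q (σ.setIArr A (i.eval σ) (e.eval σ)) := by
  constructor
  · rintro ⟨t, σ', ht, hE, hq⟩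
    cases hE with | iput _ _ _ _ h => exact ⟨ht, h, hq⟩
  · rintro ⟨ht, h, hq⟩; exact ⟨_, _, ht, .iput _ _ _ _ h, hq⟩

@[simp] theorem runs_rput {A : ℕ} {i : IExp} {e : RExp} : Runs W (.rput A i e) σ T Q ↔
    i.cost + e.cost + 1 ≤ T ∧ Q (σ.setRArr A (i.eval σ) (e.eval σ)) := by
  constructor
  · rintro ⟨t, σ', ht, hE, hq⟩
    cases hE with | rput _ _ _ _ => exact ⟨ht, hq⟩
  · rintro ⟨ht, hq⟩; exact ⟨_, _, ht, .rput _ _ _ _, hq⟩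

@[simp] theorem runs_branch {b : Test} : Runs W (.branch b P P') σ T Q ↔
    b.cost + 1 ≤ T ∧ (b.holds σ → Runs W P σ (T - (b.cost + 1)) Q) ∧
      (¬ b.holds σ → Runs W P' σ (T - (b.cost + 1)) Q) := by
  constructor
  · rintro ⟨t, σ', ht, hE, hq⟩
    cases hE with
    | branchTrue _ _ _ _ _ s hb hP =>
      exact ⟨by omega, fun _ => ⟨s, σ', by omega, hP, hq⟩, fun h => (h hb).elim⟩
    | branchFalse _ _ _ _ _ s hb hP =>
      exact ⟨by omega, fun h => (hb h).elim, fun _ => ⟨s, σ', by omega, hP, hq⟩⟩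
  · rintro ⟨hT, h1, h2⟩
    by_cases hb : b.holds σ
    · obtain ⟨t, σ', ht, hE, hq⟩ := h1 hb
      exact ⟨_, σ', by omega, .branchTrue _ _ _ _ _ _ hb hE, hq⟩
    · obtain ⟨t, σ', ht, hE, hq⟩ := h2 hb
      exact ⟨_, σ', by omega, .branchFalse _ _ _ _ _ _ hb hE, hq⟩

theorem runs_seq_iff : Runs W (P ;; P') σ T Q ↔
    ∃ s t σ', s + t ≤ T ∧ Exec W P σ s σ' ∧ Runs W P' σ' t Q := by
  constructor
  · rintro ⟨t, σ', ht, hE, hq⟩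
    cases hE with
    | seq _ _ _ σ₁ _ s t hP hQ => exact ⟨s, t, σ₁, ht, hP, ⟨t, σ', le_rfl, hQ, hq⟩⟩
  · rintro ⟨s, t, σ₁, hT, hE, ⟨t', σ', ht, hE', hq⟩⟩
    exact ⟨_, σ', by omega, .seq _ _ _ _ _ _ _ hE hE', hq⟩

/-- The rule for an assignment, which takes `c` steps and changes the state by `g` if `R` holds,
followed by `P'`. -/
theorem runs_seq_atomic {R : State → ℕ → Prop} {c : ℕ} {g : State → State}
    (hP : ∀ σ σ' s, Exec W P σ s σ' ↔ R σ s ∧ s = c ∧ σ' = g σ) :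
    Runs W (P ;; P') σ T Q ↔ c ≤ T ∧ R σ c ∧ Runs W P' (g σ) (T - c) Q := by
  rw [runs_seq_iff]
  constructor
  · rintro ⟨s, t, σ₁, hT, hE, t', σ', ht, hE', hq⟩
    obtain ⟨hR, rfl, rfl⟩ := (hP _ _ _).1 hE
    exact ⟨by omega, hR, t', σ', by omega, hE', hq⟩
  · rintro ⟨hT, hR, h⟩
    exact ⟨c, T - c, g σ, by omega, (hP _ _ _).2 ⟨hR, rfl, rfl⟩, h⟩

@[simp] theorem runs_seq_iset {v : ℕ} {e : IExp} : Runs W (.iset v e ;; P') σ T Q ↔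
    e.cost + 1 ≤ T ∧ e.eval σ ≤ W ∧
      Runs W P' (σ.setIVar v (e.eval σ)) (T - (e.cost + 1)) Q :=
  runs_seq_atomic (R := fun σ _ => e.eval σ ≤ W) (g := fun σ => σ.setIVar v (e.eval σ))
    fun σ σ' s => ⟨fun h => by cases h with | iset _ _ _ h => exact ⟨h, rfl, rfl⟩,
      fun ⟨h, h1, h2⟩ => h1 ▸ h2 ▸ .iset _ _ _ h⟩

@[simp] theorem runs_seq_rset {v : ℕ} {e : RExp} : Runs W (.rset v e ;; P') σ T Q ↔
    e.cost + 1 ≤ T ∧ Runs W P' (σ.setRVar v (e.eval σ)) (T - (e.cost + 1)) Q := by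
  have := runs_seq_atomic (W := W) (σ := σ) (T := T) (P' := P') (Q := Q) (P := .rset v e)
    (R := fun _ _ => True) (g := fun σ => σ.setRVar v (e.eval σ)) (c := e.cost + 1)
    fun σ σ' s => ⟨fun h => by cases h with | rset _ _ _ => exact ⟨trivial, rfl, rfl⟩,
      fun ⟨h, h1, h2⟩ => h1 ▸ h2 ▸ .rset _ _ _⟩
  simpa using this

@[simp] theorem runs_seq_iput {A : ℕ} {i e : IExp} : Runs W (.iput A i e ;; P') σ T Q ↔
    i.cost + e.cost + 1 ≤ T ∧ e.eval σ ≤ W ∧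
      Runs W P' (σ.setIArr A (i.eval σ) (e.eval σ)) (T - (i.cost + e.cost + 1)) Q :=
  runs_seq_atomic (R := fun σ _ => e.eval σ ≤ W)
    (g := fun σ => σ.setIArr A (i.eval σ) (e.eval σ))
    fun σ σ' s => ⟨fun h => by cases h with | iput _ _ _ _ h => exact ⟨h, rfl, rfl⟩,
      fun ⟨h, h1, h2⟩ => h1 ▸ h2 ▸ .iput _ _ _ _ h⟩

@[simp] theorem runs_seq_rput {A : ℕ} {i : IExp} {e : RExp} : Runs W (.rput A i e ;; P') σ T Q ↔
    i.cost + e.cost + 1 ≤ T ∧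
      Runs W P' (σ.setRArr A (i.eval σ) (e.eval σ)) (T - (i.cost + e.cost + 1)) Q := by
  have := runs_seq_atomic (W := W) (σ := σ) (T := T) (P' := P') (Q := Q) (P := .rput A i e)
    (R := fun _ _ => True) (g := fun σ => σ.setRArr A (i.eval σ) (e.eval σ))
    (c := i.cost + e.cost + 1)
    fun σ σ' s => ⟨fun h => by cases h with | rput _ _ _ _ => exact ⟨trivial, rfl, rfl⟩,
      fun ⟨h, h1, h2⟩ => h1 ▸ h2 ▸ .rput _ _ _ _⟩
  simpa using this

@[simp] theorem runs_seq_skip : Runs W (.skip ;; P') σ T Q ↔ 1 ≤ T ∧ Runs W P' σ (T - 1) Q := by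
  have := runs_seq_atomic (W := W) (σ := σ) (T := T) (P' := P') (Q := Q) (P := .skip)
    (R := fun _ _ => True) (g := fun σ => σ) (c := 1)
    fun σ σ' s => ⟨fun h => by cases h with | skip _ => exact ⟨trivial, rfl, rfl⟩,
      fun ⟨h, h1, h2⟩ => h1 ▸ h2 ▸ .skip _⟩
  simpa using this

@[simp] theorem runs_seq_branch {b : Test} : Runs W (.branch b P P' ;; P'') σ T Q ↔
    b.cost + 1 ≤ T ∧ (b.holds σ → Runs W (P ;; P'') σ (T - (b.cost + 1)) Q) ∧
      (¬ b.holds σ → Runs W (P' ;; P'') σ (T - (b.cost + 1)) Q) := by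
  constructor
  · intro h
    obtain ⟨s, t, σ₁, hT, hE, h⟩ := runs_seq_iff.1 h
    cases hE with
    | branchTrue _ _ _ _ _ s hb hP =>
      exact ⟨by omega, fun _ => runs_seq_iff.2 ⟨s, t, σ₁, by omega, hP, h⟩, fun h => (h hb).elim⟩
    | branchFalse _ _ _ _ _ s hb hP =>
      exact ⟨by omega, fun h => (hb h).elim, fun _ => runs_seq_iff.2 ⟨s, t, σ₁, by omega, hP, h⟩⟩
  · rintro ⟨hT, h1, h2⟩
    by_cases hb : b.holds σ
    · obtain ⟨s, t, σ₁, hs, hE, h⟩ := runs_seq_iff.1 (h1 hb)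
      exact runs_seq_iff.2 ⟨_, t, σ₁, by omega, .branchTrue _ _ _ _ _ _ hb hE, h⟩
    · obtain ⟨s, t, σ₁, hs, hE, h⟩ := runs_seq_iff.1 (h2 hb)
      exact runs_seq_iff.2 ⟨_, t, σ₁, by omega, .branchFalse _ _ _ _ _ _ hb hE, h⟩

/-- The rule for loops. The invariant `I a` holds after `a` iterations, the `a`-th of which takes
at most `τ a` steps; there are at most `A` iterations. -/
theorem Runs.loop {b : Test} {I : ℕ → State → Prop} (A : ℕ) (τ : ℕ → ℕ) (h0 : I 0 σ)
    (hstep : ∀ a σ', Frame P σ σ' → I a σ' → b.holds σ' → a < A ∧ Runs W P σ' (τ a) (I (a + 1))) :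
    Runs W (.loop b P) σ ((∑ a ∈ Finset.range A, (τ a + b.cost + 1)) + b.cost + 1)
      (fun σ' => (∃ a ≤ A, I a σ') ∧ ¬ b.holds σ') := by
  have key : ∀ d a σ', a + d = A → Frame P σ σ' → I a σ' →
      Runs W (.loop b P) σ' ((∑ a ∈ Finset.Ico a A, (τ a + b.cost + 1)) + b.cost + 1)
      (fun σ' => (∃ a ≤ A, I a σ') ∧ ¬ b.holds σ') := by
    intro d
    induction d with
    | zero =>
      intro a σ' ha hF hI
      have hb : ¬ b.holds σ' := fun hb => by have := (hstep a σ' hF hI hb).1; omega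
      exact ⟨_, _, by omega, .loopFalse _ _ _ hb, ⟨a, by omega, hI⟩, hb⟩
    | succ d ih =>
      intro a σ' ha hF hI
      by_cases hb : b.holds σ'
      · obtain ⟨hA, s, σ₁, hs, hE, hI'⟩ := hstep a σ' hF hI hb
        obtain ⟨t, σ₂, ht, hE', hq⟩ := ih (a + 1) σ₁ (by omega) (hF.trans hE.frame) hI'
        refine ⟨_, σ₂, ?_, .loopTrue _ _ _ _ _ _ _ hb hE hE', hq⟩
        rw [Finset.sum_eq_sum_Ico_succ_bot hA]
        omega
      · exact ⟨_, _, by omega, .loopFalse _ _ _ hb, ⟨a, by omega, hI⟩, hb⟩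
  have := key A 0 σ (by omega) (Frame.refl _ _) h0
  rwa [← Finset.range_eq_Ico] at this

/-- A loop whose body takes at most `c` steps and decreases the number `μ`. -/
theorem Runs.loop_measure {b : Test} {I : State → Prop} (μ : State → ℕ) (c : ℕ) (h0 : I σ)
    (hstep : ∀ σ', Frame P σ σ' → I σ' → b.holds σ' →
      Runs W P σ' c (fun σ'' => I σ'' ∧ μ σ'' < μ σ')) :
    Runs W (.loop b P) σ (μ σ * (c + b.cost + 1) + b.cost + 1)
      (fun σ' => I σ' ∧ ¬ b.holds σ') := by
  refine (Runs.loop (I := fun a σ' => I σ' ∧ a + μ σ' ≤ μ σ) (μ σ) (fun _ => c)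
    ⟨h0, by omega⟩ ?_).mono (by simp) ?_
  · rintro a σ' hF ⟨hI, ha⟩ hb
    have h := hstep σ' hF hI hb
    refine ⟨?_, h.mono le_rfl fun σ'' _ h => ⟨h.1, by omega⟩⟩
    obtain ⟨_, _, _, _, _, h⟩ := h
    omega
  · rintro σ' - ⟨⟨a, -, hI, -⟩, hb⟩
    exact ⟨hI, hb⟩

/-- The rule for `forUp`: iteration `i` takes at most `τ i` steps and leads from `I i` to
`I (i + 1)`. -/
theorem Runs.forUp {I : ℕ → State → Prop} {v : ℕ} {e : IExp} (N : ℕ) (τ : ℕ → ℕ) (hW : N ≤ W)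
    (hv : P.setsI v = false)
    (he : ∀ σ', Frame (.forUp v e P) σ σ' → e.eval σ' = N)
    (h0 : I 0 (σ.setIVar v 0))
    (hstep : ∀ i σ', Frame (.forUp v e P) σ σ' → i < N → σ'.ivar v = i → I i σ' →
      Runs W P σ' (τ i) (fun σ'' => I (i + 1) (σ''.setIVar v (i + 1)))) :
    Runs W (.forUp v e P) σ ((∑ i ∈ Finset.range N, (τ i + e.cost + 8)) + e.cost + 9)
      (fun σ' => I N σ' ∧ σ'.ivar v = N) := by
  have hfr : ∀ σ', Frame (P ;; .iset v (.add (.var v) (.const 1))) (σ.setIVar v 0) σ' →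
      Frame (.forUp v e P) σ σ' := by
    refine fun σ' hF => ⟨fun w hw => ?_, fun w hw => ?_, fun w hw => ?_, fun w hw => ?_⟩
    · simp only [Program.forUp, Program.setsI, Bool.or_eq_false_iff] at hw
      rw [hF.ivar w (by simp [Program.setsI, hw])]
      have : w ≠ v := fun h => by simp [h] at hw
      simp [this]
    · simp only [Program.forUp, Program.setsR, Bool.or_eq_false_iff] at hw
      exact hF.rvar w (by simp [Program.setsR, hw])
    · simp only [Program.forUp, Program.putsI, Bool.or_eq_false_iff] at hw
      exact hF.iarr w (by simp [Program.putsI, hw])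
    · simp only [Program.forUp, Program.putsR, Bool.or_eq_false_iff] at hw
      exact hF.rarr w (by simp [Program.putsR, hw])
  have hloop := Runs.loop (W := W) (σ := σ.setIVar v 0) (b := .not (.ile e (.var v)))
    (P := P ;; .iset v (.add (.var v) (.const 1))) (I := fun a σ' => I a σ' ∧ σ'.ivar v = a ∧ a ≤ N)
    N (fun i => τ i + 4) ⟨h0, by simp, by omega⟩ (by
      rintro a σ' hF ⟨hI, hva, haN⟩ hb
      have hF' := hfr σ' hF
      have haN : a < N := by
        simpa [Test.holds, IExp.eval, he σ' hF', hva] using hb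
      refine ⟨haN, (hstep a σ' hF' haN hva hI).seq fun σ'' hF'' hI'' => ?_⟩
      have hv'' : σ''.ivar v = a := (hF''.ivar v hv).trans hva
      simp only [runs_iset, IExp.eval, IExp.cost, hv'', setIVar_ivar, if_true]
      exact ⟨by omega, by omega, hI'', trivial, haN⟩)
  unfold Program.forUp
  rw [runs_seq_iset]
  have hcost : (∑ a ∈ Finset.range N, (τ a + 4 + (Test.not (.ile e (.var v))).cost + 1))
      = ∑ i ∈ Finset.range N, (τ i + e.cost + 8) := by
    refine Finset.sum_congr rfl fun i _ => ?_
    simp only [Test.cost, IExp.cost]; ring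
  refine ⟨by simp only [IExp.cost]; omega, by simp only [IExp.eval]; omega, hloop.mono ?_ ?_⟩
  · rw [hcost]; simp only [Test.cost, IExp.cost]; omega
  · rintro σ'' hF'' ⟨⟨a, haN, hI, hva, -⟩, hb⟩
    have hN := he σ'' (hfr σ'' ⟨hF''.ivar, hF''.rvar, hF''.iarr, hF''.rarr⟩)
    have : N ≤ a := by simpa [Test.holds, IExp.eval, hN, hva] using hb
    obtain rfl : a = N := by omega
    exact ⟨hI, hva⟩

/-- `forUp` up to the value of a variable, with iterations of constant cost. -/
theorem Runs.forVar {I : ℕ → State → Prop} {v u : ℕ} (N c : ℕ) (hN : σ.ivar u = N) (hW : N ≤ W)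
    (hv : P.setsI v = false) (hu : (Program.forUp v (.var u) P).setsI u = false)
    (h0 : I 0 (σ.setIVar v 0))
    (hstep : ∀ i σ', Frame (.forUp v (.var u) P) σ σ' → i < N → σ'.ivar v = i → I i σ' →
      Runs W P σ' c (fun σ'' => I (i + 1) (σ''.setIVar v (i + 1)))) :
    Runs W (.forUp v (.var u) P) σ (N * (c + 9) + 10) (I N) :=
  (Runs.forUp (I := I) N (fun _ => c) hW hv (fun _ hF => (hF.ivar u hu).trans hN) h0 hstep).mono
    (by simp [IExp.cost]) fun _ _ h => h.1

end Rules

attribute [simp] IExp.eval IExp.cost RExp.eval RExp.cost Test.holds Test.cost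

end RealRAM

/-! ### The cost as a Monge array -/

/-- `∑ i < k, (U i a + D i b + min (D i a) (U i b))`. -/
noncomputable def pairCost (k : ℕ) (U D : ℕ → ℕ → ℝ) (a b : ℕ) : ℝ :=
  ∑ i ∈ Finset.range k, (U i a + D i b + min (D i a) (U i b))

theorem min_add_min_le {d d' u u' : ℝ} (hd : d' ≤ d) (hu : u ≤ u') :
    min d u + min d' u' ≤ min d u' + min d' u := by
  rcases le_total d u with h1 | h1 <;> rcases le_total d' u' with h2 | h2 <;>
    rcases le_total d u' with h3 | h3 <;> rcases le_total d' u with h4 | h4 <;>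
    simp only [min_eq_left, min_eq_right, h1, h2, h3, h4] <;> linarith

section Monge
variable {k n : ℕ} {U D : ℕ → ℕ → ℝ}

/-- The cost is a Monge array, because the row only competes with the column in the terms
`min (D i a) (U i b)`, where one entry decreases and the other one increases. -/
theorem pairCost_monge (hU : ∀ i < k, ∀ p p', p ≤ p' → p' < n → U i p ≤ U i p')
    (hD : ∀ i < k, ∀ p p', p ≤ p' → p' < n → D i p' ≤ D i p) {a a' b b' : ℕ}
    (ha : a ≤ a') (ha' : a' < n) (hb : b ≤ b') (hb' : b' < n) :
    pairCost k U D a b + pairCost k U D a' b' ≤ pairCost k U D a b' + pairCost k U D a' b := by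
  simp only [pairCost, ← Finset.sum_add_distrib]
  refine Finset.sum_le_sum fun i hi => ?_
  rw [Finset.mem_range] at hi
  have := min_add_min_le (hD i hi a a' ha ha') (hU i hi b b' hb hb')
  linarith

/-- The optimal column `o` of the row `a` is at least as good as the columns before it, also for
the rows after `a`. -/
theorem pairCost_le_of_argmin_above (hU : ∀ i < k, ∀ p p', p ≤ p' → p' < n → U i p ≤ U i p')
    (hD : ∀ i < k, ∀ p p', p ≤ p' → p' < n → D i p' ≤ D i p) {a a' o : ℕ}
    (ha : a ≤ a') (ha' : a' < n) (ho : o < n)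
    (h : ∀ b < n, pairCost k U D a o ≤ pairCost k U D a b) {b : ℕ} (hb : b ≤ o) :
    pairCost k U D a' o ≤ pairCost k U D a' b := by
  have := pairCost_monge hU hD ha ha' hb ho
  have := h b (by omega)
  linarith

/-- The optimal column `o` of the row `a` is at least as good as the columns after it, also for
the rows before `a`. -/
theorem pairCost_le_of_argmin_below (hU : ∀ i < k, ∀ p p', p ≤ p' → p' < n → U i p ≤ U i p')
    (hD : ∀ i < k, ∀ p p', p ≤ p' → p' < n → D i p' ≤ D i p) {a a' o : ℕ}
    (ha : a' ≤ a) (ha' : a < n)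
    (h : ∀ b < n, pairCost k U D a o ≤ pairCost k U D a b) {b : ℕ} (hb : o ≤ b) (hbn : b < n) :
    pairCost k U D a' o ≤ pairCost k U D a' b := by
  have := pairCost_monge hU hD ha ha' hb hbn
  have := h b hbn
  linarith

end Monge

/-! ### The rising and the falling part of a unimodal function -/

/-- `c` is a point up to which `f` is non-increasing and from which on it is non-decreasing. -/
def UnimodalAt (f : ℝ → ℝ) (c : ℝ) : Prop :=
  (∀ x y : ℝ, x ≤ y → y ≤ c → f y ≤ f x) ∧ (∀ x y : ℝ, c ≤ x → x ≤ y → f x ≤ f y)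

/-- The rising part of a function with minimum at `c`. -/
def rise (f : ℝ → ℝ) (c x : ℝ) : ℝ := f (max x c) - f c

/-- The falling part of a function with minimum at `c`. -/
def fall (f : ℝ → ℝ) (c x : ℝ) : ℝ := f (min x c) - f c

theorem rise_add_fall (f : ℝ → ℝ) (c x : ℝ) : rise f c x + fall f c x = f x - f c := by
  unfold rise fall
  rcases le_total x c with h | h <;> simp [h]

section Split
variable {f : ℝ → ℝ} {c : ℝ} (hf : UnimodalAt f c)
include hf

theorem rise_mono : Monotone (rise f c) := fun _ _ h =>
  sub_le_sub_right (hf.2 _ _ (le_max_right _ _) (max_le_max_right _ h)) _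

theorem fall_anti : Antitone (fall f c) := fun _ _ h =>
  sub_le_sub_right (hf.1 _ _ (min_le_min_right _ h) (min_le_right _ _)) _

theorem rise_nonneg (x : ℝ) : 0 ≤ rise f c x := sub_nonneg.2 (hf.2 _ _ le_rfl (le_max_right _ _))

theorem fall_nonneg (x : ℝ) : 0 ≤ fall f c x := sub_nonneg.2 (hf.1 _ _ (min_le_right _ _) le_rfl)

/-- The right-hand side is the smaller one of `f a + fall f c b` and `f b + rise f c a`. -/
theorem min_le_rise_fall (a b : ℝ) :
    min (f a) (f b) ≤ f c + (rise f c a + fall f c b + min (fall f c a) (rise f c b)) := by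
  have ha := rise_add_fall f c a
  have hb := rise_add_fall f c b
  have h1 := rise_nonneg hf a
  have h2 := fall_nonneg hf b
  rcases le_total (fall f c a) (rise f c b) with h | h
  · rw [min_eq_left h]; exact (min_le_left _ _).trans (by linarith)
  · rw [min_eq_right h]; exact (min_le_right _ _).trans (by linarith)

theorem min_eq_rise_fall {a b : ℝ} (hab : a ≤ b) :
    min (f a) (f b) = f c + (rise f c a + fall f c b + min (fall f c a) (rise f c b)) := by
  refine le_antisymm (min_le_rise_fall hf a b) ?_
  have ha := rise_add_fall f c a
  have hb := rise_add_fall f c b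
  have h1 := rise_mono hf hab
  have h2 := fall_anti hf hab
  have h3 := rise_nonneg hf a
  have h4 := fall_nonneg hf b
  have h5 : c ≤ b → fall f c b = 0 := fun h => by simp [fall, h]
  have h6 : a ≤ c → rise f c a = 0 := fun h => by simp [rise, h]
  have h7 : b ≤ c → rise f c b = 0 := fun h => by simp [rise, h]
  have h8 : c ≤ a → fall f c a = 0 := fun h => by simp [fall, h]
  refine le_min ?_ ?_
  · rcases le_total c b with h | h
    · have := h5 h; have := min_le_left (fall f c a) (rise f c b); linarith
    · have := h6 (hab.trans h); have := h7 h
      have := min_le_right (fall f c a) (rise f c b); linarith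
  · rcases le_total a c with h | h
    · have := h6 h; have := min_le_right (fall f c a) (rise f c b); linarith
    · have := h8 h; have := h5 (h.trans hab)
      have := min_le_left (fall f c a) (rise f c b); linarith

/-- Where `f` has slope `m`, its rising part has slope `max m 0`: if `c` lies strictly
between `x` and `y`, then `m = 0`. -/
theorem rise_affine {s : Set ℝ} (hs : s.OrdConnected) {m : ℝ}
    (hm : ∀ x ∈ s, ∀ y ∈ s, f y - f x = m * (y - x)) {x y : ℝ} (hx : x ∈ s) (hy : y ∈ s) :
    rise f c y - rise f c x = max m 0 * (y - x) := by
  wlog hxy : x ≤ y generalizing x y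
  · have := this hy hx (le_of_not_ge hxy); linarith
  rcases hxy.eq_or_lt with rfl | hlt
  · simp
  have h := hm x hx y hy
  unfold rise
  rcases le_or_gt c x with h1 | h1
  · have : 0 ≤ m := by
      have := hf.2 x y h1 hxy
      by_contra hneg
      nlinarith
    rw [max_eq_left this, max_eq_left h1, max_eq_left (h1.trans hxy)]; linarith
  · rcases le_total y c with h2 | h2
    · have : m ≤ 0 := by
        have := hf.1 x y hxy h2
        by_contra hneg
        nlinarith
      rw [max_eq_right this, max_eq_right h1.le, max_eq_right h2]; ring
    · have hc : c ∈ s := hs.out hx hy ⟨h1.le, h2⟩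
      have e1 := hm x hx c hc
      have e2 := hm c hc y hy
      have i1 := hf.1 x c h1.le le_rfl
      have i2 := hf.2 c y le_rfl h2
      have : m ≤ 0 := by
        by_contra hneg
        nlinarith
      rw [max_eq_right this, max_eq_right h1.le, max_eq_left h2]
      nlinarith

theorem fall_affine {s : Set ℝ} (hs : s.OrdConnected) {m : ℝ}
    (hm : ∀ x ∈ s, ∀ y ∈ s, f y - f x = m * (y - x)) {x y : ℝ} (hx : x ∈ s) (hy : y ∈ s) :
    fall f c y - fall f c x = min m 0 * (y - x) := by
  have h1 := rise_affine hf hs hm hx hy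
  have h2 := hm x hx y hy
  have h3 := rise_add_fall f c x
  have h4 := rise_add_fall f c y
  have h5 := min_add_max m 0
  have : min m 0 = m - max m 0 := by linarith
  rw [this]; linarith

end Split

/-! ### Pieces of a piecewise-linear function -/

/-- The slope of the `j`-th of the `m + 1` pieces of the piecewise-linear function with breakpoints
`x 0, …, x (m - 1)`, values `y` there, initial slope `s₀` and final slope `s₁`; piece `j` ends at
`x j`. -/
noncomputable def pieceSlope (m : ℕ) (x y : ℕ → ℝ) (s₀ s₁ : ℝ) (j : ℕ) : ℝ :=
  if j = 0 then s₀ else if j < m then (y j - y (j - 1)) / (x j - x (j - 1)) else s₁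

/-- The interval of piece `j`. -/
def pieceSet (m : ℕ) (x : ℕ → ℝ) (j : ℕ) : Set ℝ :=
  {u | (∀ l < j, x l ≤ u) ∧ ∀ l, j ≤ l → l < m → u ≤ x l}

theorem ordConnected_pieceSet (m : ℕ) (x : ℕ → ℝ) (j : ℕ) : (pieceSet m x j).OrdConnected :=
  ⟨fun _ hu _ hv _ hw => ⟨fun l hl => (hu.1 l hl).trans hw.1,
    fun l hl hm => hw.2.trans (hv.2 l hl hm)⟩⟩

section Pieces
variable {E : PLData} {f : ℝ → ℝ} {x y : ℕ → ℝ} {c : ℝ}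

/-- On the interval of each piece, `f` is affine with the slope of the piece. -/
theorem PLData.Represents.affine (h : E.Represents f) (hx : ∀ j : Fin E.size, x j = E.x j)
    (hy : ∀ j : Fin E.size, y j = E.y j) {j : ℕ} (hj : j ≤ E.size) :
    ∀ u ∈ pieceSet E.size x j, ∀ v ∈ pieceSet E.size x j,
      f v - f u = pieceSlope E.size x y E.initialSlope E.finalSlope j * (v - u) := by
  intro u hu v hv
  unfold pieceSlope
  split_ifs with h1 h2
  · subst h1
    exact h.left u v (fun j => hx j ▸ hu.2 j (Nat.zero_le _) j.2)
      (fun j => hx j ▸ hv.2 j (Nat.zero_le _) j.2)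
  · have e0 : x (j - 1) = E.x ⟨j - 1, by omega⟩ := hx ⟨j - 1, by omega⟩
    have e1 : x j = E.x ⟨j, h2⟩ := hx ⟨j, h2⟩
    have e2 : y (j - 1) = E.y ⟨j - 1, by omega⟩ := hy ⟨j - 1, by omega⟩
    have e3 : y j = E.y ⟨j, h2⟩ := hy ⟨j, h2⟩
    have key : ∀ w ∈ pieceSet E.size x j,
        f w = y (j - 1) + (y j - y (j - 1)) / (x j - x (j - 1)) * (w - x (j - 1)) := by
      intro w hw
      rw [e0, e1, e2, e3]
      refine h.between ⟨j - 1, by omega⟩ ⟨j, h2⟩ (by simp; omega) w ⟨?_, ?_⟩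
      · rw [← e0]; exact hw.1 _ (by omega)
      · rw [← e1]; exact hw.2 _ le_rfl h2
    rw [key u hu, key v hv]; ring
  · obtain rfl : j = E.size := by omega
    exact h.right u v (fun j => hx j ▸ hu.1 j j.2) (fun j => hx j ▸ hv.1 j j.2)

/-- The lines `ua j + ub j * u` and `da j + db j * u` are glued from pieces with the slopes
`max (slope j) 0` and `min (slope j) 0`, starting with `0` on the left and on the right. -/
structure Lines (m : ℕ) (x slope ua ub da db : ℕ → ℝ) : Prop where
  ua_zero : ua 0 = 0
  ub_zero : ub 0 = 0
  ub_succ : ∀ j < m, ub (j + 1) = max (slope (j + 1)) 0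
  ua_succ : ∀ j < m, ua (j + 1) = ua j + (ub j - ub (j + 1)) * x j
  da_last : da m = 0
  db_last : db m = 0
  db_eq : ∀ j < m, db j = min (slope j) 0
  da_eq : ∀ j < m, da j = da (j + 1) + (db (j + 1) - db j) * x j

theorem first_slope_nonpos (h : E.Represents f) (hx : ∀ j : Fin E.size, x j = E.x j)
    (hy : ∀ j : Fin E.size, y j = E.y j) (hf : UnimodalAt f c) :
    pieceSlope E.size x y E.initialSlope E.finalSlope 0 ≤ 0 := by
  obtain ⟨B, hB⟩ : ∃ B : ℝ, ∀ l < E.size, B ≤ x l := by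
    obtain ⟨B, hB⟩ := ((Finset.range E.size).image x).bddBelow
    exact ⟨B, fun l hl => hB (by simpa using ⟨l, hl, rfl⟩)⟩
  have hm : ∀ u ≤ min B c, u ∈ pieceSet E.size x 0 := fun u hu =>
    ⟨fun l hl => by omega, fun l _ hl => (hu.trans (min_le_left _ _)).trans (hB l hl)⟩
  have := h.affine hx hy (Nat.zero_le _) (min B c - 1) (hm _ (by linarith)) _ (hm _ le_rfl)
  have h2 := hf.1 (min B c - 1) (min B c) (by linarith) (min_le_right _ _)
  linarith

theorem last_slope_nonneg (h : E.Represents f) (hx : ∀ j : Fin E.size, x j = E.x j)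
    (hy : ∀ j : Fin E.size, y j = E.y j) (hf : UnimodalAt f c) :
    0 ≤ pieceSlope E.size x y E.initialSlope E.finalSlope E.size := by
  obtain ⟨B, hB⟩ : ∃ B : ℝ, ∀ l < E.size, x l ≤ B := by
    obtain ⟨B, hB⟩ := ((Finset.range E.size).image x).bddAbove
    exact ⟨B, fun l hl => hB (by simpa using ⟨l, hl, rfl⟩)⟩
  have hm : ∀ u, max B c ≤ u → u ∈ pieceSet E.size x E.size := fun u hu =>
    ⟨fun l hl => (hB l hl).trans ((le_max_left _ _).trans hu), fun l _ hl => by omega⟩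
  have := h.affine hx hy le_rfl _ (hm _ le_rfl) (max B c + 1) (hm _ (by linarith))
  have h2 := hf.2 (max B c) (max B c + 1) (le_max_right _ _) (by linarith)
  linarith

/-- The rising part vanishes on the first piece, and continuity at the breakpoints determines
each line from the one before. -/
theorem rise_eq_line (h : E.Represents f) (hx : ∀ j : Fin E.size, x j = E.x j)
    (hy : ∀ j : Fin E.size, y j = E.y j) (hf : UnimodalAt f c) {ua ub da db : ℕ → ℝ}
    (hl : Lines E.size x (pieceSlope E.size x y E.initialSlope E.finalSlope) ua ub da db)
    {j : ℕ} (hj : j ≤ E.size) : ∀ u ∈ pieceSet E.size x j, rise f c u = ua j + ub j * u := by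
  have hmono : ∀ l l', l ≤ l' → l' < E.size → x l ≤ x l' := fun l l' hll hl' => by
    rw [hx ⟨l, by omega⟩, hx ⟨l', hl'⟩]; exact h.strictMono.monotone (by simpa using hll)
  induction j with
  | zero =>
    intro u hu
    have hu' : min u c ∈ pieceSet E.size x 0 :=
      ⟨fun l hl => by omega, fun l h0 hl => (min_le_left _ _).trans (hu.2 l h0 hl)⟩
    have h1 := rise_affine hf (ordConnected_pieceSet _ _ _) (h.affine hx hy hj) hu' hu
    rw [max_eq_right (first_slope_nonpos h hx hy hf)] at h1
    have h2 : rise f c (min u c) = 0 := by simp [rise]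
    rw [hl.ua_zero, hl.ub_zero]; linarith
  | succ j ih =>
    intro u hu
    have hj' : j < E.size := by omega
    have hm1 : x j ∈ pieceSet E.size x (j + 1) :=
      ⟨fun l hl => hmono l j (by omega) hj', fun l h0 hl => hmono j l (by omega) hl⟩
    have hm0 : x j ∈ pieceSet E.size x j :=
      ⟨fun l hl => hmono l j (by omega) hj', fun l h0 hl => hmono j l (by omega) hl⟩
    have h1 := rise_affine hf (ordConnected_pieceSet _ _ _) (h.affine hx hy hj) hm1 hu
    have h2 := ih (by omega) _ hm0
    rw [hl.ua_succ j hj', hl.ub_succ j hj']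
    rw [h2] at h1
    linarith

/-- The falling part vanishes on the last piece, and continuity at the breakpoints determines
each line from the one after. -/
theorem fall_eq_line (h : E.Represents f) (hx : ∀ j : Fin E.size, x j = E.x j)
    (hy : ∀ j : Fin E.size, y j = E.y j) (hf : UnimodalAt f c) {ua ub da db : ℕ → ℝ}
    (hl : Lines E.size x (pieceSlope E.size x y E.initialSlope E.finalSlope) ua ub da db)
    {j : ℕ} (hj : j ≤ E.size) : ∀ u ∈ pieceSet E.size x j, fall f c u = da j + db j * u := by
  have hmono : ∀ l l', l ≤ l' → l' < E.size → x l ≤ x l' := fun l l' hll hl' => by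
    rw [hx ⟨l, by omega⟩, hx ⟨l', hl'⟩]; exact h.strictMono.monotone (by simpa using hll)
  induction hj using Nat.decreasingInduction with
  | self =>
    intro u hu
    have hu' : max u c ∈ pieceSet E.size x E.size :=
      ⟨fun l hl => (hu.1 l hl).trans (le_max_left _ _), fun l h0 hl => by omega⟩
    have h1 := fall_affine hf (ordConnected_pieceSet _ _ _) (h.affine hx hy le_rfl) hu' hu
    rw [min_eq_right (last_slope_nonneg h hx hy hf)] at h1
    have h2 : fall f c (max u c) = 0 := by simp [fall]
    rw [hl.da_last, hl.db_last]; linarith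
  | of_succ j hj ih =>
    intro u hu
    have hm1 : x j ∈ pieceSet E.size x (j + 1) :=
      ⟨fun l hl => hmono l j (by omega) hj, fun l h0 hl => hmono j l (by omega) hl⟩
    have hm0 : x j ∈ pieceSet E.size x j :=
      ⟨fun l hl => hmono l j (by omega) hj, fun l h0 hl => hmono j l (by omega) hl⟩
    have h1 := fall_affine hf (ordConnected_pieceSet _ _ _) (h.affine hx hy hj.le) hm0 hu
    have h2 := ih _ hm1
    rw [hl.da_eq j hj, hl.db_eq j hj]
    rw [h2] at h1
    linarith

end Pieces

/-! ### Reduction to the breakpoints -/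

section Candidates
variable {k : ℕ} {D : Fin k → PLData} {f : Fin k → ℝ → ℝ} {n : ℕ} {xs : ℕ → ℝ}

/-- A sum of some of the functions is at least as small at some breakpoint as at a given point. -/
theorem exists_candidate_sum_le (hD : ∀ i, (D i).Represents (f i)) (hf : ∀ i, Unimodal (f i))
    (hn : 0 < n) (hxs : ∀ p p', p ≤ p' → p' < n → xs p ≤ xs p')
    (hbp : ∀ i j, ∃ p < n, xs p = (D i).x j) (s : Finset (Fin k)) (u : ℝ) :
    ∃ p < n, ∑ i ∈ s, f i (xs p) ≤ ∑ i ∈ s, f i u := by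
  have hx : ∀ i, ∃ x y : ℕ → ℝ, (∀ j : Fin (D i).size, x j = (D i).x j) ∧
      (∀ j : Fin (D i).size, y j = (D i).y j) := fun i =>
    ⟨fun j => if h : j < (D i).size then (D i).x ⟨j, h⟩ else 0,
      fun j => if h : j < (D i).size then (D i).y ⟨j, h⟩ else 0, by simp, by simp⟩
  choose x y hx hy using hx
  have hbp' : ∀ i, ∀ l < (D i).size, ∃ p < n, xs p = x i l := fun i l hl => by
    obtain ⟨p, hp, h⟩ := hbp i ⟨l, hl⟩
    exact ⟨p, hp, h.trans (hx i ⟨l, hl⟩).symm⟩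
  choose c hc using hf
  by_cases h0 : u ≤ xs 0
  · refine ⟨0, hn, Finset.sum_le_sum fun i _ => ?_⟩
    have hle : ∀ l < (D i).size, xs 0 ≤ x i l := fun l hl => by
      obtain ⟨p, hp, h⟩ := hbp' i l hl
      rw [← h]; exact hxs 0 p (Nat.zero_le _) hp
    have := (hD i).affine (hx i) (hy i) (Nat.zero_le _) u
      ⟨fun l hl => by omega, fun l _ hl => h0.trans (hle l hl)⟩ (xs 0)
      ⟨fun l hl => by omega, fun l _ hl => hle l hl⟩
    have h1 := first_slope_nonpos (hD i) (hx i) (hy i) (hc i)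
    nlinarith
  push Not at h0
  by_cases h1 : xs (n - 1) ≤ u
  · refine ⟨n - 1, by omega, Finset.sum_le_sum fun i _ => ?_⟩
    have hle : ∀ l < (D i).size, x i l ≤ xs (n - 1) := fun l hl => by
      obtain ⟨p, hp, h⟩ := hbp' i l hl
      rw [← h]; exact hxs p (n - 1) (by omega) (by omega)
    have := (hD i).affine (hx i) (hy i) le_rfl (xs (n - 1))
      ⟨fun l hl => hle l hl, fun l _ hl => by omega⟩ u
      ⟨fun l hl => (hle l hl).trans h1, fun l _ hl => by omega⟩
    have h2 := last_slope_nonneg (hD i) (hx i) (hy i) (hc i)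
    nlinarith
  push Not at h1
  obtain ⟨p, hp, hp0, hp1⟩ : ∃ p, p + 1 < n ∧ xs p ≤ u ∧ u ≤ xs (p + 1) := by
    classical
    have hex : ∃ q, u < xs q := ⟨n - 1, h1⟩
    have hq0 : Nat.find hex ≠ 0 := fun h => by
      have := Nat.find_spec hex; rw [h] at this; linarith
    have hqn : Nat.find hex ≤ n - 1 := Nat.find_min' hex h1
    refine ⟨Nat.find hex - 1, by omega, not_lt.1 (Nat.find_min hex (by omega)), ?_⟩
    rw [Nat.sub_add_cancel (by omega)]
    exact (Nat.find_spec hex).le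
  have haff : ∀ i, ∃ m : ℝ, ∀ v ∈ Set.Icc (xs p) (xs (p + 1)), ∀ w ∈ Set.Icc (xs p) (xs (p + 1)),
      f i w - f i v = m * (w - v) := by
    intro i
    have hgap : ∀ l < (D i).size, x i l ≤ xs p ∨ xs (p + 1) ≤ x i l := fun l hl => by
      obtain ⟨q, hq, h⟩ := hbp' i l hl
      rw [← h]
      rcases Nat.lt_or_ge p q with hpq | hpq
      · exact Or.inr (hxs _ _ hpq hq)
      · exact Or.inl (hxs _ _ hpq (by omega))
    obtain ⟨j, hj, hj1, hj2⟩ : ∃ j ≤ (D i).size, (∀ l < j, x i l ≤ xs p) ∧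
        ∀ l, j ≤ l → l < (D i).size → xs (p + 1) ≤ x i l := by
      classical
      have hex : ∃ j, j = (D i).size ∨ xs (p + 1) ≤ x i j := ⟨_, Or.inl rfl⟩
      have hle : Nat.find hex ≤ (D i).size := Nat.find_min' hex (Or.inl rfl)
      refine ⟨Nat.find hex, hle, fun l hl => ?_, fun l hl hls => ?_⟩
      · have := Nat.find_min hex hl
        push Not at this
        exact (hgap l (by omega)).resolve_right (not_le.2 this.2)
      · rcases Nat.find_spec hex with h | h
        · omega
        · refine h.trans ?_
          rw [hx i ⟨_, by omega⟩, hx i ⟨l, hls⟩]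
          exact (hD i).strictMono.monotone (by simpa using hl)
    refine ⟨_, fun v hv w hw => (hD i).affine (hx i) (hy i) hj v
      ⟨fun l hl => (hj1 l hl).trans hv.1, fun l hl hm => hv.2.trans (hj2 l hl hm)⟩ w
      ⟨fun l hl => (hj1 l hl).trans hw.1, fun l hl hm => hw.2.trans (hj2 l hl hm)⟩⟩
  choose m hm using haff
  have hp01 := hp0.trans hp1
  have e0 : ∑ i ∈ s, f i (xs p) = ∑ i ∈ s, f i u + (∑ i ∈ s, m i) * (xs p - u) := by
    rw [Finset.sum_mul, ← Finset.sum_add_distrib]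
    refine Finset.sum_congr rfl fun i _ => ?_
    have := hm i u ⟨hp0, hp1⟩ (xs p) ⟨le_rfl, hp01⟩
    linarith
  have e1 : ∑ i ∈ s, f i (xs (p + 1)) = ∑ i ∈ s, f i u + (∑ i ∈ s, m i) * (xs (p + 1) - u) := by
    rw [Finset.sum_mul, ← Finset.sum_add_distrib]
    refine Finset.sum_congr rfl fun i _ => ?_
    have := hm i u ⟨hp0, hp1⟩ (xs (p + 1)) ⟨hp01, le_rfl⟩
    linarith
  rcases le_total 0 (∑ i ∈ s, m i) with h | h
  · exact ⟨p, by omega, by rw [e0]; nlinarith⟩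
  · exact ⟨p + 1, hp, by rw [e1]; nlinarith⟩

/-- The cost of a pair is at least that of some pair of breakpoints: once it is fixed which
functions are charged to `a` and which to `b`, both sums can be minimized separately. -/
theorem exists_candidate_cost_le (hD : ∀ i, (D i).Represents (f i)) (hf : ∀ i, Unimodal (f i))
    (hn : 0 < n) (hxs : ∀ p p', p ≤ p' → p' < n → xs p ≤ xs p')
    (hbp : ∀ i j, ∃ p < n, xs p = (D i).x j) (a b : ℝ) :
    ∃ p < n, ∃ q < n, twoMedianCost f (xs p) (xs q) ≤ twoMedianCost f a b := by
  classical
  obtain ⟨p, hp, h1⟩ := exists_candidate_sum_le hD hf hn hxs hbp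
    (Finset.univ.filter fun i => f i a ≤ f i b) a
  obtain ⟨q, hq, h2⟩ := exists_candidate_sum_le hD hf hn hxs hbp
    (Finset.univ.filter fun i => ¬ f i a ≤ f i b) b
  refine ⟨p, hp, q, hq, ?_⟩
  unfold twoMedianCost
  rw [← Finset.sum_filter_add_sum_filter_not Finset.univ (fun i => f i a ≤ f i b),
    ← Finset.sum_filter_add_sum_filter_not (s := Finset.univ) (fun i => f i a ≤ f i b)
      (f := fun i => min (f i a) (f i b))]
  refine add_le_add ?_ ?_
  · calc _ ≤ ∑ i ∈ Finset.univ.filter (fun i => f i a ≤ f i b), f i (xs p) :=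
          Finset.sum_le_sum fun i _ => min_le_left _ _
      _ ≤ _ := h1
      _ = _ := Finset.sum_congr rfl fun i hi => (min_eq_left (by simpa using hi)).symm
  · calc _ ≤ ∑ i ∈ Finset.univ.filter (fun i => ¬ f i a ≤ f i b), f i (xs q) :=
          Finset.sum_le_sum fun i _ => min_le_right _ _
      _ ≤ _ := h2
      _ = _ := Finset.sum_congr rfl fun i hi =>
        (min_eq_right (le_of_lt (by simpa using hi))).symm

end Candidates

/-! ### Arithmetic of the running time -/

/-- If `k ^ 2 < n`, then `k * log n` is below `n`, up to a constant; otherwise `log n` is at most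
`2 * log k`. -/
theorem mul_log_le (n k : ℕ) (hn : 1 ≤ n) :
    (k : ℝ) * Real.log n ≤ 2 * (n + k * Real.log k) := by
  have hn' : (1 : ℝ) ≤ n := by exact_mod_cast hn
  have hk0 : (0 : ℝ) ≤ k := k.cast_nonneg
  have hkl : 0 ≤ (k : ℝ) * Real.log k := mul_nonneg hk0 (Real.log_natCast_nonneg k)
  rcases Nat.lt_or_ge (k ^ 2) n with h | h
  · have hs : (k : ℝ) ≤ √n := Real.le_sqrt_of_sq_le (by exact_mod_cast h.le)
    have hl : Real.log n ≤ 2 * √n := by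
      have h1 : Real.log n = 2 * Real.log (√n) := by
        rw [Real.log_sqrt (by linarith)]; ring
      rw [h1]
      have := Real.log_le_self (Real.sqrt_nonneg (n : ℝ))
      linarith
    have := mul_le_mul hs hl (Real.log_natCast_nonneg n) (Real.sqrt_nonneg _)
    have h2 := Real.mul_self_sqrt (show (0 : ℝ) ≤ n by linarith)
    nlinarith
  · have : Real.log n ≤ 2 * Real.log k := by
      have h1 : Real.log n ≤ Real.log ((k : ℝ) ^ 2) :=
        Real.log_le_log (by linarith) (by exact_mod_cast h)
      rwa [Real.log_pow] at h1
    nlinarith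

theorem time_bound {n k : ℕ} (hn : 2 ≤ n) :
    ((n : ℝ) + k * (Nat.log 2 n + 1)) * (Nat.log 2 n + 1) ≤
      30 * ((n + k * Real.log k) * Real.log n) := by
  have hn' : (2 : ℝ) ≤ n := by exact_mod_cast hn
  have hk0 : (0 : ℝ) ≤ k := k.cast_nonneg
  have hkl : 0 ≤ (k : ℝ) * Real.log k := mul_nonneg hk0 (Real.log_natCast_nonneg k)
  have hL : ((Nat.log 2 n : ℕ) : ℝ) + 1 ≤ 3 * Real.log n := by
    have h1 : ((2 : ℝ) ^ Nat.log 2 n) ≤ n := by exact_mod_cast Nat.pow_log_le_self 2 (by omega)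
    have h2 := Real.log_le_log (by positivity) h1
    rw [Real.log_pow] at h2
    have h3 := Real.log_le_log (by norm_num) hn'
    have h4 := Real.log_two_gt_d9
    nlinarith [(Nat.log 2 n).cast_nonneg (α := ℝ)]
  have hlog : 0 ≤ Real.log n := Real.log_natCast_nonneg n
  have h1 := mul_log_le n k (by omega)
  have h2 : (n : ℝ) + k * (Nat.log 2 n + 1) ≤ 7 * (n + k * Real.log k) := by nlinarith
  calc _ ≤ (7 * (n + k * Real.log k)) * (3 * Real.log n) :=
        mul_le_mul h2 hL (by positivity) (by positivity)
    _ ≤ _ := by nlinarith [mul_nonneg (add_nonneg (by linarith : (0:ℝ) ≤ n) hkl) hlog]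

namespace RealRAM

/-! ### Memory layout -/

/-! The integer variables. `vK` and `vN` are the numbers of functions and of breakpoints. `vH` is the
width of the blocks to be merged, later the distance parameter of a level. For merging, `vI` and `vJ`
are the heads of the two blocks, `vIE` and `vJE` their ends, and `vNx` the start of the next pair of
blocks; later these five are auxiliary. `vP` and `vL` are loop counters. `vT` is the length of a path,
`vR`, `vB`, `vHi` are its current row and column and the last column of the row. `vF` is the current
function, `vO` and `vQ` are the positions of its first breakpoint and first piece, and `vM` is their
number. `vS` and `vE` enclose the time of crossing, while the path is in piece `vQA` with its row and
in piece `vQB` with its column; `vLo`, `vUp`, `vMid` serve for the bisection. `vRow` is a row. -/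

notation "vK" => 0
notation "vN" => 1
notation "vH" => 2
notation "vP" => 3
notation "vI" => 4
notation "vIE" => 5
notation "vJ" => 6
notation "vJE" => 7
notation "vNx" => 8
notation "vT" => 9
notation "vR" => 10
notation "vB" => 11
notation "vHi" => 12
notation "vF" => 13
notation "vQ" => 14
notation "vS" => 15
notation "vE" => 16
notation "vQA" => 17
notation "vQB" => 18
notation "vLo" => 19
notation "vUp" => 20
notation "vMid" => 21
notation "vM" => 22
notation "vL" => 23
notation "vO" => 24
notation "vRow" => 25

/-! The integer arrays: offsets of the functions; the sorting permutation of the breakpoints, a copy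
for merging, and its inverse; the candidates at which the pieces start; the optimal columns of the
rows; the rows and columns of a path; the first times at which they reach each candidate. -/

notation "aOff" => 0
notation "aOrd" => 1
notation "aTmp" => 2
notation "aRnk" => 3
notation "aSt" => 4
notation "aOpt" => 5
notation "aPA" => 6
notation "aPB" => 7
notation "aTA" => 8
notation "aTB" => 9

/-! The real variables besides the two outputs, for slopes and sums, and the real arrays: the four
parts of the input; the sorted breakpoints; constant terms and slopes of the pieces of the rising
and of the falling parts; the differences that encode the costs along a path (constant terms, and
coefficients of the row and of the column); the optimal values of the rows. -/

notation "xS" => 2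
notation "xC" => 3
notation "xCA" => 4
notation "xCB" => 5
notation "xVal" => 6
notation "rX" => 0
notation "rY" => 1
notation "rS0" => 2
notation "rS1" => 3
notation "rXS" => 4
notation "rUA" => 5
notation "rUB" => 6
notation "rDA" => 7
notation "rDB" => 8
notation "rCC" => 9
notation "rCA" => 10
notation "rCB" => 11
notation "rOV" => 12

/-- The minimum of two integer expressions, by truncated subtraction. -/
def IExp.min (e e' : IExp) : IExp := .sub e (.sub e e')

/-- The maximum of two integer expressions, by truncated subtraction. -/
def IExp.max (e e' : IExp) : IExp := .add e' (.sub e e')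

@[simp] theorem eval_min (σ : State) (e e' : IExp) :
    (IExp.min e e').eval σ = Min.min (e.eval σ) (e'.eval σ) := by
  simp only [IExp.min, IExp.eval]; omega

@[simp] theorem eval_max (σ : State) (e e' : IExp) :
    (IExp.max e e').eval σ = Max.max (e.eval σ) (e'.eval σ) := by
  simp only [IExp.max, IExp.eval]; omega

@[simp] theorem cost_min (e e' : IExp) : (IExp.min e e').cost = 2 * e.cost + e'.cost + 2 := by
  simp only [IExp.min, IExp.cost]; omega

@[simp] theorem cost_max (e e' : IExp) : (IExp.max e e').cost = e.cost + 2 * e'.cost + 2 := by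
  simp only [IExp.max, IExp.cost]; omega

/-! ### Merge sort of the breakpoints -/

/-- The keys `X (A p)` increase within each block of `b` consecutive positions below `N`. -/
def SortedBlocks (X : ℕ → ℝ) (A : ℕ → ℕ) (N b : ℕ) : Prop :=
  ∀ m p p', b * m ≤ p → p ≤ p' → p' < b * (m + 1) → p' < N → X (A p) ≤ X (A p')

/-- Every number below `N` is a value of `A` below `N`. -/
def Covers (A : ℕ → ℕ) (N : ℕ) : Prop := ∀ e < N, ∃ p < N, A p = e

/-- A surjection of a finite set onto itself takes no other values. -/
theorem Covers.lt {A : ℕ → ℕ} {N : ℕ} (h : Covers A N) {p : ℕ} (hp : p < N) : A p < N := by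
  have hsub : Finset.range N ⊆ (Finset.range N).image A := fun e he => by
    obtain ⟨q, hq, rfl⟩ := h e (Finset.mem_range.1 he)
    exact Finset.mem_image_of_mem _ (Finset.mem_range.2 hq)
  have := Finset.eq_of_subset_of_card_le hsub Finset.card_image_le
  exact Finset.mem_range.1 (this ▸ Finset.mem_image_of_mem A (Finset.mem_range.2 hp))

theorem Covers.inj {A : ℕ → ℕ} {N : ℕ} (h : Covers A N) {p q : ℕ} (hp : p < N) (hq : q < N)
    (hpq : A p = A q) : p = q := by
  have hsub : Finset.range N ⊆ (Finset.range N).image A := fun e he => by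
    obtain ⟨q, hq, rfl⟩ := h e (Finset.mem_range.1 he)
    exact Finset.mem_image_of_mem _ (Finset.mem_range.2 hq)
  have hc := Finset.card_le_card hsub
  have : ((Finset.range N).image A).card = (Finset.range N).card :=
    le_antisymm Finset.card_image_le hc
  exact Finset.card_image_iff.1 this (by simpa using hp) (by simpa using hq) hpq

/-- The state of the merging of blocks `2 * m` and `2 * m + 1` of width `h`: of the former, the
entries from `i` to `ie`, and of the latter those from `j` to `je` are left; `p` entries have been
written to `B`. -/
structure Merging (X : ℕ → ℝ) (A B : ℕ → ℕ) (N h m p i ie j je : ℕ) : Prop where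
  ie_eq : ie = min (2 * h * m + h) N
  je_eq : je = min (2 * h * m + 2 * h) N
  le_i : 2 * h * m ≤ i
  i_le : i ≤ ie
  le_j : ie ≤ j
  j_le : j ≤ je
  count : p + ie = i + j
  covered : ∀ q, (q < i ∨ ie ≤ q ∧ q < j) → ∃ p' < p, B p' = A q
  sorted : SortedBlocks X B p (2 * h)
  head : ∀ p', 2 * h * m ≤ p' → p' < p →
    ∀ q, (i ≤ q ∧ q < ie ∨ j ≤ q ∧ q < je) → X (B p') ≤ X (A q)

section Merging
variable {X : ℕ → ℝ} {A B : ℕ → ℕ} {N h m p i ie j je : ℕ}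

theorem Merging.zero : Merging X A B N h 0 0 0 (min h N) (min h N) (min (h + h) N) where
  ie_eq := by simp
  je_eq := by simp [two_mul]
  le_i := by simp
  i_le := by simp
  le_j := le_rfl
  j_le := by omega
  count := by simp
  covered := by omega
  sorted := fun _ _ _ _ _ _ h => by omega
  head := by omega

/-- A finished pair of blocks ends where the next one starts. -/
theorem Merging.next (hM : Merging X A B N h m p i ie j je) (hp : je ≤ p) (hN : p < N) :
    Merging X A B N h (m + 1) p p (min (p + h) N) (min (p + h) N) (min (p + h + h) N) := by
  have h1 := hM.je_eq
  have h2 := hM.j_le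
  have h3 := hM.i_le
  have h4 := hM.count
  have h5 := hM.ie_eq
  have e : 2 * h * (m + 1) = 2 * h * m + 2 * h := by ring
  have hpe : p = 2 * h * (m + 1) := by omega
  exact
  { ie_eq := by omega
    je_eq := by omega
    le_i := by omega
    i_le := by omega
    le_j := le_rfl
    j_le := by omega
    count := by omega
    covered := fun q hq => hM.covered q (by omega)
    sorted := hM.sorted
    head := by omega }

/-- An entry may be appended if its key is at least those of the unfinished block. -/
theorem SortedBlocks.update {b : ℕ} (hB : SortedBlocks X B p b) {a : ℕ} (hm : b * m ≤ p)
    (hm' : p < b * (m + 1)) (ha : ∀ p', b * m ≤ p' → p' < p → X (B p') ≤ X a) :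
    SortedBlocks X (Function.update B p a) (p + 1) b := by
  intro m' p₁ p₂ h1 h2 h3 h4
  rcases Nat.lt_or_ge p₂ p with h | h
  · rw [Function.update_of_ne (by omega), Function.update_of_ne (by omega)]
    exact hB m' p₁ p₂ h1 h2 h3 h
  · obtain rfl : p₂ = p := by omega
    have e1 : p₂ / b = m' := Nat.div_eq_of_lt_le (by rw [mul_comm]; omega) (by rwa [mul_comm])
    have e2 : p₂ / b = m := Nat.div_eq_of_lt_le (by rwa [mul_comm]) (by rwa [mul_comm])
    obtain rfl : m' = m := e1.symm.trans e2
    rcases Nat.lt_or_ge p₁ p₂ with h' | h'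
    · rw [Function.update_of_ne (by omega), Function.update_self]
      exact ha p₁ h1 h'
    · rw [show p₁ = p₂ by omega]

theorem Merging.left (hM : Merging X A B N h m p i ie j je) (hA : SortedBlocks X A N h)
    (hi : i < ie) (hij : j < je → X (A i) ≤ X (A j)) :
    Merging X A (Function.update B p (A i)) N h m (p + 1) (i + 1) ie j je := by
  obtain ⟨h1, h2, h3, h4, h5, h6, h7, h8, h9, h10⟩ := hM
  have e : 2 * h * (m + 1) = 2 * h * m + 2 * h := by ring
  have e1 : h * (2 * m) = 2 * h * m := by ring
  have e2 : h * (2 * m + 1) = 2 * h * m + h := by ring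
  have e3 : h * (2 * m + 1 + 1) = 2 * h * m + 2 * h := by ring
  refine ⟨h1, h2, by omega, by omega, h5, h6, by omega, fun q hq => ?_,
    h9.update (m := m) (by omega) (by omega) fun p' hp hp' => h10 p' hp hp' i (by omega),
    fun p' hp hp' q hq => ?_⟩
  · by_cases hqi : q = i
    · exact ⟨p, by omega, by simp [hqi]⟩
    · obtain ⟨p', hp', e⟩ := h8 q (by omega)
      exact ⟨p', by omega, by rw [Function.update_of_ne (by omega), e]⟩
  · rcases Nat.lt_or_ge p' p with hlt | hge
    · rw [Function.update_of_ne (by omega)]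
      exact h10 p' hp hlt q (by omega)
    · rw [show p' = p by omega, Function.update_self]
      rcases hq with hq | hq
      · exact hA (2 * m) i q (by omega) (by omega) (by omega) (by omega)
      · exact (hij (by omega)).trans (hA (2 * m + 1) j q (by omega) (by omega) (by omega)
          (by omega))

theorem Merging.right (hM : Merging X A B N h m p i ie j je) (hA : SortedBlocks X A N h)
    (hj : j < je) (hij : i < ie → X (A j) ≤ X (A i)) :
    Merging X A (Function.update B p (A j)) N h m (p + 1) i ie (j + 1) je := by
  obtain ⟨h1, h2, h3, h4, h5, h6, h7, h8, h9, h10⟩ := hM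
  have e : 2 * h * (m + 1) = 2 * h * m + 2 * h := by ring
  have e1 : h * (2 * m) = 2 * h * m := by ring
  have e2 : h * (2 * m + 1) = 2 * h * m + h := by ring
  have e3 : h * (2 * m + 1 + 1) = 2 * h * m + 2 * h := by ring
  refine ⟨h1, h2, by omega, by omega, by omega, by omega, by omega, fun q hq => ?_,
    h9.update (m := m) (by omega) (by omega) fun p' hp hp' => h10 p' hp hp' j (by omega),
    fun p' hp hp' q hq => ?_⟩
  · by_cases hqi : q = j
    · exact ⟨p, by omega, by simp [hqi]⟩
    · obtain ⟨p', hp', e⟩ := h8 q (by omega)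
      exact ⟨p', by omega, by rw [Function.update_of_ne (by omega), e]⟩
  · rcases Nat.lt_or_ge p' p with hlt | hge
    · rw [Function.update_of_ne (by omega)]
      exact h10 p' hp hlt q (by omega)
    · rw [show p' = p by omega, Function.update_self]
      rcases hq with hq | hq
      · exact (hij (by omega)).trans (hA (2 * m) i q (by omega) (by omega) (by omega) (by omega))
      · exact hA (2 * m + 1) j q (by omega) (by omega) (by omega) (by omega)

end Merging

/-- Start the next pair of blocks if the current one is finished. -/
def mergeStart : Program :=
  .branch (.ile (.var vNx) (.var vP))
    (.iset vI (.var vP) ;;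
     .iset vIE (.min (.add (.var vP) (.var vH)) (.var vN)) ;;
     .iset vJ (.var vIE) ;;
     .iset vJE (.min (.add (.add (.var vP) (.var vH)) (.var vH)) (.var vN)) ;;
     .iset vNx (.var vJE))
    .skip

/-- Move the smaller one of the two head entries to the output. -/
def mergeMove : Program :=
  .branch (.and (.not (.ile (.var vIE) (.var vI)))
      (.not (.and (.not (.ile (.var vJE) (.var vJ)))
        (.not (.rle (.arr rX (.arr aOrd (.var vI))) (.arr rX (.arr aOrd (.var vJ))))))))
    (.iput aTmp (.var vP) (.arr aOrd (.var vI)) ;; .iset vI (.add (.var vI) (.const 1)))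
    (.iput aTmp (.var vP) (.arr aOrd (.var vJ)) ;; .iset vJ (.add (.var vJ) (.const 1)))

/-- Merge the blocks of width `vH` in pairs. -/
def mergePass : Program :=
  .iset vNx (.const 0) ;;
  .forUp vP (.var vN) (mergeStart ;; mergeMove) ;;
  .forUp vP (.var vN) (.iput aOrd (.var vP) (.arr aTmp (.var vP)))

def mergeSort : Program :=
  .forUp vP (.var vN) (.iput aOrd (.var vP) (.var vP)) ;;
  .iset vH (.const 1) ;;
  .loop (.not (.ile (.var vN) (.var vH))) (mergePass ;; .iset vH (.add (.var vH) (.var vH)))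

/-- Invert the sorting permutation, and list the breakpoints in sorted order. -/
def computeRanks : Program :=
  .forUp vP (.var vN)
    (.iput aRnk (.arr aOrd (.var vP)) (.var vP) ;;
     .rput rXS (.var vP) (.arr rX (.arr aOrd (.var vP))))

theorem mergeStart_spec {W : ℕ} {σ : State} (hW : σ.ivar vN ≤ W) (hP : σ.ivar vP < σ.ivar vN)
    (hH : 0 < σ.ivar vH) {X : ℕ → ℝ} {A B : ℕ → ℕ}
    (h : (σ.ivar vP = 0 ∧ σ.ivar vNx = 0) ∨ (∃ m, Merging X A B (σ.ivar vN) (σ.ivar vH) m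
      (σ.ivar vP) (σ.ivar vI) (σ.ivar vIE) (σ.ivar vJ) (σ.ivar vJE)) ∧
      σ.ivar vNx = σ.ivar vJE) :
    Runs W mergeStart σ 40 (fun σ' => (∃ m, Merging X A B (σ.ivar vN) (σ.ivar vH) m
      (σ.ivar vP) (σ'.ivar vI) (σ'.ivar vIE) (σ'.ivar vJ) (σ'.ivar vJE)) ∧
      σ'.ivar vNx = σ'.ivar vJE ∧ σ.ivar vP < σ'.ivar vNx) := by
  simp [mergeStart]
  constructor
  · intro h1
    and_intros
    all_goals try omega
    rcases h with ⟨h2, h3⟩ | ⟨⟨m, h2⟩, h3⟩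
    · rw [h2]; simpa using ⟨0, Merging.zero⟩
    · exact ⟨m + 1, h2.next (by omega) hP⟩
  · intro h1
    rcases h with ⟨h2, h3⟩ | h
    · omega
    · exact ⟨h.1, h.2, by omega⟩

theorem mergeMove_spec {W : ℕ} {σ : State} {m : ℕ} (hW : σ.ivar vN ≤ W)
    (hP : σ.ivar vP < σ.ivar vJE)
    (hA : SortedBlocks (σ.rarr rX) (σ.iarr aOrd) (σ.ivar vN) (σ.ivar vH))
    (hlt : ∀ p < σ.ivar vN, σ.iarr aOrd p ≤ W)
    (h : Merging (σ.rarr rX) (σ.iarr aOrd) (σ.iarr aTmp) (σ.ivar vN) (σ.ivar vH) m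
      (σ.ivar vP) (σ.ivar vI) (σ.ivar vIE) (σ.ivar vJ) (σ.ivar vJE)) :
    Runs W mergeMove σ 40 (fun σ' => Merging (σ.rarr rX) (σ.iarr aOrd) (σ'.iarr aTmp) (σ.ivar vN)
      (σ.ivar vH) m (σ.ivar vP + 1) (σ'.ivar vI) (σ.ivar vIE) (σ'.ivar vJ) (σ.ivar vJE)) := by
  have h1 := h.count
  have h2 := h.i_le
  have h3 := h.j_le
  have h4 := h.je_eq
  have h5 := h.le_j
  simp [mergeMove]
  constructor
  · intro h6 h7
    exact ⟨hlt _ (by omega), by omega, h.left hA h6 h7⟩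
  · intro h6
    have hj : σ.ivar vJ < σ.ivar vJE := by
      by_contra hj
      exact absurd (h6 (by omega)) (by simp; omega)
    refine ⟨hlt _ (by omega), by omega, h.right hA hj fun hi => ?_⟩
    exact (h6 hi).2.le

theorem mergePass_spec {W : ℕ} {σ : State} (hW : σ.ivar vN ≤ W) (hH : 0 < σ.ivar vH)
    (hA : SortedBlocks (σ.rarr rX) (σ.iarr aOrd) (σ.ivar vN) (σ.ivar vH))
    (hc : Covers (σ.iarr aOrd) (σ.ivar vN)) :
    Runs W mergePass σ (200 * (σ.ivar vN + 1)) (fun σ' =>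
      SortedBlocks (σ.rarr rX) (σ'.iarr aOrd) (σ.ivar vN) (2 * σ.ivar vH) ∧
      Covers (σ'.iarr aOrd) (σ.ivar vN)) := by
  set N := σ.ivar vN with hN
  set h := σ.ivar vH
  set X := σ.rarr rX
  set A := σ.iarr aOrd
  unfold mergePass
  refine Runs.mono_time (Runs.seq (T := 2) (Q := fun σ' => σ'.ivar vNx = 0) (by simp)
    fun σ₁ hF₁ hn₁ => Runs.seq
    (Runs.forVar (I := fun p σ' => (p = 0 ∧ σ'.ivar vNx = 0) ∨
      (∃ m, Merging X A (σ'.iarr aTmp) N h m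
        p (σ'.ivar vI) (σ'.ivar vIE) (σ'.ivar vJ) (σ'.ivar vJE)) ∧ σ'.ivar vNx = σ'.ivar vJE)
      N 80 ((hF₁.ivar vN rfl).trans hN.symm) hW rfl rfl ?_ ?_) (T' := 50 * N + 50)
      fun σ₂ hF₂ h₂ => ?_) ?_
  rotate_left 2
  · have hB : SortedBlocks X (σ₂.iarr aTmp) N (2 * h) ∧ Covers (σ₂.iarr aTmp) N := by
      rcases h₂ with h | ⟨⟨m, hM⟩, -⟩
      · rw [h.1]
        exact ⟨fun _ _ _ _ _ _ h => by omega, fun _ h => by omega⟩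
      · refine ⟨hM.sorted, fun e he => ?_⟩
        obtain ⟨q, hq, rfl⟩ := hc e he
        have h1 := hM.count
        have h2 := hM.i_le
        have h3 := hM.j_le
        have h4 := hM.je_eq
        exact hM.covered q (by omega)
    refine (Runs.forVar (I := fun p σ' => ∀ q < p, σ'.iarr aOrd q = σ₂.iarr aTmp q)
      N 40 ((hF₂.ivar vN rfl).trans ((hF₁.ivar vN rfl).trans hN.symm)) hW rfl rfl ?_ ?_).mono
      (by omega) fun σ₃ hF₃ h₃ => ?_
    · simp
    · intro p σ' hF hp hvp hI
      have e2 : σ'.iarr aTmp = σ₂.iarr aTmp := hF.iarr aTmp rfl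
      simp [hvp, e2]
      refine ⟨(hB.2.lt hp).le.trans hW, fun q hq => ?_⟩
      rcases Nat.lt_or_ge q p with h | h
      · rw [Function.update_of_ne (by omega), hI q h]
      · rw [show q = p by omega, Function.update_self]
    · refine ⟨fun m p p' h1 h2 h3 h4 => ?_, fun e he => ?_⟩
      · rw [h₃ p (by omega), h₃ p' h4]
        exact hB.1 m p p' h1 h2 h3 h4
      · obtain ⟨q, hq, h⟩ := hB.2 e he
        exact ⟨q, hq, by rw [h₃ q hq, h]⟩
  · omega
  · exact Or.inl ⟨rfl, hn₁⟩
  · intro p σ' hF hp hvp hI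
    have e1 : σ'.ivar vN = N := (hF.ivar vN rfl).trans (hF₁.ivar vN rfl)
    have e2 : σ'.ivar vH = h := (hF.ivar vH rfl).trans (hF₁.ivar vH rfl)
    have e3 : σ'.rarr rX = X := (hF.rarr rX rfl).trans (hF₁.rarr rX rfl)
    have e4 : σ'.iarr aOrd = A := (hF.iarr aOrd rfl).trans (hF₁.iarr aOrd rfl)
    have hP : σ'.ivar vP < σ'.ivar vN := by rw [hvp, e1]; exact hp
    refine Runs.seq (T := 40) (T' := 40) (mergeStart_spec (W := W) (σ := σ') (X := X) (A := A)
      (B := σ'.iarr aTmp) (by omega) (by omega) (by omega) (by rw [hvp, e1, e2]; exact hI)) ?_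
    rintro σ'' hF'' ⟨⟨m, hM⟩, hn, hlt⟩
    have f0 : σ''.ivar vP = p := (hF''.ivar vP rfl).trans hvp
    have f1 : σ''.ivar vN = N := (hF''.ivar vN rfl).trans e1
    have f2 : σ''.ivar vH = h := (hF''.ivar vH rfl).trans e2
    have f3 : σ''.rarr rX = X := (hF''.rarr rX rfl).trans e3
    have f4 : σ''.iarr aOrd = A := (hF''.iarr aOrd rfl).trans e4
    rw [e1, e2, ← hF''.iarr aTmp rfl, hvp] at hM
    rw [hvp] at hlt
    refine (mergeMove_spec (W := W) (σ := σ'') (m := m) (by omega) (by omega)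
      (by rwa [f1, f2, f3, f4])
      (by rw [f1, f4]; exact fun q hq => (hc.lt hq).le.trans hW)
      (by rwa [f0, f1, f2, f3, f4])).mono le_rfl ?_
    intro σ₃ hF₃ hM'
    have g1 : σ₃.ivar vIE = σ''.ivar vIE := hF₃.ivar vIE rfl
    have g2 : σ₃.ivar vJE = σ''.ivar vJE := hF₃.ivar vJE rfl
    have g3 : σ₃.ivar vNx = σ''.ivar vNx := hF₃.ivar vNx rfl
    rw [f0, f1, f2, f3, f4, ← g1, ← g2] at hM'
    refine Or.inr ⟨⟨m, ?_⟩, ?_⟩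
    · simpa using hM'
    · simpa [g2, g3] using hn

theorem mergeSort_spec {W : ℕ} {σ : State} (hW : 2 * σ.ivar vN + 1 ≤ W) :
    Runs W mergeSort σ (300 * (σ.ivar vN + 1) * (Nat.log 2 (σ.ivar vN) + 2)) (fun σ' =>
      (∀ p p', p ≤ p' → p' < σ.ivar vN →
        σ.rarr rX (σ'.iarr aOrd p) ≤ σ.rarr rX (σ'.iarr aOrd p')) ∧
      Covers (σ'.iarr aOrd) (σ.ivar vN)) := by
  set N := σ.ivar vN with hN
  set X := σ.rarr rX
  unfold mergeSort
  refine Runs.mono_time (Runs.seq (Runs.forVar (I := fun p σ' => ∀ q < p, σ'.iarr aOrd q = q)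
    N 20 hN.symm (by omega) rfl rfl ?_ ?_) fun σ₁ hF₁ h₁ => Runs.seq (T := 2)
    (Q := fun σ' => σ'.ivar vH = 1) (by simp; omega) fun σ₂ hF₂ h₂ =>
    (Runs.loop (I := fun a σ' => σ'.ivar vH = 2 ^ a ∧ SortedBlocks X (σ'.iarr aOrd) N (2 ^ a) ∧
      Covers (σ'.iarr aOrd) N) (Nat.log 2 N + 1) (fun _ => 200 * (N + 1) + 4) ?_ ?_).mono le_rfl
      fun σ₃ hF₃ h₃ => ?_) ?_
  · simp
  · intro p σ' hF hp hvp hI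
    simp [hvp]
    refine ⟨by omega, fun q hq => ?_⟩
    rcases Nat.lt_or_ge q p with h | h
    · rw [Function.update_of_ne (by omega), hI q h]
    · rw [show q = p by omega, Function.update_self]
  · rw [← hF₂.iarr aOrd rfl] at h₁
    refine ⟨by simp [h₂], fun m p p' _ _ _ _ => ?_, fun e he => ⟨e, he, h₁ e he⟩⟩
    rw [show p = p' by omega]
  · rintro a σ' hF ⟨hH, hS, hC⟩ hb
    have e1 : σ'.ivar vN = N := (hF.ivar vN rfl).trans ((hF₂.ivar vN rfl).trans (hF₁.ivar vN rfl))
    have e3 : σ'.rarr rX = X :=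
      (hF.rarr rX rfl).trans ((hF₂.rarr rX rfl).trans (hF₁.rarr rX rfl))
    simp [hH, e1] at hb
    refine ⟨Nat.lt_succ_of_le (Nat.le_log_of_pow_le (by omega) hb.le), ?_⟩
    refine Runs.seq (by
      have := mergePass_spec (W := W) (σ := σ') (by omega) (by rw [hH]; positivity)
        (by rwa [e1, e3, hH]) (by rwa [e1])
      rw [e1, e3, hH] at this
      exact this) ?_
    rintro σ'' hF'' ⟨h1, h2⟩
    have e4 : σ''.ivar vH = 2 ^ a := (hF''.ivar vH rfl).trans hH
    have e5 : 2 ^ a + 2 ^ a = 2 ^ (a + 1) := by ring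
    have e6 : 2 * 2 ^ a = 2 ^ (a + 1) := by ring
    rw [e6] at h1
    simp [e4, e5]
    exact ⟨by omega, h1, h2⟩
  · obtain ⟨⟨a, -, hH, hS, hC⟩, hb⟩ := h₃
    have e1 : σ₃.ivar vN = N := (hF₃.ivar vN rfl).trans ((hF₂.ivar vN rfl).trans (hF₁.ivar vN rfl))
    simp [hH, e1] at hb
    exact ⟨fun p p' h1 h2 => hS 0 p p' (by simp) h1 (by omega) h2, hC⟩
  · simp; ring_nf; omega

theorem computeRanks_spec {W : ℕ} {σ : State} (hW : σ.ivar vN ≤ W)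
    (hc : Covers (σ.iarr aOrd) (σ.ivar vN)) :
    Runs W computeRanks σ (50 * (σ.ivar vN + 1)) (fun σ' =>
      (∀ p < σ.ivar vN, σ'.iarr aRnk (σ.iarr aOrd p) = p) ∧
      ∀ p < σ.ivar vN, σ'.rarr rXS p = σ.rarr rX (σ.iarr aOrd p)) := by
  unfold computeRanks
  refine (Runs.forVar (I := fun p σ' => (∀ q < p, σ'.iarr aRnk (σ.iarr aOrd q) = q) ∧
    ∀ q < p, σ'.rarr rXS q = σ.rarr rX (σ.iarr aOrd q)) (σ.ivar vN) 30 rfl hW rfl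
    rfl (by simp) ?_).mono ?_ fun σ' hF h => h
  · rintro p σ' hF hp hvp ⟨h1, h2⟩
    simp [hvp, hF.iarr aOrd rfl, hF.rarr rX rfl]
    refine ⟨by omega, fun q hq => ?_, fun q hq => ?_⟩
    · rcases Nat.lt_or_ge q p with h | h
      · rw [Function.update_of_ne, h1 q h]
        exact fun e => by have := hc.inj (by omega) hp e; omega
      · rw [show q = p by omega, Function.update_self]
    · rcases Nat.lt_or_ge q p with h | h
      · rw [Function.update_of_ne (by omega), h2 q h]
      · rw [show q = p by omega, Function.update_self]
  · omega

/-! ### The lines of the rising and falling parts -/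

/-- The piece of the rising part that starts at breakpoint `vL` of function `vF`. -/
def risingPiece : Program :=
  .iput aSt (.add (.add (.var vQ) (.var vL)) (.const 1)) (.arr aRnk (.add (.var vO) (.var vL))) ;;
  .branch (.ile (.var vM) (.add (.var vL) (.const 1)))
    (.rset xS (.arr rS1 (.var vF)))
    (.rset xS (.div
      (.sub (.arr rY (.add (.add (.var vO) (.var vL)) (.const 1)))
        (.arr rY (.add (.var vO) (.var vL))))
      (.sub (.arr rX (.add (.add (.var vO) (.var vL)) (.const 1)))
        (.arr rX (.add (.var vO) (.var vL)))))) ;;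
  .branch (.rle (.var xS) (.const 0)) (.rset xS (.const 0)) .skip ;;
  .rput rUB (.add (.add (.var vQ) (.var vL)) (.const 1)) (.var xS) ;;
  .rput rUA (.add (.add (.var vQ) (.var vL)) (.const 1))
    (.add (.arr rUA (.add (.var vQ) (.var vL)))
      (.mul (.sub (.arr rUB (.add (.var vQ) (.var vL))) (.var xS))
        (.arr rX (.add (.var vO) (.var vL)))))

/-- The piece of the falling part that ends at breakpoint `vM - 1 - vL` of function `vF`. -/
def fallingPiece : Program :=
  .iset vI (.sub (.var vM) (.add (.var vL) (.const 1))) ;;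
  .branch (.ile (.var vI) (.const 0))
    (.rset xS (.arr rS0 (.var vF)))
    (.rset xS (.div
      (.sub (.arr rY (.add (.var vO) (.var vI)))
        (.arr rY (.add (.var vO) (.sub (.var vI) (.const 1)))))
      (.sub (.arr rX (.add (.var vO) (.var vI)))
        (.arr rX (.add (.var vO) (.sub (.var vI) (.const 1))))))) ;;
  .branch (.rle (.const 0) (.var xS)) (.rset xS (.const 0)) .skip ;;
  .rput rDB (.add (.var vQ) (.var vI)) (.var xS) ;;
  .rput rDA (.add (.var vQ) (.var vI))
    (.add (.arr rDA (.add (.add (.var vQ) (.var vI)) (.const 1)))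
      (.mul (.sub (.arr rDB (.add (.add (.var vQ) (.var vI)) (.const 1))) (.var xS))
        (.arr rX (.add (.var vO) (.var vI)))))

/-- Locate function `vF`, and set up the parts of its first and last piece that are zero. A function
with `m` breakpoints occupies `m + 2` entries: its `m + 1` pieces, and one entry for the end of the
last piece; therefore the entries of function `i` start `2 * i` places after its breakpoints. -/
def setUpStart : Program :=
  .iset vO (.arr aOff (.var vF)) ;;
  .iset vQ (.add (.add (.var vO) (.var vF)) (.var vF)) ;;
  .iset vM (.sub (.arr aOff (.add (.var vF) (.const 1))) (.var vO)) ;;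
  .iput aSt (.var vQ) (.const 0) ;;
  .iput aSt (.add (.add (.var vQ) (.var vM)) (.const 1)) (.var vN) ;;
  .rput rUA (.var vQ) (.const 0) ;;
  .rput rUB (.var vQ) (.const 0) ;;
  .rput rDA (.add (.var vQ) (.var vM)) (.const 0) ;;
  .rput rDB (.add (.var vQ) (.var vM)) (.const 0)

def setUpFunction : Program :=
  setUpStart ;;
  .forUp vL (.var vM) risingPiece ;;
  .forUp vL (.var vM) fallingPiece

def setUp : Program := .forUp vF (.var vK) setUpFunction

/-- The pieces of function `i`, with `m` breakpoints stored from position `o` on, have been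
set up: they are stored from position `o + i + i` on. -/
structure IsSetUp (σ : State) (N i o m : ℕ) : Prop where
  lines : Lines m (fun j => σ.rarr rX (o + j))
    (pieceSlope m (fun j => σ.rarr rX (o + j)) (fun j => σ.rarr rY (o + j))
      (σ.rarr rS0 i) (σ.rarr rS1 i))
    (fun j => σ.rarr rUA (o + i + i + j)) (fun j => σ.rarr rUB (o + i + i + j))
    (fun j => σ.rarr rDA (o + i + i + j)) (fun j => σ.rarr rDB (o + i + i + j))
  st_zero : σ.iarr aSt (o + i + i) = 0
  st_succ : ∀ j < m, σ.iarr aSt (o + i + i + j + 1) = σ.iarr aRnk (o + j)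
  st_last : σ.iarr aSt (o + i + i + m + 1) = N

/-- The entries of the arrays of pieces below `q` agree. -/
structure SameBelow (q : ℕ) (σ σ' : State) : Prop where
  st : ∀ p < q, σ'.iarr aSt p = σ.iarr aSt p
  ua : ∀ p < q, σ'.rarr rUA p = σ.rarr rUA p
  ub : ∀ p < q, σ'.rarr rUB p = σ.rarr rUB p
  da : ∀ p < q, σ'.rarr rDA p = σ.rarr rDA p
  db : ∀ p < q, σ'.rarr rDB p = σ.rarr rDB p

/-- Setting up the later functions does not affect function `i`. -/
theorem IsSetUp.congr {σ σ' : State} {N i o m q : ℕ} (h : IsSetUp σ N i o m)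
    (hs : SameBelow q σ σ') (hq : o + i + i + m + 1 < q)
    (hR : σ'.iarr aRnk = σ.iarr aRnk) (hX : σ'.rarr rX = σ.rarr rX) (hY : σ'.rarr rY = σ.rarr rY)
    (h0 : σ'.rarr rS0 = σ.rarr rS0) (h1 : σ'.rarr rS1 = σ.rarr rS1) : IsSetUp σ' N i o m := by
  obtain ⟨⟨l1, l2, l3, l4, l5, l6, l7, l8⟩, hz, hsu, hl⟩ := h
  refine ⟨?_, by rw [hs.st _ (by omega), hz], fun j hj => by
    rw [hs.st _ (by omega), hsu j hj, hR], by rw [hs.st _ (by omega), hl]⟩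
  rw [hX, hY, h0, h1]
  refine ⟨?_, ?_, fun j hj => ?_, fun j hj => ?_, ?_, ?_, fun j hj => ?_, fun j hj => ?_⟩
  · rw [← l1]; exact hs.ua _ (by omega)
  · rw [← l2]; exact hs.ub _ (by omega)
  · rw [← l3 j hj]; exact hs.ub _ (by omega)
  · rw [hs.ua _ (by omega), hs.ua _ (by omega), hs.ub _ (by omega), hs.ub _ (by omega)]
    exact l4 j hj
  · rw [← l5]; exact hs.da _ (by omega)
  · rw [← l6]; exact hs.db _ (by omega)
  · rw [← l7 j hj]; exact hs.db _ (by omega)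
  · rw [hs.da _ (by omega), hs.da _ (by omega), hs.db _ (by omega), hs.db _ (by omega)]
    exact l8 j hj

section
variable {W : ℕ} {σ : State}

theorem risingPiece_spec (hR : σ.iarr aRnk (σ.ivar vO + σ.ivar vL) ≤ W) :
    Runs W risingPiece σ 100 (fun σ' =>
      σ'.iarr aSt = Function.update (σ.iarr aSt) (σ.ivar vQ + σ.ivar vL + 1)
        (σ.iarr aRnk (σ.ivar vO + σ.ivar vL)) ∧
      σ'.rarr rUB = Function.update (σ.rarr rUB) (σ.ivar vQ + σ.ivar vL + 1)
        (max (pieceSlope (σ.ivar vM) (fun j => σ.rarr rX (σ.ivar vO + j))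
          (fun j => σ.rarr rY (σ.ivar vO + j)) (σ.rarr rS0 (σ.ivar vF)) (σ.rarr rS1 (σ.ivar vF))
          (σ.ivar vL + 1)) 0) ∧
      σ'.rarr rUA = Function.update (σ.rarr rUA) (σ.ivar vQ + σ.ivar vL + 1)
        (σ.rarr rUA (σ.ivar vQ + σ.ivar vL) +
          (σ.rarr rUB (σ.ivar vQ + σ.ivar vL) - σ'.rarr rUB (σ.ivar vQ + σ.ivar vL + 1)) *
            σ.rarr rX (σ.ivar vO + σ.ivar vL))) := by
  simp [risingPiece, pieceSlope, hR, ← add_assoc]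
  constructor
  · intro h
    simp [not_lt.2 h]
    exact ⟨fun h => by simp [h], fun h => by simp [h.le]⟩
  · intro h
    simp [h]
    exact ⟨fun h => by simp [h], fun h => by simp [h.le]⟩

theorem fallingPiece_spec (hW : σ.ivar vM ≤ W) {l : ℕ} (hL : σ.ivar vL + l + 1 = σ.ivar vM) :
    Runs W fallingPiece σ 100 (fun σ' =>
      σ'.rarr rDB = Function.update (σ.rarr rDB) (σ.ivar vQ + l)
        (min (pieceSlope (σ.ivar vM) (fun j => σ.rarr rX (σ.ivar vO + j))
          (fun j => σ.rarr rY (σ.ivar vO + j)) (σ.rarr rS0 (σ.ivar vF)) (σ.rarr rS1 (σ.ivar vF))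
          l) 0) ∧
      σ'.rarr rDA = Function.update (σ.rarr rDA) (σ.ivar vQ + l)
        (σ.rarr rDA (σ.ivar vQ + l + 1) +
          (σ.rarr rDB (σ.ivar vQ + l + 1) - σ'.rarr rDB (σ.ivar vQ + l)) *
            σ.rarr rX (σ.ivar vO + l))) := by
  have e : σ.ivar vM - (σ.ivar vL + 1) = l := by omega
  simp [fallingPiece, pieceSlope, e]
  refine ⟨by omega, ?_, ?_⟩
  · intro h
    simp [h]
    exact ⟨fun h => by simp [h], fun h => by simp [h.le]⟩
  · intro h
    simp [h, show l < σ.ivar vM by omega]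
    exact ⟨fun h => by simp [h], fun h => by simp [h.le]⟩

theorem SameBelow.trans {q : ℕ} {σ' σ'' : State} (h : SameBelow q σ σ') (h' : SameBelow q σ' σ'') :
    SameBelow q σ σ'' :=
  ⟨fun p hp => (h'.st p hp).trans (h.st p hp), fun p hp => (h'.ua p hp).trans (h.ua p hp),
    fun p hp => (h'.ub p hp).trans (h.ub p hp), fun p hp => (h'.da p hp).trans (h.da p hp),
    fun p hp => (h'.db p hp).trans (h.db p hp)⟩

theorem setUpStart_spec {N i o m : ℕ} (hN : σ.ivar vN = N) (hF : σ.ivar vF = i)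
    (ho : σ.iarr aOff i = o) (hm : σ.iarr aOff (i + 1) = o + m) (hW : o + i + i + m + N ≤ W) :
    Runs W setUpStart σ 100 (fun σ' => σ'.ivar vO = o ∧ σ'.ivar vQ = o + i + i ∧ σ'.ivar vM = m ∧
      σ'.iarr aSt (o + i + i) = 0 ∧ σ'.iarr aSt (o + i + i + m + 1) = N ∧
      σ'.rarr rUA (o + i + i) = 0 ∧ σ'.rarr rUB (o + i + i) = 0 ∧
      σ'.rarr rDA (o + i + i + m) = 0 ∧ σ'.rarr rDB (o + i + i + m) = 0 ∧
      SameBelow (o + i + i) σ σ') := by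
  simp [setUpStart, hF, ho, hm, hN]
  refine ⟨by omega, by omega, by omega, by omega, ?_, ?_⟩
  · rw [Function.update_of_ne (by omega), Function.update_self]
  · refine ⟨fun p hp => ?_, fun p hp => ?_, fun p hp => ?_, fun p hp => ?_, fun p hp => ?_⟩ <;>
      simp [Function.update_apply]
    · split_ifs <;> omega
    all_goals intros; omega

theorem setUpFunction_spec {N i o m : ℕ} (hN : σ.ivar vN = N) (hF : σ.ivar vF = i)
    (ho : σ.iarr aOff i = o) (hm : σ.iarr aOff (i + 1) = o + m) (hW : o + i + i + m + N ≤ W)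
    (hR : ∀ j < m, σ.iarr aRnk (o + j) ≤ W) :
    Runs W setUpFunction σ (300 * (m + 1)) (fun σ' => IsSetUp σ' N i o m ∧
      SameBelow (o + i + i) σ σ') := by
  unfold setUpFunction
  refine Runs.mono_time (Runs.seq (setUpStart_spec hN hF ho hm hW) (T' := 250 * m + 40) ?_)
    (by omega)
  rintro σ₁ hF₁ ⟨hO, hQ, hM, s0, s1, u1, u2, d1, d2, hsb⟩
  set q := o + i + i with hq
  set sl := pieceSlope m (fun j => σ.rarr rX (o + j)) (fun j => σ.rarr rY (o + j))
      (σ.rarr rS0 i) (σ.rarr rS1 i) with hsl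
  refine Runs.mono_time (Runs.seq (Runs.forVar (I := fun j σ' =>
      σ'.iarr aSt q = 0 ∧ σ'.iarr aSt (q + m + 1) = N ∧ σ'.rarr rUA q = 0 ∧ σ'.rarr rUB q = 0 ∧
      (∀ l < j, σ'.iarr aSt (q + l + 1) = σ.iarr aRnk (o + l)) ∧
      (∀ l < j, σ'.rarr rUB (q + l + 1) = max (sl (l + 1)) 0) ∧
      (∀ l < j, σ'.rarr rUA (q + l + 1) = σ'.rarr rUA (q + l) +
        (σ'.rarr rUB (q + l) - σ'.rarr rUB (q + l + 1)) * σ.rarr rX (o + l)) ∧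
      SameBelow q σ σ') m 100 hM (by omega) rfl rfl
      ⟨s0, s1, u1, u2, by simp, by simp, by simp, ?_⟩ ?_) (T' := m * 109 + 10) ?_) (by omega)
  · exact ⟨hsb.st, hsb.ua, hsb.ub, hsb.da, hsb.db⟩
  · rintro j σ' hF' hj hL ⟨i1, i2, i3, i4, i5, i6, i7, i8⟩
    have e1 : σ'.ivar vO = o := (hF'.ivar vO rfl).trans hO
    have e2 : σ'.ivar vQ = q := (hF'.ivar vQ rfl).trans hQ
    have e3 : σ'.ivar vM = m := (hF'.ivar vM rfl).trans hM
    have e4 : σ'.ivar vF = i := (hF'.ivar vF rfl).trans ((hF₁.ivar vF rfl).trans hF)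
    have e5 : σ'.iarr aRnk = σ.iarr aRnk := (hF'.iarr aRnk rfl).trans (hF₁.iarr aRnk rfl)
    have e6 : σ'.rarr rX = σ.rarr rX := (hF'.rarr rX rfl).trans (hF₁.rarr rX rfl)
    have e7 : σ'.rarr rY = σ.rarr rY := (hF'.rarr rY rfl).trans (hF₁.rarr rY rfl)
    have e8 : σ'.rarr rS0 = σ.rarr rS0 := (hF'.rarr rS0 rfl).trans (hF₁.rarr rS0 rfl)
    have e9 : σ'.rarr rS1 = σ.rarr rS1 := (hF'.rarr rS1 rfl).trans (hF₁.rarr rS1 rfl)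
    refine (risingPiece_spec (W := W) (σ := σ') (by rw [e1, hL, e5]; exact hR j hj)).mono le_rfl ?_
    rintro σ'' hF'' ⟨h1, h2, h3⟩
    rw [h2] at h3
    rw [e1, e2, e3, e4, e6, e7, e8, e9, hL, ← hsl] at h2
    rw [e1, e2, e3, e4, e6, e7, e8, e9, hL, ← hsl, Function.update_self] at h3
    rw [e1, e2, e5, hL] at h1
    simp only [setIVar_iarr, setIVar_rarr]
    rw [h1, h2, h3]
    refine ⟨?_, ?_, ?_, ?_, fun l hl => ?_, fun l hl => ?_, fun l hl => ?_, ?_⟩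
    · rw [Function.update_of_ne (by omega), i1]
    · rw [Function.update_of_ne (by omega), i2]
    · rw [Function.update_of_ne (by omega), i3]
    · rw [Function.update_of_ne (by omega), i4]
    · rcases Nat.lt_or_ge l j with h | h
      · rw [Function.update_of_ne (by omega), i5 l h]
      · rw [show l = j by omega, Function.update_self]
    · rcases Nat.lt_or_ge l j with h | h
      · rw [Function.update_of_ne (by omega), i6 l h]
      · rw [show l = j by omega, Function.update_self]
    · rcases Nat.lt_or_ge l j with h | h
      · rw [Function.update_of_ne (by omega), Function.update_of_ne (by omega),
          Function.update_of_ne (by omega), Function.update_of_ne (by omega), i7 l h]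
      · rw [show l = j by omega, Function.update_self, Function.update_self,
          Function.update_of_ne (by omega), Function.update_of_ne (by omega)]
    · refine i8.trans ⟨fun p hp => ?_, fun p hp => ?_, fun p hp => ?_, fun p hp => ?_,
        fun p hp => ?_⟩
      · rw [setIVar_iarr, h1, Function.update_of_ne (by omega)]
      · rw [setIVar_rarr, h3, Function.update_of_ne (by omega)]
      · rw [setIVar_rarr, h2, Function.update_of_ne (by omega)]
      · rw [setIVar_rarr, hF''.rarr rDA rfl]
      · rw [setIVar_rarr, hF''.rarr rDB rfl]
  rintro σ₂ hF₂ ⟨i1, i2, i3, i4, i5, i6, i7, i8⟩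
  refine (Runs.forVar (I := fun j σ' =>
      σ'.rarr rDA (q + m) = 0 ∧ σ'.rarr rDB (q + m) = 0 ∧
      (∀ l < m, m - j ≤ l → σ'.rarr rDB (q + l) = min (sl l) 0) ∧
      (∀ l < m, m - j ≤ l → σ'.rarr rDA (q + l) = σ'.rarr rDA (q + l + 1) +
        (σ'.rarr rDB (q + l + 1) - σ'.rarr rDB (q + l)) * σ.rarr rX (o + l)) ∧
      SameBelow q σ σ') m 100 ((hF₂.ivar vM rfl).trans hM) (by omega) rfl rfl
      ⟨?_, ?_, fun l h1 h2 => by omega, fun l h1 h2 => by omega, ?_⟩ ?_).mono (by omega) ?_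
  · rw [setIVar_rarr, hF₂.rarr rDA rfl, d1]
  · rw [setIVar_rarr, hF₂.rarr rDB rfl, d2]
  · exact ⟨i8.st, i8.ua, i8.ub, i8.da, i8.db⟩
  · rintro j σ' hF' hj hL ⟨k1, k2, k3, k4, k5⟩
    have e1 : σ'.ivar vO = o := (hF'.ivar vO rfl).trans ((hF₂.ivar vO rfl).trans hO)
    have e2 : σ'.ivar vQ = q := (hF'.ivar vQ rfl).trans ((hF₂.ivar vQ rfl).trans hQ)
    have e3 : σ'.ivar vM = m := (hF'.ivar vM rfl).trans ((hF₂.ivar vM rfl).trans hM)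
    have e4 : σ'.ivar vF = i :=
      (hF'.ivar vF rfl).trans ((hF₂.ivar vF rfl).trans ((hF₁.ivar vF rfl).trans hF))
    have e6 : σ'.rarr rX = σ.rarr rX :=
      (hF'.rarr rX rfl).trans ((hF₂.rarr rX rfl).trans (hF₁.rarr rX rfl))
    have e7 : σ'.rarr rY = σ.rarr rY :=
      (hF'.rarr rY rfl).trans ((hF₂.rarr rY rfl).trans (hF₁.rarr rY rfl))
    have e8 : σ'.rarr rS0 = σ.rarr rS0 :=
      (hF'.rarr rS0 rfl).trans ((hF₂.rarr rS0 rfl).trans (hF₁.rarr rS0 rfl))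
    have e9 : σ'.rarr rS1 = σ.rarr rS1 :=
      (hF'.rarr rS1 rfl).trans ((hF₂.rarr rS1 rfl).trans (hF₁.rarr rS1 rfl))
    obtain ⟨l₀, hl₀⟩ : ∃ l₀, j + l₀ + 1 = m := ⟨m - j - 1, by omega⟩
    refine (fallingPiece_spec (W := W) (σ := σ') (l := l₀) (by omega) (by omega)).mono le_rfl ?_
    rintro σ'' hF'' ⟨h1, h2⟩
    rw [h1] at h2
    rw [e1, e2, e3, e4, e6, e7, e8, e9, ← hsl] at h1
    rw [e1, e2, e3, e4, e6, e7, e8, e9, ← hsl, Function.update_self] at h2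
    simp only [setIVar_rarr]
    rw [h1, h2]
    refine ⟨?_, ?_, fun l hl hl' => ?_, fun l hl hl' => ?_, ?_⟩
    · rw [Function.update_of_ne (by omega), k1]
    · rw [Function.update_of_ne (by omega), k2]
    · by_cases h : l = l₀
      · rw [h, Function.update_self]
      · rw [Function.update_of_ne (by omega), k3 l hl (by omega)]
    · by_cases h : l = l₀
      · rw [h, Function.update_self, Function.update_self,
          Function.update_of_ne (by omega), Function.update_of_ne (by omega)]
      · rw [Function.update_of_ne (by omega), Function.update_of_ne (by omega),
          Function.update_of_ne (by omega), Function.update_of_ne (by omega), k4 l hl (by omega)]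
    · refine k5.trans ⟨fun p hp => ?_, fun p hp => ?_, fun p hp => ?_, fun p hp => ?_,
        fun p hp => ?_⟩
      · rw [setIVar_iarr, hF''.iarr aSt rfl]
      · rw [setIVar_rarr, hF''.rarr rUA rfl]
      · rw [setIVar_rarr, hF''.rarr rUB rfl]
      · rw [setIVar_rarr, h2, Function.update_of_ne (by omega)]
      · rw [setIVar_rarr, h1, Function.update_of_ne (by omega)]
  · rintro σ₃ hF₃ ⟨k1, k2, k3, k4, k5⟩
    refine ⟨⟨?_, ?_, ?_, ?_⟩, k5⟩
    · have e6 : σ₃.rarr rX = σ.rarr rX :=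
        (hF₃.rarr rX rfl).trans ((hF₂.rarr rX rfl).trans (hF₁.rarr rX rfl))
      have e7 : σ₃.rarr rY = σ.rarr rY :=
        (hF₃.rarr rY rfl).trans ((hF₂.rarr rY rfl).trans (hF₁.rarr rY rfl))
      have e8 : σ₃.rarr rS0 = σ.rarr rS0 :=
        (hF₃.rarr rS0 rfl).trans ((hF₂.rarr rS0 rfl).trans (hF₁.rarr rS0 rfl))
      have e9 : σ₃.rarr rS1 = σ.rarr rS1 :=
        (hF₃.rarr rS1 rfl).trans ((hF₂.rarr rS1 rfl).trans (hF₁.rarr rS1 rfl))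
      rw [e6, e7, e8, e9, hF₃.rarr rUA rfl, hF₃.rarr rUB rfl, ← hsl, ← hq]
      exact ⟨i3, i4, i6, i7, k1, k2, fun j hj => k3 j hj (by omega),
        fun j hj => k4 j hj (by omega)⟩
    · rw [hF₃.iarr aSt rfl]; exact i1
    · intro j hj
      rw [hF₃.iarr aSt rfl, i5 j hj, hF₃.iarr aRnk rfl, hF₂.iarr aRnk rfl, hF₁.iarr aRnk rfl]
    · rw [hF₃.iarr aSt rfl]; exact i2

theorem setUp_spec {N k : ℕ} {off : ℕ → ℕ} (hN : σ.ivar vN = N) (hK : σ.ivar vK = k)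
    (hmono : Monotone off) (hoff0 : off 0 = 0) (hoffk : off k = N)
    (hoff : ∀ i ≤ k, σ.iarr aOff i = off i) (hW : 2 * N + 2 * k ≤ W)
    (hR : ∀ e < N, σ.iarr aRnk e ≤ W) :
    Runs W setUp σ (400 * (N + k + 1)) (fun σ' =>
      ∀ i < k, IsSetUp σ' N i (off i) (off (i + 1) - off i)) := by
  unfold setUp
  refine (Runs.forUp (I := fun a σ' => ∀ i < a, IsSetUp σ' N i (off i) (off (i + 1) - off i)) k
    (fun i => 300 * (off (i + 1) - off i + 1)) (by omega) rfl
    (fun σ' hF => by rw [← hK]; exact hF.ivar vK rfl) (by simp) ?_).mono ?_ fun σ' _ h => h.1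
  · intro i σ' hF hi hvi hI
    have hm1 : off i ≤ off (i + 1) := hmono (Nat.le_succ i)
    have hm2 : off (i + 1) ≤ off k := hmono hi
    have eo : σ'.iarr aOff = σ.iarr aOff := hF.iarr aOff rfl
    refine (setUpFunction_spec (W := W) (σ := σ') (N := N) (i := i) (o := off i)
      (m := off (i + 1) - off i) ((hF.ivar vN rfl).trans hN) hvi (by rw [eo, hoff i hi.le])
      (by rw [eo, hoff (i + 1) hi]; omega) (by omega)
      fun j hj => by rw [hF.iarr aRnk rfl]; exact hR _ (by omega)).mono le_rfl ?_
    rintro σ'' hF'' ⟨h1, h2⟩ i' hi'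
    have hcon : ∀ {i' o m}, IsSetUp σ'' N i' o m → IsSetUp (σ''.setIVar vF (i + 1)) N i' o m :=
      fun h => ⟨h.1, h.2, h.3, h.4⟩
    rcases Nat.lt_or_ge i' i with h | h
    · have hm3 := hmono (Nat.le_succ i')
      have hm4 := hmono (Nat.succ_le_of_lt h)
      simp only [Nat.succ_eq_add_one] at hm3 hm4
      exact hcon ((hI i' h).congr h2 (by omega) (hF''.iarr aRnk rfl) (hF''.rarr rX rfl)
        (hF''.rarr rY rfl) (hF''.rarr rS0 rfl) (hF''.rarr rS1 rfl))
    · obtain rfl : i' = i := by omega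
      exact hcon h1
  · have := Finset.sum_range_tsub hmono k
    simp only [IExp.cost, Finset.sum_add_distrib, ← Finset.mul_sum, this, Finset.sum_const,
      Finset.card_range, smul_eq_mul]
    omega

end
/-! ### The staircase path of a level -/

/-- The first column that is tried for the row `h * (2 * m + 1)`. -/
def colLo (opt : ℕ → ℕ) (h m : ℕ) : ℕ := opt (2 * h * m)

/-- The last column that is tried for the row `h * (2 * m + 1)`. -/
def colHi (opt : ℕ → ℕ) (N h m : ℕ) : ℕ :=
  if 2 * h * (m + 1) ≤ N then opt (2 * h * (m + 1)) else N - 1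

/-- The columns chosen for the multiples of `2 * h` are legal and increase. Rows are counted
from 1; the entry for row 0 only serves as a lower bound. -/
structure OptMono (opt : ℕ → ℕ) (N h : ℕ) : Prop where
  zero : opt 0 = 0
  lt : ∀ m, 2 * h * m ≤ N → opt (2 * h * m) < N
  le : ∀ m, 2 * h * (m + 1) ≤ N → opt (2 * h * m) ≤ opt (2 * h * (m + 1))

/-- The staircase path of length `T` through the rows `pa t + 1` that are odd multiples of `h`, and
for each of them through the columns `pb t` from `colLo` to `colHi`. -/
structure IsPath (opt : ℕ → ℕ) (N h T : ℕ) (pa pb : ℕ → ℕ) : Prop where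
  length : T ≤ 2 * N
  row : ∀ t < T, ∃ m, pa t + 1 = h * (2 * m + 1) ∧ h * (2 * m + 1) ≤ N ∧
    colLo opt h m ≤ pb t ∧ pb t ≤ colHi opt N h m
  cover : ∀ m, h * (2 * m + 1) ≤ N → ∀ b, colLo opt h m ≤ b → b ≤ colHi opt N h m →
    ∃ t < T, pa t + 1 = h * (2 * m + 1) ∧ pb t = b
  mono : ∀ t t', t ≤ t' → t' < T → pa t ≤ pa t' ∧ pb t ≤ pb t'

theorem OptMono.colHi_lt {opt : ℕ → ℕ} {N h m : ℕ} (ho : OptMono opt N h) (hN : 0 < N) :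
    colHi opt N h m < N := by
  unfold colHi
  split_ifs with h1
  · exact ho.lt _ h1
  · omega

theorem OptMono.colLo_le {opt : ℕ → ℕ} {N h m : ℕ} (ho : OptMono opt N h)
    (hm : h * (2 * m + 1) ≤ N) : colLo opt h m ≤ colHi opt N h m := by
  unfold colHi colLo
  split_ifs with h1
  · exact ho.le _ h1
  · have e : h * (2 * m + 1) = 2 * h * m + h := by ring
    have := ho.lt m (by omega)
    omega

/-- The path up to time `t`, in row `r = h * (2 * m + 1)` and column `b`. -/
structure PartialPath (opt : ℕ → ℕ) (N h m t r b : ℕ) (pa pb : ℕ → ℕ) : Prop where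
  row_eq : r = h * (2 * m + 1)
  b_lt : b < N
  r_le : r ≤ N + 2 * h
  time : t + 1 ≤ b + r
  time' : t ≤ 2 * N
  col : r ≤ N → colLo opt h m ≤ b ∧ b ≤ colHi opt N h m
  row : ∀ s < t, ∃ m, pa s + 1 = h * (2 * m + 1) ∧ h * (2 * m + 1) ≤ N ∧
    colLo opt h m ≤ pb s ∧ pb s ≤ colHi opt N h m
  cover : ∀ m' b', h * (2 * m' + 1) ≤ N → colLo opt h m' ≤ b' → b' ≤ colHi opt N h m' →
    (m' < m ∨ m' = m ∧ b' < b) → ∃ s < t, pa s + 1 = h * (2 * m' + 1) ∧ pb s = b'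
  mono : ∀ s s', s ≤ s' → s' < t → pa s ≤ pa s' ∧ pb s ≤ pb s'
  le : ∀ s < t, pa s + 1 ≤ r ∧ pb s ≤ b

section PathLemmas
variable {opt pa pb : ℕ → ℕ} {N h m t r b : ℕ}

theorem PartialPath.zero (ho : OptMono opt N h) (hN : 0 < N) (hh : 0 < h) :
    PartialPath opt N h 0 0 h 0 pa pb where
  row_eq := by simp
  b_lt := hN
  r_le := by omega
  time := by omega
  time' := by omega
  col := fun _ => by simp [colLo, ho.zero]
  row := by simp
  cover := by omega
  mono := by omega
  le := by omega

/-- The common part of both kinds of steps: the position `(r, b)` is appended to the path. -/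
theorem PartialPath.step (hP : PartialPath opt N h m t r b pa pb) (hr : r ≤ N) (hh : 0 < h)
    {m' r' b' : ℕ} (hr' : r' = h * (2 * m' + 1)) (hb' : b' < N) (hr'N : r' ≤ N + 2 * h)
    (hrr : r ≤ r') (hbb : b ≤ b') (hlt : r + b < r' + b')
    (hcol : r' ≤ N → colLo opt h m' ≤ b' ∧ b' ≤ colHi opt N h m')
    (hcov : ∀ m'' b'', h * (2 * m'' + 1) ≤ N → colLo opt h m'' ≤ b'' → b'' ≤ colHi opt N h m'' →
      (m'' < m' ∨ m'' = m' ∧ b'' < b') → (m'' < m ∨ m'' = m ∧ b'' < b) ∨ m'' = m ∧ b'' = b) :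
    PartialPath opt N h m' (t + 1) r' b' (Function.update pa t (r - 1))
      (Function.update pb t b) := by
  have hr0 : 0 < r := by rw [hP.row_eq]; positivity
  have h1 := hP.time
  have h2 := hP.b_lt
  refine ⟨hr', hb', hr'N, by omega, by omega, hcol, fun s hs => ?_, fun m'' b'' a1 a2 a3 a4 => ?_,
    fun s s' hss hs => ?_, fun s hs => ?_⟩
  · rcases Nat.lt_or_ge s t with h | h
    · rw [Function.update_of_ne (by omega), Function.update_of_ne (by omega)]
      exact hP.row s h
    · rw [show s = t by omega, Function.update_self, Function.update_self]
      have := hP.col hr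
      exact ⟨m, by rw [← hP.row_eq]; omega, by rw [← hP.row_eq]; exact hr, this.1, this.2⟩
  · rcases hcov m'' b'' a1 a2 a3 a4 with h | ⟨rfl, rfl⟩
    · obtain ⟨s, hs, e1, e2⟩ := hP.cover m'' b'' a1 a2 a3 h
      exact ⟨s, by omega, by rwa [Function.update_of_ne (by omega)],
        by rwa [Function.update_of_ne (by omega)]⟩
    · exact ⟨t, by omega, by rw [Function.update_self, ← hP.row_eq]; omega,
        by rw [Function.update_self]⟩
  · rcases Nat.lt_or_ge s' t with h | h
    · rw [Function.update_of_ne (by omega), Function.update_of_ne (by omega),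
        Function.update_of_ne (by omega), Function.update_of_ne (by omega)]
      exact hP.mono s s' hss h
    · rw [show s' = t by omega, Function.update_self, Function.update_self]
      rcases Nat.lt_or_ge s t with h' | h'
      · rw [Function.update_of_ne (by omega), Function.update_of_ne (by omega)]
        have := hP.le s h'
        omega
      · rw [show s = t by omega, Function.update_self, Function.update_self]
        exact ⟨le_rfl, le_rfl⟩
  · rcases Nat.lt_or_ge s t with h | h
    · rw [Function.update_of_ne (by omega), Function.update_of_ne (by omega)]
      have := hP.le s h
      omega
    · rw [show s = t by omega, Function.update_self, Function.update_self]
      omega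

/-- Within a row, the path goes on to the next column. -/
theorem PartialPath.right (hP : PartialPath opt N h m t r b pa pb) (ho : OptMono opt N h)
    (hh : 0 < h) (hr : r ≤ N) (hb : b < colHi opt N h m) :
    PartialPath opt N h m (t + 1) r (b + 1) (Function.update pa t (r - 1))
      (Function.update pb t b) := by
  have h1 := ho.colHi_lt (m := m) (by have := hP.b_lt; omega)
  have h2 := hP.col hr
  exact hP.step hr hh hP.row_eq (by omega) hP.r_le le_rfl (by omega) (by omega)
    (fun _ => ⟨by omega, by omega⟩) (by omega)

/-- The last column of a row is the first column of the next row, so the path goes straight down. -/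
theorem PartialPath.down (hP : PartialPath opt N h m t r b pa pb) (ho : OptMono opt N h)
    (hh : 0 < h) (hr : r ≤ N) (hb : colHi opt N h m ≤ b) :
    PartialPath opt N h (m + 1) (t + 1) (r + h + h) b (Function.update pa t (r - 1))
      (Function.update pb t b) := by
  have h2 := hP.col hr
  have e : r + h + h = h * (2 * (m + 1) + 1) := by rw [hP.row_eq]; ring
  refine hP.step hr hh e hP.b_lt (by omega) (by omega) le_rfl (by omega) (fun hr' => ?_) ?_
  · have e1 : 2 * h * (m + 1) = r + h := by rw [hP.row_eq]; ring
    have e2 : colHi opt N h m = colLo opt h (m + 1) := by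
      unfold colHi colLo
      rw [if_pos (by omega)]
    have := ho.colLo_le (m := m + 1) (by omega)
    omega
  · intro m'' b'' _ _ h3 h4
    rcases h4 with h4 | ⟨rfl, h4⟩
    · rcases Nat.lt_or_ge m'' m with h5 | h5
      · omega
      · obtain rfl : m'' = m := by omega
        omega
    · have e1 : 2 * h * (m + 1) = r + h := by rw [hP.row_eq]; ring
      have e3 : colHi opt N h m = colLo opt h (m + 1) := by
        unfold colHi colLo
        rw [if_pos (by omega)]
      omega

theorem PartialPath.done (hP : PartialPath opt N h m t r b pa pb) (hr : N < r) :
    IsPath opt N h t pa pb where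
  length := hP.time'
  row := hP.row
  cover := fun m' hm b' h1 h2 => hP.cover m' b' hm h1 h2 (Or.inl (by
    have := hP.row_eq
    by_contra hmm
    have : h * (2 * m + 1) ≤ h * (2 * m' + 1) := Nat.mul_le_mul_left _ (by omega)
    omega))
  mono := hP.mono

end PathLemmas

/-- Append the current position to the path and move on. -/
def pathStep : Program :=
  .iput aPA (.var vT) (.sub (.var vR) (.const 1)) ;;
  .iput aPB (.var vT) (.var vB) ;;
  .iset vT (.add (.var vT) (.const 1)) ;;
  .branch (.ile (.add (.var vR) (.var vH)) (.var vN))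
    (.iset vHi (.arr aOpt (.add (.var vR) (.var vH))))
    (.iset vHi (.sub (.var vN) (.const 1))) ;;
  .branch (.ile (.var vHi) (.var vB))
    (.iset vR (.add (.add (.var vR) (.var vH)) (.var vH)))
    (.iset vB (.add (.var vB) (.const 1)))

/-- Build the path of the level `vH`. Every step increases the column or the row, which bounds its
length. -/
def buildPath : Program :=
  .iset vT (.const 0) ;;
  .iset vR (.var vH) ;;
  .iset vB (.const 0) ;;
  .loop (.ile (.var vR) (.var vN)) pathStep

/-- For all `p` up to `vN`, put the first time at which the array `A` has a value `≥ p` into the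
array `B`. -/
def firstTimes (A B : ℕ) : Program :=
  .iset vI (.const 0) ;;
  .iset vJ (.const 0) ;;
  .loop (.ile (.var vI) (.var vN))
    (.branch (.and (.not (.ile (.var vT) (.var vJ))) (.not (.ile (.var vI) (.arr A (.var vJ)))))
      (.iset vJ (.add (.var vJ) (.const 1)))
      (.iput B (.var vI) (.var vJ) ;; .iset vI (.add (.var vI) (.const 1))))

/-- `first p` is the first time before `T` at which `pos` is at least `p`, or `T`. -/
structure IsFirst (pos : ℕ → ℕ) (T N : ℕ) (first : ℕ → ℕ) : Prop where
  le : ∀ p ≤ N, first p ≤ T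
  lt_iff : ∀ p ≤ N, ∀ t < T, t < first p ↔ pos t < p

theorem IsFirst.mono {pos first : ℕ → ℕ} {T N : ℕ} (h : IsFirst pos T N first) {p p' : ℕ}
    (hp : p ≤ p') (hp' : p' ≤ N) : first p ≤ first p' := by
  by_contra hlt
  have h1 := h.le p (by omega)
  have h2 := (h.lt_iff p (by omega) (first p') (by omega)).1 (by omega)
  have h3 := (h.lt_iff p' hp' (first p') (by omega)).2 (by omega)
  omega

/-- Clear the arrays of differences up to index `vT`, at which ranges may end. -/
def clearSums : Program :=
  .iset vUp (.add (.var vT) (.const 1)) ;;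
  .forUp vP (.var vUp)
    (.rput rCC (.var vP) (.const 0) ;; .rput rCA (.var vP) (.const 0) ;;
     .rput rCB (.var vP) (.const 0))

section
variable {W : ℕ} {σ : State} {N h : ℕ}

theorem buildPath_spec (hN : σ.ivar vN = N) (hH : σ.ivar vH = h) (hN0 : 0 < N) (hh : 0 < h)
    (hhN : h ≤ N) (ho : OptMono (σ.iarr aOpt) N h) (hW : 3 * N ≤ W) :
    Runs W buildPath σ (200 * (N + 1)) (fun σ' =>
      IsPath (σ.iarr aOpt) N h (σ'.ivar vT) (σ'.iarr aPA) (σ'.iarr aPB)) := by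
  unfold buildPath
  simp [hH]
  refine ⟨by omega, by omega, by omega, by omega, ?_⟩
  refine (Runs.loop_measure (I := fun σ' => ∃ m, PartialPath (σ.iarr aOpt) N h m (σ'.ivar vT)
    (σ'.ivar vR) (σ'.ivar vB) (σ'.iarr aPA) (σ'.iarr aPB))
    (fun σ' => (N - σ'.ivar vB) + (N + 1 - σ'.ivar vR)) 60 ?_ ?_).mono ?_ ?_
  · exact ⟨0, by simpa using PartialPath.zero ho hN0 hh⟩
  · rintro σ' hF ⟨m, hP⟩ hb
    have e1 : σ'.ivar vN = N := (hF.ivar vN rfl).trans (by simpa using hN)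
    have e2 : σ'.ivar vH = h := (hF.ivar vH rfl).trans (by simpa using hH)
    have e3 : σ'.iarr aOpt = σ.iarr aOpt := (hF.iarr aOpt rfl).trans rfl
    simp [e1] at hb
    have h1 := hP.b_lt
    have h2 := hP.time'
    have h3 := ho.colHi_lt (m := m) hN0
    have e4 : 2 * h * (m + 1) = σ'.ivar vR + h := by rw [hP.row_eq]; ring
    have h5 := hP.time
    have hrt := hP.right ho hh hb
    have hdn := hP.down ho hh hb
    simp only [colHi, e4] at hrt hdn h3
    simp [pathStep, e1, e2, e3]
    refine ⟨by omega, by omega, by omega, fun hle => ?_, fun hle => ?_⟩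
    · rw [if_pos hle] at hrt hdn h3
      exact ⟨by omega, fun hc => ⟨by omega, ⟨m + 1, hdn hc⟩, by omega⟩,
        fun hc => ⟨by omega, ⟨m, hrt hc⟩, by omega⟩⟩
    · rw [if_neg (by omega)] at hrt hdn h3
      exact ⟨by omega, fun hc => ⟨by omega, ⟨m + 1, hdn (by omega)⟩, by omega⟩,
        fun hc => ⟨by omega, ⟨m, hrt (by omega)⟩, by omega⟩⟩
  · simp; omega
  · rintro σ' hF ⟨⟨m, hP⟩, hb⟩
    have e1 : σ'.ivar vN = N := (hF.ivar vN rfl).trans (by simpa using hN)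
    simp [e1] at hb
    exact hP.done hb

theorem firstTimes_spec {A B T : ℕ} (hAB : Nat.beq A B = false) (hN : σ.ivar vN = N)
    (hT : σ.ivar vT = T) (hmono : ∀ t t', t ≤ t' → t' < T → σ.iarr A t ≤ σ.iarr A t')
    (hW : T ≤ W) (hW' : N + 1 ≤ W) :
    Runs W (firstTimes A B) σ (50 * (N + T + 2)) (fun σ' =>
      IsFirst (σ.iarr A) T N (σ'.iarr B)) := by
  unfold firstTimes
  simp
  refine ⟨by omega, by omega, ?_⟩
  refine (Runs.loop_measure (I := fun σ' => σ'.ivar vJ ≤ T ∧ σ'.ivar vI ≤ N + 1 ∧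
    (σ'.ivar vI ≤ N → ∀ t < σ'.ivar vJ, σ.iarr A t < σ'.ivar vI) ∧
    (∀ p < σ'.ivar vI, σ'.iarr B p ≤ T ∧ ∀ t < T, t < σ'.iarr B p ↔ σ.iarr A t < p))
    (fun σ' => (N + 1 - σ'.ivar vI) + (T - σ'.ivar vJ)) 20 ?_ ?_).mono ?_ ?_
  · simp
  · rintro σ' hF ⟨h1, h2, h3, h4⟩ hb
    have e1 : σ'.ivar vN = N := (hF.ivar vN rfl).trans (by simpa using hN)
    have e2 : σ'.ivar vT = T := (hF.ivar vT rfl).trans (by simpa using hT)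
    have e3 : σ'.iarr A = σ.iarr A := (hF.iarr A (by simp [Program.putsI, hAB])).trans rfl
    simp [e1] at hb
    simp [e2, e3]
    refine ⟨fun h5 h6 => ⟨by omega, ⟨by omega, h2, fun _ t ht => ?_, h4⟩, by omega⟩,
      fun h5 => ⟨by omega, by omega, ⟨h1, hb, fun h6 t ht => ?_, fun p hp => ?_⟩, by omega⟩⟩
    · rcases Nat.lt_or_ge t (σ'.ivar vJ) with h | h
      · exact h3 hb t h
      · rwa [show t = σ'.ivar vJ by omega]
    · exact (h3 hb t ht).le
    · rcases Nat.lt_or_ge p (σ'.ivar vI) with h | h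
      · rw [Function.update_of_ne (by omega)]
        exact h4 p h
      · obtain rfl : p = σ'.ivar vI := by omega
        rw [Function.update_self]
        refine ⟨h1, fun t ht => ⟨h3 hb t, fun h7 => ?_⟩⟩
        by_contra h8
        have h9 := hmono (σ'.ivar vJ) t (by omega) ht
        have := h5 (by omega)
        omega
  · simp; omega
  · rintro σ' hF ⟨⟨h1, h2, h3, h4⟩, hb⟩
    have e1 : σ'.ivar vN = N := (hF.ivar vN rfl).trans (by simpa using hN)
    simp [e1] at hb
    exact ⟨fun p hp => (h4 p (by omega)).1, fun p hp => (h4 p (by omega)).2⟩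

theorem clearSums_spec {T : ℕ} (hT : σ.ivar vT = T) (hW : T + 1 ≤ W) :
    Runs W clearSums σ (50 * (T + 2)) (fun σ' =>
      ∀ t ≤ T, σ'.rarr rCC t = 0 ∧ σ'.rarr rCA t = 0 ∧ σ'.rarr rCB t = 0) := by
  unfold clearSums
  simp [hT]
  refine ⟨by omega, hW, (Runs.forVar (I := fun p σ' => ∀ t < p,
    σ'.rarr rCC t = 0 ∧ σ'.rarr rCA t = 0 ∧ σ'.rarr rCB t = 0) (T + 1) 20 (by simp) hW rfl rfl
    (by simp) ?_).mono (by omega) ?_⟩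
  · intro p σ' hF hp hvp hI
    simp [hvp]
    intro t ht
    rcases Nat.lt_or_ge t p with h | h
    · simpa [Function.update_of_ne (show t ≠ p by omega)] using hI t h
    · simp [show t = p by omega]
  · exact fun σ' _ h t ht => h t (by omega)

end
/-! ### Adding the costs of one function along a path -/

/-- The contents of the tables that do not change from level to level. Function `i < k` has
pieces `0, …, cnt i`, stored from position `base i` on; piece `q` starts at the candidate `st q`,
and there its rising and falling part are `ua q + ub q * x` and `da q + db q * x`. The values of
both parts at the candidate `p` are `rise i p` and `fall i p`. -/
structure Table where
  k : ℕ
  n : ℕ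
  off : ℕ → ℕ
  st : ℕ → ℕ
  xs : ℕ → ℝ
  ua : ℕ → ℝ
  ub : ℕ → ℝ
  da : ℕ → ℝ
  db : ℕ → ℝ
  rise : ℕ → ℕ → ℝ
  fall : ℕ → ℕ → ℝ

namespace Table

/-- The position of the first piece of function `i`; each earlier function takes two entries more
than it has breakpoints. -/
def base (d : Table) (i : ℕ) : ℕ := d.off i + i + i

/-- The number of breakpoints of function `i`. -/
def cnt (d : Table) (i : ℕ) : ℕ := d.off (i + 1) - d.off i

/-- The cost of a pair of candidates, up to an additive constant. -/
noncomputable def cost (d : Table) (a b : ℕ) : ℝ := pairCost d.k d.rise d.fall a b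

/-- The table consistently describes functions: the pieces of each one cover all candidates, the
lines agree with the parts of the function on them, and these parts are monotone. -/
structure Valid (d : Table) : Prop where
  n_pos : 0 < d.n
  off_mono : Monotone d.off
  off_zero : d.off 0 = 0
  off_last : d.off d.k = d.n
  st_zero : ∀ i < d.k, d.st (d.base i) = 0
  st_last : ∀ i < d.k, d.st (d.base i + d.cnt i + 1) = d.n
  st_mono : ∀ i < d.k, ∀ j ≤ d.cnt i, d.st (d.base i + j) ≤ d.st (d.base i + j + 1)
  rise_eq : ∀ i < d.k, ∀ j ≤ d.cnt i, ∀ p, d.st (d.base i + j) ≤ p → p < d.st (d.base i + j + 1) →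
    d.rise i p = d.ua (d.base i + j) + d.ub (d.base i + j) * d.xs p
  fall_eq : ∀ i < d.k, ∀ j ≤ d.cnt i, ∀ p, d.st (d.base i + j) ≤ p → p < d.st (d.base i + j + 1) →
    d.fall i p = d.da (d.base i + j) + d.db (d.base i + j) * d.xs p
  rise_mono : ∀ i < d.k, ∀ p p', p ≤ p' → p' < d.n → d.rise i p ≤ d.rise i p'
  fall_anti : ∀ i < d.k, ∀ p p', p ≤ p' → p' < d.n → d.fall i p' ≤ d.fall i p

theorem Valid.st_le {d : Table} (hd : d.Valid) {i j : ℕ} (hi : i < d.k) (hj : j ≤ d.cnt i + 1) :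
    d.st (d.base i + j) ≤ d.n := by
  induction hj using Nat.decreasingInduction with
  | self => rw [← add_assoc, hd.st_last i hi]
  | of_succ j hj ih => exact (hd.st_mono i hi j (by omega)).trans ih

/-- The state `σ` holds the table. -/
structure Stored (d : Table) (σ : State) : Prop where
  k : σ.ivar vK = d.k
  n : σ.ivar vN = d.n
  off : ∀ i ≤ d.k, σ.iarr aOff i = d.off i
  st : σ.iarr aSt = d.st
  xs : σ.rarr rXS = d.xs
  ua : σ.rarr rUA = d.ua
  ub : σ.rarr rUB = d.ub
  da : σ.rarr rDA = d.da
  db : σ.rarr rDB = d.db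

end Table

/-- `P` does not assign to the cells that hold the table. -/
def Program.keepsTable (P : Program) : Bool :=
  !(P.setsI vK || P.setsI vN || P.putsI aOff || P.putsI aSt || P.putsR rXS || P.putsR rUA ||
    P.putsR rUB || P.putsR rDA || P.putsR rDB)

theorem Table.Stored.frame {d : Table} {σ σ' : State} {P : Program} (h : d.Stored σ)
    (hF : Frame P σ σ') (hP : P.keepsTable = true) : d.Stored σ' := by
  simp only [Program.keepsTable, Bool.not_eq_true', Bool.or_eq_false_iff] at hP
  obtain ⟨⟨⟨⟨⟨⟨⟨⟨p1, p2⟩, p3⟩, p4⟩, p5⟩, p6⟩, p7⟩, p8⟩, p9⟩ := hP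
  exact ⟨(hF.ivar _ p1).trans h.k, (hF.ivar _ p2).trans h.n,
    fun i hi => by rw [hF.iarr _ p3, h.off i hi], (hF.iarr _ p4).trans h.st,
    (hF.rarr _ p5).trans h.xs, (hF.rarr _ p6).trans h.ua, (hF.rarr _ p7).trans h.ub,
    (hF.rarr _ p8).trans h.da, (hF.rarr _ p9).trans h.db⟩

theorem Table.Stored.setIVar {d : Table} {σ : State} (h : d.Stored σ) (v a : ℕ) (hv : 2 ≤ v) :
    d.Stored (σ.setIVar v a) :=
  ⟨by simp [h.k, show 0 ≠ v by omega], by simp [h.n, show 1 ≠ v by omega], h.off, h.st, h.xs, h.ua,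
    h.ub, h.da, h.db⟩

/-- A path of length `T`, with its positions `pa`, `pb` and the first times `ta`, `tb` at which they
reach the candidates. -/
structure Path where
  T : ℕ
  pa : ℕ → ℕ
  pb : ℕ → ℕ
  ta : ℕ → ℕ
  tb : ℕ → ℕ

/-- The path is monotone and stays within the candidates. -/
structure Path.Valid (r : Path) (n : ℕ) : Prop where
  length : r.T ≤ 2 * n
  pa_lt : ∀ t < r.T, r.pa t < n
  pb_lt : ∀ t < r.T, r.pb t < n
  pa_mono : ∀ t t', t ≤ t' → t' < r.T → r.pa t ≤ r.pa t'
  pb_mono : ∀ t t', t ≤ t' → t' < r.T → r.pb t ≤ r.pb t'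
  ta_first : IsFirst r.pa r.T n r.ta
  tb_first : IsFirst r.pb r.T n r.tb

/-- The state `σ` holds the path. -/
structure Path.Stored (r : Path) (σ : State) : Prop where
  T : σ.ivar vT = r.T
  pa : σ.iarr aPA = r.pa
  pb : σ.iarr aPB = r.pb
  ta : σ.iarr aTA = r.ta
  tb : σ.iarr aTB = r.tb

/-- `P` does not assign to the cells that hold the path. -/
def Program.keepsPath (P : Program) : Bool :=
  !(P.setsI vT || P.putsI aPA || P.putsI aPB || P.putsI aTA || P.putsI aTB)

theorem Path.Stored.frame {r : Path} {σ σ' : State} {P : Program} (h : r.Stored σ)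
    (hF : Frame P σ σ') (hP : P.keepsPath = true) : r.Stored σ' := by
  simp only [Program.keepsPath, Bool.not_eq_true', Bool.or_eq_false_iff] at hP
  obtain ⟨⟨⟨⟨p1, p2⟩, p3⟩, p4⟩, p5⟩ := hP
  exact ⟨(hF.ivar _ p1).trans h.T, (hF.iarr _ p2).trans h.pa, (hF.iarr _ p3).trans h.pb,
    (hF.iarr _ p4).trans h.ta, (hF.iarr _ p5).trans h.tb⟩

theorem Path.Stored.setIVar {r : Path} {σ : State} (h : r.Stored σ) (v a : ℕ) (hv : vT ≠ v) :
    r.Stored (σ.setIVar v a) :=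
  ⟨by simp [h.T, hv], h.pa, h.pb, h.ta, h.tb⟩

/-- At the time `e`, the falling part at the row, read off from piece `vQA`, is at most the rising
part at the column, read off from piece `vQB`. -/
def crossed (e : IExp) : Test :=
  .rle (.add (.arr rDA (.var vQA)) (.mul (.arr rDB (.var vQA)) (.arr rXS (.arr aPA e))))
    (.add (.arr rUA (.var vQB)) (.mul (.arr rUB (.var vQB)) (.arr rXS (.arr aPB e))))

/-- The time at which the path leaves piece `vQA` with its row or piece `vQB` with its column. -/
def pieceEnd : IExp :=
  .min (.arr aTA (.arr aSt (.add (.var vQA) (.const 1))))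
    (.arr aTB (.arr aSt (.add (.var vQB) (.const 1))))

/-- Follow the path from piece to piece until the falling part at the row gets smaller than the
rising part at the column. -/
def walk : Program :=
  .iset vS (.const 0) ;;
  .iset vQA (.var vQ) ;;
  .iset vQB (.var vQ) ;;
  .iset vE pieceEnd ;;
  .loop (.and (.not (.ile (.var vT) (.var vE)))
      (.not (.and (.not (.ile (.var vE) (.var vS))) (crossed (.sub (.var vE) (.const 1))))))
    (.branch (.ile (.arr aTA (.arr aSt (.add (.var vQA) (.const 1)))) (.var vE))
      (.iset vQA (.add (.var vQA) (.const 1)))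
      (.iset vQB (.add (.var vQB) (.const 1))) ;;
     .iset vS (.var vE) ;;
     .iset vE pieceEnd)

/-- Find the time of crossing between `vS` and `vE` by bisection. -/
def search : Program :=
  .iset vLo (.var vS) ;;
  .iset vUp (.var vE) ;;
  .loop (.not (.ile (.var vUp) (.var vLo)))
    (.iset vMid (.half (.add (.var vLo) (.var vUp))) ;;
     .branch (crossed (.var vMid))
      (.iset vUp (.var vMid))
      (.iset vLo (.add (.var vMid) (.const 1))))

/-- `r` crosses function `i` at time `c`: this is the first time at which the falling part at the
row is at most the rising part at the column. -/
def CrossesAt (d : Table) (r : Path) (i c : ℕ) : Prop :=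
  c ≤ r.T ∧ ∀ t < r.T, c ≤ t ↔ d.fall i (r.pa t) ≤ d.rise i (r.pb t)

/-- What is known after the walk: the crossing lies between `vS` and `vE`, and between these times
the path stays in the pieces `vQA` and `vQB`. -/
structure Walked (d : Table) (r : Path) (i : ℕ) (σ : State) : Prop where
  le : σ.ivar vS ≤ σ.ivar vE
  le_T : σ.ivar vE ≤ r.T
  before : ∀ t < σ.ivar vS, t < r.T → ¬ d.fall i (r.pa t) ≤ d.rise i (r.pb t)
  after : ∀ t, σ.ivar vE ≤ t → t < r.T → d.fall i (r.pa t) ≤ d.rise i (r.pb t)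
  fall_eq : ∀ t, σ.ivar vS ≤ t → t < σ.ivar vE →
    d.fall i (r.pa t) = d.da (σ.ivar vQA) + d.db (σ.ivar vQA) * d.xs (r.pa t)
  rise_eq : ∀ t, σ.ivar vS ≤ t → t < σ.ivar vE →
    d.rise i (r.pb t) = d.ua (σ.ivar vQB) + d.ub (σ.ivar vQB) * d.xs (r.pb t)

section
variable {W : ℕ} {σ : State} {d : Table} {r : Path} {i : ℕ}

/-- Along the path, the falling part at the row decreases and the rising part at the column
increases. -/
theorem crossing_persists (hd : d.Valid) (hr : r.Valid d.n) (hi : i < d.k) {t t' : ℕ} (ht : t ≤ t')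
    (ht' : t' < r.T) (h : d.fall i (r.pa t) ≤ d.rise i (r.pb t)) :
    d.fall i (r.pa t') ≤ d.rise i (r.pb t') :=
  (hd.fall_anti i hi _ _ (hr.pa_mono t t' ht ht') (hr.pa_lt t' ht')).trans
    (h.trans (hd.rise_mono i hi _ _ (hr.pb_mono t t' ht ht') (hr.pb_lt t' ht')))

/-- The invariant of the walk: between the times `s` and `e`, the row is in piece `qa` and the column
in piece `qb`, and the crossing has not occurred before `s`. -/
structure Walking (d : Table) (r : Path) (i s e qa qb : ℕ) : Prop where
  le_a : d.base i ≤ qa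
  a_le : qa ≤ d.base i + d.cnt i
  le_b : d.base i ≤ qb
  b_le : qb ≤ d.base i + d.cnt i
  le : s ≤ e
  e_eq : e = min (r.ta (d.st (qa + 1))) (r.tb (d.st (qb + 1)))
  ta_le : r.ta (d.st qa) ≤ s
  tb_le : r.tb (d.st qb) ≤ s
  before : ∀ t < s, t < r.T → ¬ d.fall i (r.pa t) ≤ d.rise i (r.pb t)

theorem Walking.fall_eq {s e qa qb : ℕ} (h : Walking d r i s e qa qb) (hd : d.Valid)
    (hr : r.Valid d.n) (hi : i < d.k) {t : ℕ} (hs : s ≤ t) (he : t < e) :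
    d.fall i (r.pa t) = d.da qa + d.db qa * d.xs (r.pa t) := by
  obtain ⟨j, rfl⟩ := Nat.exists_eq_add_of_le h.le_a
  have h1 := h.a_le
  have h2 := h.e_eq
  have h3 := h.ta_le
  have hb := hd.st_le hi (j := j) (by omega)
  have hb' := hd.st_le hi (j := j + 1) (by omega)
  rw [← add_assoc] at hb'
  have hT : t < r.T := by have := hr.ta_first.le _ hb'; omega
  refine hd.fall_eq i hi j (by omega) _ ?_ ?_
  · by_contra hlt
    have := (hr.ta_first.lt_iff _ hb t hT).2 (by omega)
    omega
  · exact (hr.ta_first.lt_iff _ hb' t hT).1 (by omega)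

theorem Walking.rise_eq {s e qa qb : ℕ} (h : Walking d r i s e qa qb) (hd : d.Valid)
    (hr : r.Valid d.n) (hi : i < d.k) {t : ℕ} (hs : s ≤ t) (he : t < e) :
    d.rise i (r.pb t) = d.ua qb + d.ub qb * d.xs (r.pb t) := by
  obtain ⟨j, rfl⟩ := Nat.exists_eq_add_of_le h.le_b
  have h1 := h.b_le
  have h2 := h.e_eq
  have h3 := h.tb_le
  have hb := hd.st_le hi (j := j) (by omega)
  have hb' := hd.st_le hi (j := j + 1) (by omega)
  rw [← add_assoc] at hb'
  have hT : t < r.T := by have := hr.tb_first.le _ hb'; omega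
  refine hd.rise_eq i hi j (by omega) _ ?_ ?_
  · by_contra hlt
    have := (hr.tb_first.lt_iff _ hb t hT).2 (by omega)
    omega
  · exact (hr.tb_first.lt_iff _ hb' t hT).1 (by omega)

theorem IsFirst.zero {pos first : ℕ → ℕ} {T N : ℕ} (h : IsFirst pos T N first) : first 0 = 0 := by
  by_contra h0
  have h1 := h.le 0 (by omega)
  have := (h.lt_iff 0 (by omega) 0 (by omega)).1 (by omega)
  omega

theorem IsFirst.last {pos first : ℕ → ℕ} {T N : ℕ} (h : IsFirst pos T N first)
    (hpos : ∀ t < T, pos t < N) : first N = T := by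
  by_contra h0
  have h1 := h.le N le_rfl
  have := (h.lt_iff N le_rfl (first N) (by omega)).2 (hpos _ (by omega))
  omega

theorem Walking.zero (hd : d.Valid) (hr : r.Valid d.n) (hi : i < d.k) :
    Walking d r i 0 (min (r.ta (d.st (d.base i + 1))) (r.tb (d.st (d.base i + 1))))
      (d.base i) (d.base i) where
  le_a := le_rfl
  a_le := by omega
  le_b := le_rfl
  b_le := by omega
  le := by omega
  e_eq := rfl
  ta_le := by rw [hd.st_zero i hi, hr.ta_first.zero]
  tb_le := by rw [hd.st_zero i hi, hr.tb_first.zero]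
  before := by omega

/-- At time `e` the row or the column enters a new piece. As long as the path goes on, there is one. -/
theorem Walking.next {s e qa qb : ℕ} (h : Walking d r i s e qa qb) (hd : d.Valid)
    (hr : r.Valid d.n) (hi : i < d.k) (he : e < r.T)
    (hc : s < e → ¬ d.fall i (r.pa (e - 1)) ≤ d.rise i (r.pb (e - 1))) :
    (r.ta (d.st (qa + 1)) ≤ e → qa < d.base i + d.cnt i ∧ Walking d r i e
      (min (r.ta (d.st (qa + 1 + 1))) (r.tb (d.st (qb + 1)))) (qa + 1) qb) ∧
    (e < r.ta (d.st (qa + 1)) → qb < d.base i + d.cnt i ∧ Walking d r i e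
      (min (r.ta (d.st (qa + 1))) (r.tb (d.st (qb + 1 + 1)))) qa (qb + 1)) := by
  obtain ⟨h1, h2, h3, h4, h5, h6, h7, h8, h9⟩ := h
  have hbef : ∀ t < e, t < r.T → ¬ d.fall i (r.pa t) ≤ d.rise i (r.pb t) := by
    intro t ht htT hcr
    rcases Nat.lt_or_ge t s with hts | hts
    · exact h9 t hts htT hcr
    · exact hc (by omega) (crossing_persists hd hr hi (t := t) (by omega) (by omega) hcr)
  obtain ⟨ja, rfl⟩ := Nat.exists_eq_add_of_le h1
  obtain ⟨jb, rfl⟩ := Nat.exists_eq_add_of_le h3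
  have hlast := hd.st_last i hi
  constructor
  · intro hle
    have hlt : ja < d.cnt i := by
      by_contra hge
      obtain rfl : ja = d.cnt i := by omega
      rw [hlast, hr.ta_first.last hr.pa_lt] at hle
      omega
    have hm := hr.ta_first.mono (hd.st_mono i hi (ja + 1) (by omega))
      (by rw [add_assoc]; exact hd.st_le hi (j := ja + 1 + 1) (by omega))
    rw [← add_assoc] at hm
    exact ⟨by omega, ⟨by omega, by omega, by omega, by omega, by omega, rfl, by omega, by omega,
      hbef⟩⟩
  · intro hle
    have hlt : jb < d.cnt i := by
      by_contra hge
      obtain rfl : jb = d.cnt i := by omega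
      rw [hlast, hr.tb_first.last hr.pb_lt] at h6
      omega
    have hm := hr.tb_first.mono (hd.st_mono i hi (jb + 1) (by omega))
      (by rw [add_assoc]; exact hd.st_le hi (j := jb + 1 + 1) (by omega))
    rw [← add_assoc] at hm
    exact ⟨by omega, ⟨by omega, by omega, by omega, by omega, by omega, rfl, by omega, by omega,
      hbef⟩⟩

theorem Walking.end_le {s e qa qb : ℕ} (h : Walking d r i s e qa qb) (hd : d.Valid)
    (hr : r.Valid d.n) (hi : i < d.k) : e ≤ r.T := by
  obtain ⟨ja, rfl⟩ := Nat.exists_eq_add_of_le h.le_a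
  have h1 := h.a_le
  have := hr.ta_first.le _ (hd.st_le hi (j := ja + 1) (by omega))
  have := h.e_eq
  rw [add_assoc (d.base i)] at this
  omega

/-- The number of iterations is bounded because each one advances `vQA` or `vQB` by one piece. -/
theorem walk_spec (hd : d.Valid) (hr : r.Valid d.n) (hi : i < d.k) (hdσ : d.Stored σ)
    (hrσ : r.Stored σ) (hQ : σ.ivar vQ = d.base i) (hW : d.base i + d.cnt i + 2 * d.n + 1 ≤ W) :
    Runs W walk σ (400 * (d.cnt i + 1)) (fun σ' => Walked d r i σ') := by
  have hlen := hr.length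
  have hz := Walking.zero hd hr hi
  have hze := hz.end_le hd hr hi
  unfold walk pieceEnd
  simp [hQ, hrσ.ta, hrσ.tb, hdσ.st]
  refine ⟨by omega, by omega, by omega, by omega, by omega, by omega, by omega, ?_⟩
  have hd₀ := (((hdσ.setIVar vS 0 (by omega)).setIVar vQA (d.base i) (by omega)).setIVar vQB
    (d.base i) (by omega)).setIVar vE
    (min (r.ta (d.st (d.base i + 1))) (r.tb (d.st (d.base i + 1)))) (by omega)
  have hr₀ := (((hrσ.setIVar vS 0 (by omega)).setIVar vQA (d.base i) (by omega)).setIVar vQB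
    (d.base i) (by omega)).setIVar vE
    (min (r.ta (d.st (d.base i + 1))) (r.tb (d.st (d.base i + 1)))) (by omega)
  refine (Runs.loop_measure (I := fun σ' => Walking d r i (σ'.ivar vS) (σ'.ivar vE) (σ'.ivar vQA)
      (σ'.ivar vQB))
    (fun σ' => (d.base i + d.cnt i - σ'.ivar vQA) + (d.base i + d.cnt i - σ'.ivar vQB))
    80 ?_ ?_).mono ?_ ?_
  · simpa using hz
  · intro σ' hF hI hb
    have hd' := hd₀.frame hF rfl
    have hr' := hr₀.frame hF rfl
    simp [crossed, hd'.xs, hd'.ua, hd'.ub, hd'.da, hd'.db, hr'.T, hr'.pa, hr'.pb] at hb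
    obtain ⟨hn1, hn2⟩ := hI.next hd hr hi hb.1 (fun hlt => by
      rw [hI.fall_eq hd hr hi (t := σ'.ivar vE - 1) (by omega) (by omega),
        hI.rise_eq hd hr hi (t := σ'.ivar vE - 1) (by omega) (by omega)]
      exact not_le.2 (hb.2 hlt))
    have h1 := hI.a_le
    have h2 := hI.b_le
    simp [hr'.ta, hr'.tb, hd'.st]
    refine ⟨fun hle => ?_, fun hlt => ?_⟩
    · obtain ⟨h3, h4⟩ := hn1 hle
      have := h4.end_le hd hr hi
      exact ⟨by omega, by omega, by omega, h4, by omega⟩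
    · obtain ⟨h3, h4⟩ := hn2 hlt
      have := h4.end_le hd hr hi
      exact ⟨by omega, by omega, by omega, h4, by omega⟩
  · simp [crossed]; omega
  · rintro σ' hF ⟨hI, hb⟩
    have hd' := hd₀.frame hF rfl
    have hr' := hr₀.frame hF rfl
    simp [crossed, hd'.xs, hd'.ua, hd'.ub, hd'.da, hd'.db, hr'.T, hr'.pa, hr'.pb] at hb
    refine ⟨hI.le, hI.end_le hd hr hi, hI.before, fun t h1 h2 => ?_,
      fun t => hI.fall_eq hd hr hi, fun t => hI.rise_eq hd hr hi⟩
    obtain ⟨h3, h4⟩ := hb (by omega)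
    rw [← hI.fall_eq hd hr hi (by omega) (by omega), ← hI.rise_eq hd hr hi (by omega) (by omega)]
      at h4
    exact crossing_persists hd hr hi (by omega) h2 h4

/-- Halving shortens the binary expansion. -/
theorem size_lt_of_le_half {x y : ℕ} (hx : 0 < x) (hy : y ≤ x / 2) : Nat.size y < Nat.size x := by
  have h0 : 0 < Nat.size x := Nat.size_pos.2 hx
  have h1 : x < 2 ^ Nat.size x := Nat.lt_size_self x
  obtain ⟨s, hs⟩ := Nat.exists_eq_add_of_lt h0
  rw [hs] at h1 ⊢
  refine Nat.lt_succ_of_le (Nat.size_le.2 ?_)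
  rw [pow_succ] at h1
  omega

/-- Between `vS` and `vE` both parts are read off from fixed lines, so each comparison takes
constant time; the binary length of the gap bounds the number of comparisons. -/
theorem search_spec (hd : d.Valid) (hr : r.Valid d.n) (hi : i < d.k) (hdσ : d.Stored σ)
    (hrσ : r.Stored σ) (hw : Walked d r i σ) (hW : 2 * d.n ≤ W) :
    Runs W search σ (100 * (Nat.log 2 d.n + 3)) (fun σ' => CrossesAt d r i (σ'.ivar vLo)) := by
  have hlen := hr.length
  have h1 := hw.le
  have h2 := hw.le_T
  unfold search
  simp
  refine ⟨by omega, by omega, by omega, by omega, ?_⟩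
  have hd₀ := (hdσ.setIVar vLo (σ.ivar vS) (by omega)).setIVar vUp (σ.ivar vE) (by omega)
  have hr₀ := (hrσ.setIVar vLo (σ.ivar vS) (by omega)).setIVar vUp (σ.ivar vE) (by omega)
  refine (Runs.loop_measure (I := fun σ' => σ.ivar vS ≤ σ'.ivar vLo ∧ σ'.ivar vLo ≤ σ'.ivar vUp ∧
      σ'.ivar vUp ≤ σ.ivar vE ∧
      (∀ t < σ'.ivar vLo, t < r.T → ¬ d.fall i (r.pa t) ≤ d.rise i (r.pb t)) ∧
      (∀ t, σ'.ivar vUp ≤ t → t < r.T → d.fall i (r.pa t) ≤ d.rise i (r.pb t)))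
    (fun σ' => Nat.size (σ'.ivar vUp - σ'.ivar vLo)) 80 ?_ ?_).mono ?_ ?_
  · simpa using ⟨h1, fun t ht hT => not_le.1 (hw.before t ht hT), hw.after⟩
  · rintro σ' hF ⟨h3, h4, h5, h6, h7⟩ hb
    have hd' := hd₀.frame hF rfl
    have hr' := hr₀.frame hF rfl
    have eA : σ'.ivar vQA = σ.ivar vQA := (hF.ivar vQA rfl).trans (by simp)
    have eB : σ'.ivar vQB = σ.ivar vQB := (hF.ivar vQB rfl).trans (by simp)
    simp at hb
    obtain ⟨c, hc⟩ : ∃ c, c = (σ'.ivar vLo + σ'.ivar vUp) / 2 := ⟨_, rfl⟩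
    have hf := hw.fall_eq c (by omega) (by omega)
    have hri := hw.rise_eq c (by omega) (by omega)
    simp [crossed, hd'.xs, hd'.ua, hd'.ub, hd'.da, hd'.db, hr'.pa, hr'.pb, eA, eB, ← hc]
    rw [← hf, ← hri]
    refine ⟨by omega, fun hle => ⟨by omega, ⟨h3, by omega, by omega,
        fun t ht hT => not_le.1 (h6 t ht hT), fun t ht hT => ?_⟩, ?_⟩,
      fun hlt => ⟨by omega, ⟨by omega, by omega, h5, fun t ht hT => ?_, h7⟩, ?_⟩⟩
    · exact crossing_persists hd hr hi ht hT hle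
    · exact size_lt_of_le_half (by omega) (by omega)
    · by_contra hle
      exact not_le.2 hlt (crossing_persists hd hr hi (t' := c) (by omega) (by omega) (not_lt.1 hle))
    · exact size_lt_of_le_half (by omega) (by omega)
  · have hsz : Nat.size (σ.ivar vE - σ.ivar vS) ≤ Nat.log 2 d.n + 2 := by
      refine Nat.size_le.2 ?_
      have := Nat.lt_pow_succ_log_self (b := 2) (by omega) d.n
      rw [pow_succ] at this
      rw [pow_succ, pow_succ]
      omega
    simp
    omega
  · rintro σ' hF ⟨⟨h1, h3, h4, h5, h6⟩, hb⟩
    simp at hb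
    refine ⟨by omega, fun t ht => ⟨fun h => h6 t (by omega) ht, fun h => ?_⟩⟩
    by_contra hlt
    exact h5 t (by omega) ht h

/-- The sum of the entries up to `t`. -/
noncomputable def prefixSum (c : ℕ → ℝ) (t : ℕ) : ℝ := ∑ s ∈ Finset.range (t + 1), c s

/-- Adding `a` to one entry changes all prefix sums from this entry on. -/
theorem prefixSum_update (c : ℕ → ℝ) (l t : ℕ) (a : ℝ) :
    prefixSum (Function.update c l (c l + a)) t = prefixSum c t + if l ≤ t then a else 0 := by
  have h : Function.update c l (c l + a) = fun s => c s + if s = l then a else 0 := by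
    funext s
    by_cases hs : s = l
    · subst hs; simp
    · simp [hs]
  unfold prefixSum
  rw [h, Finset.sum_add_distrib, Finset.sum_ite_eq']
  simp

/-- The cost at time `t` that is encoded by the arrays of differences, when the row is at `x` and the
column at `y`. -/
noncomputable def encoded (σ : State) (t : ℕ) (x y : ℝ) : ℝ :=
  prefixSum (σ.rarr rCC) t + prefixSum (σ.rarr rCA) t * x + prefixSum (σ.rarr rCB) t * y

/-- From time `e` on, add `s` times the line with coefficients `A` and `B` at index `vI`; the
argument of the line is the row or the column, according to `C`. -/
def addLine (C A B : ℕ) (s : ℚ) (e : IExp) : Program :=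
  .rput rCC e (.add (.arr rCC e) (.mul (.const s) (.arr A (.var vI)))) ;;
  .rput C e (.add (.arr C e) (.mul (.const s) (.arr B (.var vI))))

/-- Add a line from time `e` to time `e'`. -/
def addRange (C A B : ℕ) (e e' : IExp) : Program :=
  addLine C A B 1 e ;; addLine C A B (-1) e'

/-- Add the costs of piece `vL` of function `vF`: the rising part at the row and the falling part at
the column, while these are in the piece, and for the minimum the falling part at the row from the
time of crossing `vLo` on and the rising part at the column before it. -/
def addPiece : Program :=
  .iset vI (.add (.var vQ) (.var vL)) ;;
  .iset vJ (.arr aTA (.arr aSt (.var vI))) ;;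
  .iset vJE (.arr aTA (.arr aSt (.add (.var vI) (.const 1)))) ;;
  .iset vNx (.arr aTB (.arr aSt (.var vI))) ;;
  .iset vIE (.arr aTB (.arr aSt (.add (.var vI) (.const 1)))) ;;
  addRange rCA rUA rUB (.var vJ) (.var vJE) ;;
  addRange rCB rDA rDB (.var vNx) (.var vIE) ;;
  addRange rCA rDA rDB (.max (.var vJ) (.var vLo)) (.max (.var vJE) (.var vLo)) ;;
  addRange rCB rUA rUB (.min (.var vNx) (.var vLo)) (.min (.var vIE) (.var vLo))

/-- Add the costs of function `vF` along the path to the arrays of differences. -/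
def addFunction : Program :=
  .iset vO (.arr aOff (.var vF)) ;;
  .iset vQ (.add (.add (.var vO) (.var vF)) (.var vF)) ;;
  .iset vM (.add (.sub (.arr aOff (.add (.var vF) (.const 1))) (.var vO)) (.const 1)) ;;
  walk ;; search ;;
  .forUp vL (.var vM) addPiece

theorem addLine_row_spec {A B : ℕ} {s : ℚ} {e : IExp} {l T : ℕ} (hB : B < rCC)
    (he : ∀ σ' : State, σ'.ivar = σ.ivar → e.eval σ' = l) (hT : 4 * e.cost + 20 ≤ T) :
    Runs W (addLine rCA A B s e) σ T (fun σ' => ∀ t x y, encoded σ' t x y = encoded σ t x y +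
      if l ≤ t then s * (σ.rarr A (σ.ivar vI) + σ.rarr B (σ.ivar vI) * x) else 0) := by
  have e1 := he σ rfl
  have e2 := he (σ.setRArr rCC l (σ.rarr rCC l + s * σ.rarr A (σ.ivar vI))) rfl
  simp [addLine, e1, e2, show B ≠ 9 by omega]
  refine ⟨by omega, by omega, fun t x y => ?_⟩
  simp [encoded, prefixSum_update]
  split_ifs <;> ring

theorem addLine_col_spec {A B : ℕ} {s : ℚ} {e : IExp} {l T : ℕ} (hB : B < rCC)
    (he : ∀ σ' : State, σ'.ivar = σ.ivar → e.eval σ' = l) (hT : 4 * e.cost + 20 ≤ T) :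
    Runs W (addLine rCB A B s e) σ T (fun σ' => ∀ t x y, encoded σ' t x y = encoded σ t x y +
      if l ≤ t then s * (σ.rarr A (σ.ivar vI) + σ.rarr B (σ.ivar vI) * y) else 0) := by
  have e1 := he σ rfl
  have e2 := he (σ.setRArr rCC l (σ.rarr rCC l + s * σ.rarr A (σ.ivar vI))) rfl
  simp [addLine, e1, e2, show B ≠ 9 by omega]
  refine ⟨by omega, by omega, fun t x y => ?_⟩
  simp [encoded, prefixSum_update]
  split_ifs <;> ring

theorem beq_false {a b : ℕ} (h : a ≠ b) : Nat.beq a b = false :=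
  Bool.eq_false_iff.2 fun h' => h (Nat.eq_of_beq_eq_true h')

theorem addRange_row_spec {A B : ℕ} {e e' : IExp} {l l' : ℕ} (hA : A < rCC) (hB : B < rCC)
    (he : ∀ σ' : State, σ'.ivar = σ.ivar → e.eval σ' = l)
    (he' : ∀ σ' : State, σ'.ivar = σ.ivar → e'.eval σ' = l') (hl : l ≤ l')
    (hc : e.cost ≤ 5) (hc' : e'.cost ≤ 5) :
    Runs W (addRange rCA A B e e') σ 80 (fun σ' => ∀ t x y, encoded σ' t x y = encoded σ t x y +
      if l ≤ t ∧ t < l' then σ.rarr A (σ.ivar vI) + σ.rarr B (σ.ivar vI) * x else 0) := by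
  refine Runs.seq (T := 40) (T' := 40) (addLine_row_spec hB he (by omega)) fun σ₁ hF₁ h₁ =>
    (addLine_row_spec (T := 40) (l := l') hB
      (fun σ' hσ' => he' σ' (by rw [hσ']; funext v; exact hF₁.ivar v rfl)) (by omega)).mono
      le_rfl fun σ₂ hF₂ h₂ t x y => ?_
  have eA : σ₁.rarr A = σ.rarr A := hF₁.rarr A (by
    simp [addLine, Program.putsR, beq_false (show A ≠ 9 by omega),
      beq_false (show A ≠ 10 by omega)])
  have eB : σ₁.rarr B = σ.rarr B := hF₁.rarr B (by
    simp [addLine, Program.putsR, beq_false (show B ≠ 9 by omega),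
      beq_false (show B ≠ 10 by omega)])
  rw [h₂, h₁, eA, eB, hF₁.ivar vI rfl]
  push_cast
  split_ifs <;> first | omega | ring

theorem addRange_col_spec {A B : ℕ} {e e' : IExp} {l l' : ℕ} (hA : A < rCC) (hB : B < rCC)
    (he : ∀ σ' : State, σ'.ivar = σ.ivar → e.eval σ' = l)
    (he' : ∀ σ' : State, σ'.ivar = σ.ivar → e'.eval σ' = l') (hl : l ≤ l')
    (hc : e.cost ≤ 5) (hc' : e'.cost ≤ 5) :
    Runs W (addRange rCB A B e e') σ 80 (fun σ' => ∀ t x y, encoded σ' t x y = encoded σ t x y +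
      if l ≤ t ∧ t < l' then σ.rarr A (σ.ivar vI) + σ.rarr B (σ.ivar vI) * y else 0) := by
  refine Runs.seq (T := 40) (T' := 40) (addLine_col_spec hB he (by omega)) fun σ₁ hF₁ h₁ =>
    (addLine_col_spec (T := 40) (l := l') hB
      (fun σ' hσ' => he' σ' (by rw [hσ']; funext v; exact hF₁.ivar v rfl)) (by omega)).mono
      le_rfl fun σ₂ hF₂ h₂ t x y => ?_
  have eA : σ₁.rarr A = σ.rarr A := hF₁.rarr A (by
    simp [addLine, Program.putsR, beq_false (show A ≠ 9 by omega),
      beq_false (show A ≠ 11 by omega)])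
  have eB : σ₁.rarr B = σ.rarr B := hF₁.rarr B (by
    simp [addLine, Program.putsR, beq_false (show B ≠ 9 by omega),
      beq_false (show B ≠ 11 by omega)])
  rw [h₂, h₁, eA, eB, hF₁.ivar vI rfl]
  push_cast
  split_ifs <;> first | omega | ring

theorem addPiece_spec {q sa ea sb eb c : ℕ} (hdσ : d.Stored σ) (hrσ : r.Stored σ)
    (hq : σ.ivar vQ + σ.ivar vL = q) (hc : σ.ivar vLo = c)
    (hsa : r.ta (d.st q) = sa) (hea : r.ta (d.st (q + 1)) = ea)
    (hsb : r.tb (d.st q) = sb) (heb : r.tb (d.st (q + 1)) = eb)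
    (ha : sa ≤ ea) (hb : sb ≤ eb) (hW : ea ≤ W) (hW' : eb ≤ W) (hW'' : q ≤ W) :
    Runs W addPiece σ 400 (fun σ' => ∀ t x y, encoded σ' t x y = encoded σ t x y +
      (if sa ≤ t ∧ t < ea then d.ua q + d.ub q * x else 0) +
      (if sb ≤ t ∧ t < eb then d.da q + d.db q * y else 0) +
      (if max sa c ≤ t ∧ t < max ea c then d.da q + d.db q * x else 0) +
      (if min sb c ≤ t ∧ t < min eb c then d.ua q + d.ub q * y else 0)) := by
  unfold addPiece
  simp only [runs_seq_iset, IExp.cost, IExp.eval, setIVar_ivar, setIVar_iarr, hdσ.st, hrσ.ta,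
    hrσ.tb, hq]
  simp [hsa, hea, hsb, heb]
  refine ⟨hW'', by omega, by omega, by omega, by omega, ?_⟩
  generalize hσ₀ : ((((σ.setIVar 4 q).setIVar 6 sa).setIVar 7 ea).setIVar 8 sb).setIVar 5 eb = σ₀
  have i1 : σ₀.ivar vI = q := by simp [← hσ₀]
  have i2 : σ₀.ivar vJ = sa := by simp [← hσ₀]
  have i3 : σ₀.ivar vJE = ea := by simp [← hσ₀]
  have i4 : σ₀.ivar vNx = sb := by simp [← hσ₀]
  have i5 : σ₀.ivar vIE = eb := by simp [← hσ₀]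
  have i6 : σ₀.ivar vLo = c := by simp [← hσ₀, hc]
  have hd₀ : d.Stored σ₀ := hσ₀ ▸ (((((hdσ.setIVar vI q (by omega)).setIVar vJ sa (by omega)).setIVar
    vJE ea (by omega)).setIVar vNx sb (by omega)).setIVar vIE eb (by omega))
  have hen : ∀ t x y, encoded σ₀ t x y = encoded σ t x y := fun t x y => by rw [← hσ₀]; rfl
  have hev : ∀ {P : Program} {σ₁ σ₂ : State}, Frame P σ₁ σ₂ → (∀ v, P.setsI v = false) →
      σ₂.ivar = σ₁.ivar := fun hF h => funext fun v => hF.ivar v (h v)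
  refine Runs.mono_time (Runs.seq (T' := 240) (addRange_row_spec (l := sa) (l' := ea) (by omega)
    (by omega) (fun σ' h => by simp [h, i2]) (fun σ' h => by simp [h, i3]) ha (by simp) (by simp))
    fun σ₁ hF₁ h₁ => ?_) (by omega)
  have j₁ : σ₁.ivar = σ₀.ivar := hev hF₁ fun _ => rfl
  have hd₁ := hd₀.frame hF₁ rfl
  refine Runs.seq (T := 80) (T' := 160) (addRange_col_spec (l := sb) (l' := eb) (by omega)
    (by omega) (fun σ' h => by simp [h, j₁, i4]) (fun σ' h => by simp [h, j₁, i5]) hb (by simp)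
    (by simp)) fun σ₂ hF₂ h₂ => ?_
  have j₂ : σ₂.ivar = σ₀.ivar := (hev hF₂ fun _ => rfl).trans j₁
  have hd₂ := hd₁.frame hF₂ rfl
  refine Runs.seq (T := 80) (T' := 80) (addRange_row_spec (l := max sa c) (l' := max ea c) (by omega)
    (by omega) (fun σ' h => by simp [h, j₂, i2, i6]) (fun σ' h => by simp [h, j₂, i3, i6]) (by omega)
    (by simp) (by simp)) fun σ₃ hF₃ h₃ => ?_
  have j₃ : σ₃.ivar = σ₀.ivar := (hev hF₃ fun _ => rfl).trans j₂
  have hd₃ := hd₂.frame hF₃ rfl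
  refine (addRange_col_spec (l := min sb c) (l' := min eb c) (by omega)
    (by omega) (fun σ' h => by simp [h, j₃, i4, i6]) (fun σ' h => by simp [h, j₃, i5, i6]) (by omega)
    (by simp) (by simp)).mono le_rfl fun σ₄ hF₄ h₄ t x y => ?_
  rw [h₄, h₃, h₂, h₁, hen, j₃, j₂, j₁, i1, hd₃.ua, hd₃.ub, hd₂.da, hd₂.db, hd₁.da, hd₁.db, hd₀.ua,
    hd₀.ub]
  simp only [max_le_iff, lt_max_iff, min_le_iff, lt_min_iff]

/-- Passing from the pieces before the candidate `p` to those before `p'`, for the row `x` at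
time `t`; the piece in between is visited during the times from `s` to `s'`. -/
theorem range_sum_row {p p' x t c s s' : ℕ} {U D u v : ℝ} (h : t < s ↔ x < p) (h' : t < s' ↔ x < p')
    (hp : p ≤ p') (hU : p ≤ x → x < p' → U = u) (hD : p ≤ x → x < p' → D = v) :
    (if x < p then U + (if c ≤ t then D else 0) else 0) + (if s ≤ t ∧ t < s' then u else 0) +
      (if max s c ≤ t ∧ t < max s' c then v else 0) =
    if x < p' then U + (if c ≤ t then D else 0) else 0 := by
  rcases Nat.lt_or_ge x p with h1 | h1
  · have := h.2 h1
    rw [if_pos h1, if_pos (show x < p' by omega), if_neg (show ¬ (s ≤ t ∧ t < s') by omega),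
      if_neg (show ¬ (max s c ≤ t ∧ t < max s' c) by omega)]; ring
  · have h2 : ¬ t < s := fun h3 => by have := h.1 h3; omega
    rw [if_neg (show ¬ x < p by omega)]
    rcases Nat.lt_or_ge x p' with h3 | h3
    · have := h'.2 h3
      rw [if_pos (show s ≤ t ∧ t < s' by omega), if_pos h3, hU h1 h3, hD h1 h3, zero_add]
      congr 1
      exact if_congr (by omega) rfl rfl
    · have h4 : ¬ t < s' := fun h5 => by have := h'.1 h5; omega
      rw [if_neg (show ¬ (s ≤ t ∧ t < s') by omega), if_neg (show ¬ x < p' by omega),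
        if_neg (show ¬ (max s c ≤ t ∧ t < max s' c) by omega)]; ring

/-- Passing from the pieces before the candidate `p` to those before `p'`, for the column `x` at
time `t`; the piece in between is visited during the times from `s` to `s'`. -/
theorem range_sum_col {p p' x t c s s' : ℕ} {U D u v : ℝ} (h : t < s ↔ x < p) (h' : t < s' ↔ x < p')
    (hp : p ≤ p') (hU : p ≤ x → x < p' → U = u) (hD : p ≤ x → x < p' → D = v) :
    (if x < p then U + (if t < c then D else 0) else 0) + (if s ≤ t ∧ t < s' then u else 0) +
      (if min s c ≤ t ∧ t < min s' c then v else 0) =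
    if x < p' then U + (if t < c then D else 0) else 0 := by
  rcases Nat.lt_or_ge x p with h1 | h1
  · have := h.2 h1
    rw [if_pos h1, if_pos (show x < p' by omega), if_neg (show ¬ (s ≤ t ∧ t < s') by omega),
      if_neg (show ¬ (min s c ≤ t ∧ t < min s' c) by omega)]; ring
  · have h2 : ¬ t < s := fun h3 => by have := h.1 h3; omega
    rw [if_neg (show ¬ x < p by omega)]
    rcases Nat.lt_or_ge x p' with h3 | h3
    · have := h'.2 h3
      rw [if_pos (show s ≤ t ∧ t < s' by omega), if_pos h3, hU h1 h3, hD h1 h3, zero_add]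
      congr 1
      exact if_congr (by omega) rfl rfl
    · have h4 : ¬ t < s' := fun h5 => by have := h'.1 h5; omega
      rw [if_neg (show ¬ (s ≤ t ∧ t < s') by omega), if_neg (show ¬ x < p' by omega),
        if_neg (show ¬ (min s c ≤ t ∧ t < min s' c) by omega)]; ring

/-- Since the pieces of the function partition the path, the contributions of all pieces add up to
the cost of the function at each time. -/
theorem addFunction_spec (hd : d.Valid) (hr : r.Valid d.n) (hi : i < d.k) (hdσ : d.Stored σ)
    (hrσ : r.Stored σ) (hF : σ.ivar vF = i) (hW : 4 * d.n + 2 * d.k + 2 ≤ W) :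
    Runs W addFunction σ (1000 * (d.cnt i + 1) + 100 * (Nat.log 2 d.n + 3)) (fun σ' => ∀ t < r.T,
      encoded σ' t (d.xs (r.pa t)) (d.xs (r.pb t)) = encoded σ t (d.xs (r.pa t)) (d.xs (r.pb t)) +
        (d.rise i (r.pa t) + d.fall i (r.pb t) + min (d.fall i (r.pa t)) (d.rise i (r.pb t)))) := by
  have hlen := hr.length
  have hoff : d.base i + d.cnt i ≤ d.n + 2 * d.k := by
    have h1 : d.off i ≤ d.off (i + 1) := hd.off_mono (Nat.le_succ i)
    have h2 : d.off (i + 1) ≤ d.off d.k := hd.off_mono hi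
    rw [hd.off_last] at h2
    unfold Table.base Table.cnt
    omega
  have hcnt : d.off (i + 1) - d.off i = d.cnt i := rfl
  have hbase : d.off i + i + i = d.base i := rfl
  have hoi : d.off i ≤ d.base i := by unfold Table.base; omega
  unfold addFunction
  simp [hF, hdσ.off i hi.le, hdσ.off (i + 1) hi, hcnt, hbase]
  refine ⟨by omega, by omega, by omega, by omega, by omega, by omega, ?_⟩
  have hd₀ := ((hdσ.setIVar vO (d.off i) (by omega)).setIVar vQ (d.base i) (by omega)).setIVar
    vM (d.cnt i + 1) (by omega)
  have hr₀ := ((hrσ.setIVar vO (d.off i) (by omega)).setIVar vQ (d.base i) (by omega)).setIVar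
    vM (d.cnt i + 1) (by omega)
  refine Runs.mono_time (Runs.seq (T' := 100 * (Nat.log 2 d.n + 3) + (500 * (d.cnt i + 1) + 10))
    (walk_spec hd hr hi hd₀ hr₀ (by simp) (by omega)) fun σ₁ hF₁ h₁ => ?_) (by omega)
  have hd₁ := hd₀.frame hF₁ rfl
  have hr₁ := hr₀.frame hF₁ rfl
  refine Runs.seq (search_spec hd hr hi hd₁ hr₁ h₁ (by omega)) fun σ₂ hF₂ h₂ => ?_
  have hd₂ := hd₁.frame hF₂ rfl
  have hr₂ := hr₁.frame hF₂ rfl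
  obtain ⟨hcT, hcr⟩ := h₂
  generalize hc : σ₂.ivar vLo = c at hcT hcr
  refine (Runs.forVar (I := fun j σ' => ∀ t < r.T,
      encoded σ' t (d.xs (r.pa t)) (d.xs (r.pb t)) = encoded σ t (d.xs (r.pa t)) (d.xs (r.pb t)) +
        ((if r.pa t < d.st (d.base i + j) then
          d.rise i (r.pa t) + (if c ≤ t then d.fall i (r.pa t) else 0) else 0) +
        (if r.pb t < d.st (d.base i + j) then
          d.fall i (r.pb t) + (if t < c then d.rise i (r.pb t) else 0) else 0)))
    (d.cnt i + 1) 400 ?_ (by omega) rfl rfl ?_ ?_).mono (by omega) ?_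
  · rw [hF₂.ivar vM rfl, hF₁.ivar vM rfl]; simp
  · intro t ht
    have e : encoded (σ₂.setIVar vL 0) t (d.xs (r.pa t)) (d.xs (r.pb t)) =
        encoded σ t (d.xs (r.pa t)) (d.xs (r.pb t)) := by
      simp only [encoded, setIVar_rarr, hF₂.rarr rCC rfl, hF₂.rarr rCA rfl, hF₂.rarr rCB rfl,
        hF₁.rarr rCC rfl, hF₁.rarr rCA rfl, hF₁.rarr rCB rfl]
    rw [e]
    simp [hd.st_zero i hi]
  · intro j σ' hF' hj hvj hI
    have hd' := hd₂.frame hF' rfl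
    have hr' := hr₂.frame hF' rfl
    have hQ : σ'.ivar vQ = d.base i := by
      rw [hF'.ivar vQ rfl, hF₂.ivar vQ rfl, hF₁.ivar vQ rfl]; simp
    have hst := hd.st_mono i hi j (by omega)
    have hstn : d.st (d.base i + j + 1) ≤ d.n := hd.st_le hi (j := j + 1) (by omega)
    have hta := hr.ta_first.mono hst hstn
    have htb := hr.tb_first.mono hst hstn
    have htaT := hr.ta_first.le _ hstn
    have htbT := hr.tb_first.le _ hstn
    refine (addPiece_spec (W := W) hd' hr' (by rw [hQ, hvj]) ((hF'.ivar vLo rfl).trans hc) rfl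
      rfl rfl rfl hta htb (by omega) (by omega) (by omega)).mono le_rfl fun σ'' hF'' h'' t ht => ?_
    have hen : ∀ x y, encoded (σ''.setIVar vL (j + 1)) t x y = encoded σ'' t x y := fun x y => rfl
    rw [hen, h'', hI t ht, ← add_assoc (d.base i)]
    have a1 := hr.ta_first.lt_iff _ (hst.trans hstn) t ht
    have a2 := hr.ta_first.lt_iff _ hstn t ht
    have b1 := hr.tb_first.lt_iff _ (hst.trans hstn) t ht
    have b2 := hr.tb_first.lt_iff _ hstn t ht
    have eq1 := hd.rise_eq i hi j (by omega) (r.pa t)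
    have eq2 := hd.fall_eq i hi j (by omega) (r.pa t)
    have eq3 := hd.rise_eq i hi j (by omega) (r.pb t)
    have eq4 := hd.fall_eq i hi j (by omega) (r.pb t)
    have r1 := range_sum_row (c := c) a1 a2 hst eq1 eq2
    have r2 := range_sum_col (c := c) b1 b2 hst eq4 eq3
    linarith
  · intro σ₃ hF₃ h₃ t ht
    rw [h₃ t ht, ← add_assoc (d.base i), hd.st_last i hi, if_pos (hr.pa_lt t ht),
      if_pos (hr.pb_lt t ht)]
    have := hcr t ht
    rcases le_total (d.fall i (r.pa t)) (d.rise i (r.pb t)) with h | h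
    · rw [if_pos (this.2 h), if_neg (by have := this.2 h; omega), min_eq_left h]; ring
    · rcases h.eq_or_lt with h' | h'
      · rw [if_pos (this.2 h'.ge), if_neg (by have := this.2 h'.ge; omega), min_eq_left h'.ge]; ring
      · have hn : ¬ c ≤ t := fun hct => absurd (this.1 hct) (not_le.2 h')
        rw [if_neg hn, if_pos (not_le.1 hn), min_eq_right h]; ring

end
/-! ### The search for optimal columns -/

/-- Evaluate the cost at time `vP`, and record the column if it is the best one of its row so far. -/
def evalStep : Program :=
  .rset xC (.add (.var xC) (.arr rCC (.var vP))) ;;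
  .rset xCA (.add (.var xCA) (.arr rCA (.var vP))) ;;
  .rset xCB (.add (.var xCB) (.arr rCB (.var vP))) ;;
  .rset xVal (.add (.add (.var xC) (.mul (.var xCA) (.arr rXS (.arr aPA (.var vP)))))
    (.mul (.var xCB) (.arr rXS (.arr aPB (.var vP))))) ;;
  .branch (.and (.ile (.add (.arr aPA (.var vP)) (.const 1)) (.var vRow))
      (.rle (.arr rOV (.var vRow)) (.var xVal)))
    .skip
    (.iset vRow (.add (.arr aPA (.var vP)) (.const 1)) ;;
     .iput aOpt (.var vRow) (.arr aPB (.var vP)) ;;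
     .rput rOV (.var vRow) (.var xVal))

/-- Compute the costs along the path, as prefix sums, and record the best column of each row. Here
`vRow` is the row that was recorded last, counted from 1; the path visits the rows in order. -/
def evaluate : Program :=
  .iset vRow (.const 0) ;;
  .rset xC (.const 0) ;;
  .rset xCA (.const 0) ;;
  .rset xCB (.const 0) ;;
  .forUp vP (.var vT) evalStep

/-- Process the rows that are odd multiples of `vH`. -/
def level : Program :=
  buildPath ;;
  firstTimes aPA aTA ;;
  firstTimes aPB aTB ;;
  clearSums ;;
  .forUp vF (.var vK) addFunction ;;
  evaluate

/-- Process the levels in decreasing order, starting with the largest power of two that is at most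
`vN`. -/
def allLevels : Program :=
  .iset vH (.const 1) ;;
  .loop (.ile (.add (.var vH) (.var vH)) (.var vN)) (.iset vH (.add (.var vH) (.var vH))) ;;
  .iput aOpt (.const 0) (.const 0) ;;
  .loop (.ile (.const 1) (.var vH)) (level ;; .iset vH (.half (.var vH)))

/-- Choose the best row and output its candidate and that of its column. -/
def output : Program :=
  .iset vRow (.const 1) ;;
  .forUp vP (.var vN)
    (.branch (.rle (.arr rOV (.var vRow)) (.arr rOV (.add (.var vP) (.const 1))))
      .skip (.iset vRow (.add (.var vP) (.const 1)))) ;;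
  .rset 0 (.arr rXS (.sub (.var vRow) (.const 1))) ;;
  .rset 1 (.arr rXS (.arr aOpt (.var vRow)))

/-- The best positions of each row of the path up to time `T` have been recorded; the entries of the
other rows are those of `opt` and `ov`. -/
structure Recorded (d : Table) (r : Path) (T : ℕ) (opt opt' : ℕ → ℕ) (ov ov' : ℕ → ℝ) : Prop where
  best : ∀ t < T, ∃ s < T, r.pa s = r.pa t ∧ opt' (r.pa t + 1) = r.pb s ∧
    ov' (r.pa t + 1) = d.cost (r.pa t) (r.pb s) ∧
    ∀ t' < T, r.pa t' = r.pa t → d.cost (r.pa t) (r.pb s) ≤ d.cost (r.pa t) (r.pb t')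
  other : ∀ q, (∀ t < T, r.pa t + 1 ≠ q) → opt' q = opt q ∧ ov' q = ov q

/-- For the rows that are multiples of `g`, optimal columns have been found, and they increase. -/
structure Solved (d : Table) (g : ℕ) (opt : ℕ → ℕ) (ov : ℕ → ℝ) : Prop where
  zero : opt 0 = 0
  lt : ∀ m, g * m ≤ d.n → opt (g * m) < d.n
  le : ∀ m, g * (m + 1) ≤ d.n → opt (g * m) ≤ opt (g * (m + 1))
  best : ∀ m, 0 < g * m → g * m ≤ d.n →
    ∀ b < d.n, d.cost (g * m - 1) (opt (g * m)) ≤ d.cost (g * m - 1) b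
  value : ∀ m, 0 < g * m → g * m ≤ d.n → ov (g * m) = d.cost (g * m - 1) (opt (g * m))

section
variable {W : ℕ} {σ : State} {d : Table} {r : Path}

/-- The recorded column remains best if the cost at time `t` is no smaller. -/
theorem Recorded.keep {t : ℕ} {opt opt' : ℕ → ℕ} {ov ov' : ℕ → ℝ}
    (h : Recorded d r t opt opt' ov ov') (ht : 0 < t) (heq : r.pa (t - 1) = r.pa t)
    (hle : ov' (r.pa t + 1) ≤ d.cost (r.pa t) (r.pb t)) :
    Recorded d r (t + 1) opt opt' ov ov' := by
  have key : ∀ u < t, ∃ s < t + 1, r.pa s = r.pa u ∧ opt' (r.pa u + 1) = r.pb s ∧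
      ov' (r.pa u + 1) = d.cost (r.pa u) (r.pb s) ∧
      ∀ t' < t + 1, r.pa t' = r.pa u → d.cost (r.pa u) (r.pb s) ≤ d.cost (r.pa u) (r.pb t') := by
    intro u hu
    obtain ⟨s, hs, e1, e2, e3, e4⟩ := h.best u hu
    refine ⟨s, by omega, e1, e2, e3, fun t' ht' e5 => ?_⟩
    rcases Nat.lt_or_ge t' t with h' | h'
    · exact e4 t' h' e5
    · obtain rfl : t' = t := by omega
      rw [← e3, ← e5]; exact hle
  refine ⟨fun u hu => ?_, fun q hq => h.other q fun u hu => hq u (by omega)⟩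
  rcases Nat.lt_or_ge u t with h' | h'
  · exact key u h'
  · obtain rfl : u = t := by omega
    have := key (u - 1) (by omega)
    rwa [heq] at this

/-- The column at time `t` is the best one so far if the row is new or the cost is no larger. -/
theorem Recorded.update {t : ℕ} {opt opt' : ℕ → ℕ} {ov ov' : ℕ → ℝ}
    (h : Recorded d r t opt opt' ov ov')
    (hle : (∀ u < t, r.pa u ≠ r.pa t) ∨ d.cost (r.pa t) (r.pb t) ≤ ov' (r.pa t + 1)) :
    Recorded d r (t + 1) opt (Function.update opt' (r.pa t + 1) (r.pb t)) ov
      (Function.update ov' (r.pa t + 1) (d.cost (r.pa t) (r.pb t))) := by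
  refine ⟨fun u hu => ?_, fun q hq => ?_⟩
  · by_cases hut : r.pa u = r.pa t
    · rw [hut, Function.update_self, Function.update_self]
      refine ⟨t, by omega, rfl, rfl, rfl, fun t' ht' e => ?_⟩
      rcases Nat.lt_or_ge t' t with h' | h'
      · rcases hle with hle | hle
        · exact absurd e (hle t' h')
        · obtain ⟨s, hs, e1, e2, e3, e4⟩ := h.best t' h'
          rw [e] at e3 e4
          exact hle.trans (e3.le.trans (e4 t' h' e))
      · rw [show t' = t by omega]
    · have hu' : u < t := by
        rcases Nat.lt_or_ge u t with h' | h'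
        · exact h'
        · exact absurd (by rw [show u = t by omega]) hut
      obtain ⟨s, hs, e1, e2, e3, e4⟩ := h.best u hu'
      rw [Function.update_of_ne (by omega), Function.update_of_ne (by omega)]
      refine ⟨s, by omega, e1, e2, e3, fun t' ht' e => ?_⟩
      rcases Nat.lt_or_ge t' t with h' | h'
      · exact e4 t' h' e
      · exact absurd (by rw [← e, show t' = t by omega]) hut
  · have := hq t (by omega)
    rw [Function.update_of_ne (Ne.symm this), Function.update_of_ne (Ne.symm this)]
    exact h.other q fun u hu => hq u (by omega)

theorem evaluate_spec (hr : r.Valid d.n) (hdσ : d.Stored σ) (hrσ : r.Stored σ)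
    (hval : ∀ t < r.T, encoded σ t (d.xs (r.pa t)) (d.xs (r.pb t)) = d.cost (r.pa t) (r.pb t))
    (hW : 2 * d.n ≤ W) :
    Runs W evaluate σ (250 * (d.n + 1)) (fun σ' =>
      Recorded d r r.T (σ.iarr aOpt) (σ'.iarr aOpt) (σ.rarr rOV) (σ'.rarr rOV)) := by
  have hlen := hr.length
  unfold evaluate
  simp
  refine ⟨by omega, by omega, by omega, by omega, ?_⟩
  refine (Runs.forVar (I := fun t σ' =>
      Recorded d r t (σ.iarr aOpt) (σ'.iarr aOpt) (σ.rarr rOV) (σ'.rarr rOV) ∧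
      (0 < t → σ'.ivar vRow = r.pa (t - 1) + 1) ∧ (t = 0 → σ'.ivar vRow = 0) ∧
      σ'.rvar xC = ∑ s ∈ Finset.range t, σ.rarr rCC s ∧
      σ'.rvar xCA = ∑ s ∈ Finset.range t, σ.rarr rCA s ∧
      σ'.rvar xCB = ∑ s ∈ Finset.range t, σ.rarr rCB s) r.T 100 ?_ (by omega) rfl rfl
      ?_ ?_).mono ?_ fun σ' _ h => h.1
  · simp [hrσ.T]
  · refine ⟨⟨by omega, fun q _ => ⟨rfl, rfl⟩⟩, ?_, ?_, ?_, ?_, ?_⟩ <;> simp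
  rotate_left
  · omega
  rintro t σ' hF ht hvt ⟨hR, hrow, hrow0, c1, c2, c3⟩
  have f1 : σ'.iarr aPA = r.pa := (hF.iarr aPA rfl).trans hrσ.pa
  have f2 : σ'.iarr aPB = r.pb := (hF.iarr aPB rfl).trans hrσ.pb
  have f3 : σ'.rarr rXS = d.xs := (hF.rarr rXS rfl).trans hdσ.xs
  have f4 : σ'.rarr rCC = σ.rarr rCC := (hF.rarr rCC rfl).trans rfl
  have f5 : σ'.rarr rCA = σ.rarr rCA := (hF.rarr rCA rfl).trans rfl
  have f6 : σ'.rarr rCB = σ.rarr rCB := (hF.rarr rCB rfl).trans rfl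
  have hv := hval t ht
  unfold encoded prefixSum at hv
  have hpa := hr.pa_lt t ht
  have hpb := hr.pb_lt t ht
  have hmono : 0 < t → r.pa (t - 1) ≤ r.pa t := fun h0 => hr.pa_mono _ _ (by omega) ht
  simp [evalStep, f1, f2, f3, f4, f5, f6, hvt, c1, c2, c3, ← Finset.sum_range_succ, hv]
  refine ⟨fun h1 h2 => ⟨?_, by omega⟩, fun h1 => ⟨by omega, by omega, ?_⟩⟩
  · have h0 : 0 < t := by
      by_contra h0
      have := hrow0 (by omega)
      omega
    have := hrow h0
    have := hmono h0
    have heq : r.pa (t - 1) = r.pa t := by omega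
    rw [hrow h0, heq] at h2
    exact hR.keep h0 heq h2
  · refine hR.update ?_
    rcases Nat.lt_or_ge (r.pa t) (σ'.ivar vRow) with h2 | h2
    · right
      have h0 : 0 < t := by
        by_contra h0
        have := hrow0 (by omega)
        omega
      have := hrow h0
      have := hmono h0
      have heq : r.pa (t - 1) = r.pa t := by omega
      have h3 := h1 (by omega)
      rw [hrow h0, heq] at h3
      exact h3.le
    · left
      intro u hu heq
      have h0 : 0 < t := by omega
      have := hrow h0
      have := hr.pa_mono u (t - 1) (by omega) (by omega)
      have := hmono h0
      omega

theorem Solved.optMono {g : ℕ} {opt : ℕ → ℕ} {ov : ℕ → ℝ} (h : Solved d (2 * g) opt ov) :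
    OptMono opt d.n g := ⟨h.zero, h.lt, h.le⟩

/-- The optimal columns of the odd multiples of `h` lie between those of the neighbouring even
multiples, because the cost is a Monge array. -/
theorem Solved.refine {h : ℕ} {opt opt' : ℕ → ℕ} {ov ov' : ℕ → ℝ} (hd : d.Valid) (hh : 0 < h)
    (hs : Solved d (2 * h) opt ov) (hp : IsPath opt d.n h r.T r.pa r.pb)
    (hR : Recorded d r r.T opt opt' ov ov') : Solved d h opt' ov' := by
  have hev : ∀ m, opt' (2 * h * m) = opt (2 * h * m) ∧ ov' (2 * h * m) = ov (2 * h * m) := by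
    refine fun m => hR.other _ fun t ht heq => ?_
    obtain ⟨m', h1, -⟩ := hp.row t ht
    have : h * (2 * m' + 1) = h * (2 * m) := by rw [← h1, heq]; ring
    have := Nat.eq_of_mul_eq_mul_left hh this
    omega
  have hodd : ∀ m, h * (2 * m + 1) ≤ d.n →
      colLo opt h m ≤ opt' (h * (2 * m + 1)) ∧ opt' (h * (2 * m + 1)) ≤ colHi opt d.n h m ∧
      ov' (h * (2 * m + 1)) = d.cost (h * (2 * m + 1) - 1) (opt' (h * (2 * m + 1))) ∧
      ∀ b, colLo opt h m ≤ b → b ≤ colHi opt d.n h m →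
        d.cost (h * (2 * m + 1) - 1) (opt' (h * (2 * m + 1))) ≤ d.cost (h * (2 * m + 1) - 1) b := by
    intro m hm
    obtain ⟨t, ht, e1, -⟩ := hp.cover m hm _ le_rfl (hs.optMono.colLo_le hm)
    obtain ⟨s, hs', a1, a2, a3, a4⟩ := hR.best t ht
    have e2 : r.pa t = h * (2 * m + 1) - 1 := by omega
    rw [e1, e2] at a3
    rw [e1] at a2
    rw [e2] at a4 a1
    obtain ⟨m', b1, -, b2, b3⟩ := hp.row s hs'
    have : h * (2 * m' + 1) = h * (2 * m + 1) := by omega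
    obtain rfl : m' = m := by have := Nat.eq_of_mul_eq_mul_left hh this; omega
    rw [a2]
    refine ⟨b2, b3, a3, fun b hb hb' => ?_⟩
    obtain ⟨t', ht', e3, rfl⟩ := hp.cover m' hm b hb hb'
    exact a4 t' ht' (by omega)
  have hsplit : ∀ q, (∃ m, h * q = 2 * h * m ∧ h * (q + 1) = h * (2 * m + 1)) ∨
      ∃ m, h * q = h * (2 * m + 1) ∧ h * (q + 1) = 2 * h * (m + 1) := by
    intro q
    rcases Nat.even_or_odd' q with ⟨m, rfl | rfl⟩
    · exact Or.inl ⟨m, by ring, rfl⟩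
    · exact Or.inr ⟨m, rfl, by ring⟩
  have hlt : ∀ m, colHi opt d.n h m < d.n := fun m => hs.optMono.colHi_lt hd.n_pos
  refine ⟨?_, fun q hq => ?_, fun q hq => ?_, fun q h0 hq b hb => ?_, fun q h0 hq => ?_⟩
  · have := (hev 0).1
    simpa [hs.zero] using this
  · rcases hsplit q with ⟨m, e, -⟩ | ⟨m, e, -⟩
    · rw [e] at hq ⊢
      rw [(hev m).1]
      exact hs.lt m hq
    · rw [e] at hq ⊢
      exact (hodd m hq).2.1.trans_lt (hlt m)
  · rcases hsplit q with ⟨m, e, e'⟩ | ⟨m, e, e'⟩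
    · rw [e'] at hq
      rw [e, e', (hev m).1]
      exact (hodd m hq).1
    · rw [e'] at hq
      rw [e, e', (hev (m + 1)).1]
      have h1 : h * (2 * m + 1) ≤ d.n := le_trans (by nlinarith) hq
      have h2 := (hodd m h1).2.1
      unfold colHi at h2
      rwa [if_pos hq] at h2
  · rcases hsplit q with ⟨m, e, -⟩ | ⟨m, e, -⟩
    · rw [e] at hq h0 ⊢
      rw [(hev m).1]
      exact hs.best m h0 hq b hb
    · rw [e] at hq h0 ⊢
      obtain ⟨o1, o2, o3, o4⟩ := hodd m hq
      have hlh := hs.optMono.colLo_le hq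
      have e1 : h * (2 * m + 1) = 2 * h * m + h := by ring
      have e2 : 2 * h * (m + 1) = 2 * h * m + 2 * h := by ring
      rcases Nat.lt_or_ge b (colLo opt h m) with h1 | h1
      · have hpos : 0 < 2 * h * m := by
          by_contra h2
          have h3 : 2 * h * m = 0 := by omega
          unfold colLo at h1
          rw [h3, hs.zero] at h1
          omega
        refine (o4 _ le_rfl hlh).trans ?_
        exact pairCost_le_of_argmin_above hd.rise_mono hd.fall_anti (a := 2 * h * m - 1) (by omega)
          (by omega) (hs.lt m (by omega)) (hs.best m hpos (by omega)) h1.le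
      rcases Nat.lt_or_ge (colHi opt d.n h m) b with h2 | h2
      · refine (o4 _ hlh le_rfl).trans ?_
        unfold colHi at h2 ⊢
        split_ifs at h2 ⊢ with h3
        · exact pairCost_le_of_argmin_below hd.rise_mono hd.fall_anti (a := 2 * h * (m + 1) - 1)
            (by omega) (by omega) (hs.best (m + 1) (by omega) h3) h2.le hb
        · omega
      · exact o4 b h1 h2
  · rcases hsplit q with ⟨m, e, -⟩ | ⟨m, e, -⟩
    · rw [e] at hq h0 ⊢
      rw [(hev m).1, (hev m).2]
      exact hs.value m h0 hq
    · rw [e] at hq h0 ⊢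
      exact (hodd m hq).2.2.1

/-- The total number of pieces is `n + k`, so the `k` functions take `O(n + k log n)` steps
together. -/
theorem level_spec {h : ℕ} (hd : d.Valid) (hdσ : d.Stored σ) (hH : σ.ivar vH = h) (hh : 0 < h)
    (hhn : h ≤ d.n) (hs : Solved d (2 * h) (σ.iarr aOpt) (σ.rarr rOV))
    (hW : 4 * d.n + 2 * d.k + 2 ≤ W) :
    Runs W level σ (3000 * (d.n + d.k + 1) + 100 * (d.k * (Nat.log 2 d.n + 3))) (fun σ' =>
      Solved d h (σ'.iarr aOpt) (σ'.rarr rOV)) := by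
  have hn := hd.n_pos
  unfold level
  refine Runs.mono_time (Runs.seq (buildPath_spec hdσ.n hH hn hh hhn hs.optMono (by omega))
    (T' := 50 * (3 * d.n + 2) + (50 * (3 * d.n + 2) + (50 * (2 * d.n + 2) +
      ((1000 * d.n + 1009 * d.k + 100 * (d.k * (Nat.log 2 d.n + 3)) + 10) + 250 * (d.n + 1)))))
    fun σ₁ hF₁ hp => ?_) (by omega)
  have hd₁ := hdσ.frame hF₁ rfl
  have hlen := hp.length
  refine Runs.seq ((firstTimes_spec (W := W) (A := aPA) (B := aTA) (T := σ₁.ivar vT) rfl hd₁.n rfl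
    (fun t t' h1 h2 => (hp.mono t t' h1 h2).1) (by omega) (by omega)).mono_time (by omega))
    fun σ₂ hF₂ hta => ?_
  have hd₂ := hd₁.frame hF₂ rfl
  have e₂ : σ₂.ivar vT = σ₁.ivar vT := hF₂.ivar vT rfl
  refine Runs.seq ((firstTimes_spec (W := W) (A := aPB) (B := aTB) (T := σ₁.ivar vT) rfl hd₂.n e₂
    (fun t t' h1 h2 => by rw [hF₂.iarr aPB rfl]; exact (hp.mono t t' h1 h2).2)
    (by omega) (by omega)).mono_time (by omega)) fun σ₃ hF₃ htb => ?_
  have hd₃ := hd₂.frame hF₃ rfl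
  have e₃ : σ₃.ivar vT = σ₁.ivar vT := (hF₃.ivar vT rfl).trans e₂
  refine Runs.seq ((clearSums_spec (W := W) e₃ (by omega)).mono_time (by omega))
    fun σ₄ hF₄ hcl => ?_
  have hd₄ := hd₃.frame hF₄ rfl
  obtain ⟨r, hr_eq⟩ : ∃ r : Path, r = ⟨σ₁.ivar vT, σ₁.iarr aPA, σ₁.iarr aPB, σ₂.iarr aTA,
    σ₃.iarr aTB⟩ := ⟨_, rfl⟩
  have hp' : IsPath (σ.iarr aOpt) d.n h r.T r.pa r.pb := by rw [hr_eq]; exact hp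
  have hr₄ : r.Stored σ₄ := by
    rw [hr_eq]
    exact ⟨by rw [hF₄.ivar vT rfl, hF₃.ivar vT rfl, hF₂.ivar vT rfl],
      by rw [hF₄.iarr aPA rfl, hF₃.iarr aPA rfl, hF₂.iarr aPA rfl],
      by rw [hF₄.iarr aPB rfl, hF₃.iarr aPB rfl, hF₂.iarr aPB rfl],
      by rw [hF₄.iarr aTA rfl, hF₃.iarr aTA rfl], by rw [hF₄.iarr aTB rfl]⟩
  have hr : r.Valid d.n := by
    refine ⟨hp'.length, fun t ht => ?_, fun t ht => ?_, fun t t' h1 h2 => (hp'.mono t t' h1 h2).1,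
      fun t t' h1 h2 => (hp'.mono t t' h1 h2).2, ?_, ?_⟩
    · obtain ⟨m, h1, h2, -⟩ := hp'.row t ht
      omega
    · obtain ⟨m, -, -, -, h2⟩ := hp'.row t ht
      exact h2.trans_lt (hs.optMono.colHi_lt hn)
    · rw [hr_eq]; exact hta
    · rw [hr_eq]; rw [hF₂.iarr aPB rfl] at htb; exact htb
  refine Runs.seq ((Runs.forUp (I := fun a σ' => ∀ t < r.T,
      encoded σ' t (d.xs (r.pa t)) (d.xs (r.pb t)) = pairCost a d.rise d.fall (r.pa t) (r.pb t))
      (v := vF) (e := .var vK) d.k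
      (fun i => 1000 * (d.cnt i + 1) + 100 * (Nat.log 2 d.n + 3)) (by omega) rfl
    (fun σ' hF => (hF.ivar vK rfl).trans hd₄.k) ?_ ?_).mono ?_ fun _ _ h => h.1) fun σ₅ hF₅ h₅ => ?_
  · intro t ht
    have hz : ∀ s ∈ Finset.range (t + 1), σ₄.rarr rCC s = 0 ∧ σ₄.rarr rCA s = 0 ∧
        σ₄.rarr rCB s = 0 := fun s hs => hcl s (by
      have := Finset.mem_range.1 hs
      have : r.T = σ₁.ivar vT := by rw [hr_eq]
      omega)
    simp only [encoded, prefixSum, setIVar_rarr]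
    rw [Finset.sum_eq_zero fun s hs => (hz s hs).1, Finset.sum_eq_zero fun s hs => (hz s hs).2.1,
      Finset.sum_eq_zero fun s hs => (hz s hs).2.2]
    simp [pairCost]
  · intro i σ' hF hi hvi hI
    refine (addFunction_spec hd hr hi (hd₄.frame hF rfl) (hr₄.frame hF rfl) hvi hW).mono le_rfl
      fun σ'' _ h'' t ht => ?_
    have e : ∀ x y, encoded (σ''.setIVar vF (i + 1)) t x y = encoded σ'' t x y := fun x y => rfl
    rw [e, h'' t ht, hI t ht, pairCost, pairCost, Finset.sum_range_succ]
  · have := Finset.sum_range_tsub hd.off_mono d.k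
    rw [hd.off_last, hd.off_zero, Nat.sub_zero] at this
    have e : ∀ i, 1000 * (d.cnt i + 1) + 100 * (Nat.log 2 d.n + 3) + (IExp.var vK).cost + 8 =
        1000 * (d.off (i + 1) - d.off i) + (1009 + 100 * (Nat.log 2 d.n + 3)) := fun i => by
      simp only [Table.cnt, IExp.cost]
      omega
    rw [Finset.sum_congr rfl fun i _ => e i, Finset.sum_add_distrib, ← Finset.mul_sum, this,
      Finset.sum_const, Finset.card_range, smul_eq_mul]
    simp only [IExp.cost]
    exact le_of_eq (by ring)
  · have hd₅ := hd₄.frame hF₅ rfl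
    have hr₅ := hr₄.frame hF₅ rfl
    refine (evaluate_spec hr hd₅ hr₅ h₅ (by omega)).mono le_rfl fun σ₆ hF₆ h₆ => ?_
    rw [hF₅.iarr aOpt rfl, hF₄.iarr aOpt rfl, hF₃.iarr aOpt rfl, hF₂.iarr aOpt rfl,
      hF₁.iarr aOpt rfl, hF₅.rarr rOV rfl, hF₄.rarr rOV rfl, hF₃.rarr rOV rfl, hF₂.rarr rOV rfl,
      hF₁.rarr rOV rfl] at h₆
    exact hs.refine hd hh hp' h₆

theorem allLevels_spec (hd : d.Valid) (hdσ : d.Stored σ) (hW : 4 * d.n + 2 * d.k + 2 ≤ W) :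
    Runs W allLevels σ ((Nat.log 2 d.n + 1) *
      (3000 * (d.n + d.k + 1) + 100 * (d.k * (Nat.log 2 d.n + 3)) + 30) + 40) (fun σ' =>
      Solved d 1 (σ'.iarr aOpt) (σ'.rarr rOV)) := by
  have hn := hd.n_pos
  obtain ⟨L, hL⟩ : ∃ L, L = Nat.log 2 d.n := ⟨_, rfl⟩
  unfold allLevels
  rw [runs_seq_iset, ← hL]
  refine ⟨by simp, by simp; omega, ?_⟩
  obtain ⟨B, hB⟩ : ∃ B, B = 3000 * (d.n + d.k + 1) + 100 * (d.k * (L + 3)) := ⟨_, rfl⟩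
  rw [← hB]
  refine Runs.mono_time (T := (L * 18 + 18) + (4 + ((L + 1) * (B + 10) + 10))) (Runs.seq
    ((Runs.loop (I := fun a σ' => σ'.ivar vH = 2 ^ a ∧ 2 ^ a ≤ d.n) L (fun _ => 10) ?_ ?_).mono
      ?_ fun _ _ h => h) ?_) ?_
  · exact ⟨by simp, by simpa using Nat.succ_le_of_lt hn⟩
  · rintro a σ' hF ⟨h1, h2⟩ hb
    have hN : σ'.ivar vN = d.n := (hF.ivar vN rfl).trans hdσ.n
    simp [h1, hN] at hb
    have h3 : 2 ^ (a + 1) ≤ d.n := by rw [pow_succ]; omega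
    have h4 := Nat.le_log_of_pow_le (b := 2) (by omega) h3
    refine ⟨by omega, ?_⟩
    simp [h1]
    exact ⟨by omega, by rw [pow_succ]; omega, h3⟩
  · simp
    omega
  · rintro σ₁ hF₁ ⟨⟨a, ha, h1, h2⟩, hb⟩
    have hd₁ := (hdσ.setIVar vH 1 le_rfl).frame hF₁ rfl
    simp only [IExp.eval, Test.holds, h1, hd₁.n] at hb
    -- No positive multiple of `2 * 2 ^ a` is a row, so only the bound for row 0 is needed.
    have hs₀ : Solved d (2 * 2 ^ a) (Function.update (σ₁.iarr aOpt) 0 0) (σ₁.rarr rOV) := by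
      have hm : ∀ m, 2 * 2 ^ a * m ≤ d.n → m = 0 := by
        intro m hm
        by_contra h0
        have := Nat.le_mul_of_pos_right (2 * 2 ^ a) (Nat.pos_of_ne_zero h0)
        omega
      refine ⟨by simp, fun m h => ?_, fun m h => ?_, fun m h0 h => ?_, fun m h0 h => ?_⟩
      · rw [hm m h]; simpa using hn
      · exact absurd (hm _ h) (by omega)
      · rw [hm m h] at h0; simp at h0
      · rw [hm m h] at h0; simp at h0
    rw [runs_seq_iput]
    refine ⟨by simp; omega, by simp, ?_⟩
    refine (Runs.loop (I := fun c σ' =>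
      (∃ e, e + c = a ∧ σ'.ivar vH = 2 ^ e ∧ Solved d (2 * 2 ^ e) (σ'.iarr aOpt) (σ'.rarr rOV)) ∨
      (σ'.ivar vH = 0 ∧ Solved d 1 (σ'.iarr aOpt) (σ'.rarr rOV))) (a + 1) (fun _ => B + 4)
      ?_ ?_).mono ?_ ?_
    · exact Or.inl ⟨a, rfl, by simpa using h1, by simpa using hs₀⟩
    · rintro c σ' hF hI hb
      rcases hI with ⟨e, he, h3, h4⟩ | ⟨h3, -⟩
      swap
      · simp [h3] at hb
      refine ⟨by omega, ?_⟩
      have hd' : d.Stored σ' :=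
        Table.Stored.frame (P := level ;; .iset vH (.half (.var vH))) (σ := σ₁.setIArr aOpt 0 0)
          ⟨hd₁.k, hd₁.n, hd₁.off, hd₁.st, hd₁.xs, hd₁.ua, hd₁.ub, hd₁.da, hd₁.db⟩ hF rfl
      have hle : 2 ^ e ≤ 2 ^ a := Nat.pow_le_pow_right (by omega) (by omega)
      refine Runs.mono_time (Runs.seq (level_spec hd hd' h3 (by positivity) (by omega) h4 hW)
        (T' := 4) fun σ'' hF'' h5 => ?_) (by rw [← hL, ← hB])
      have h6 : σ''.ivar vH = 2 ^ e := (hF''.ivar vH rfl).trans h3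
      simp [h6]
      refine ⟨by omega, ?_⟩
      rcases e with _ | e
      · right; simpa using h5
      · left
        exact ⟨e, by omega, by rw [pow_succ]; omega, by rwa [pow_succ, mul_comm] at h5⟩
    · have h3 := Nat.mul_le_mul_right (B + 8) (show a + 1 ≤ L + 1 by omega)
      have h4 : (L + 1) * (B + 10) = (L + 1) * (B + 8) + 2 * (L + 1) := by ring
      simp only [Finset.sum_const, Finset.card_range, smul_eq_mul, IExp.cost, Test.cost]
      rw [show B + 4 + (1 + 1 + 1) + 1 = B + 8 by omega]
      omega
    · rintro σ' - ⟨⟨c, hc, ⟨e, he, h3, h4⟩ | ⟨-, h4⟩⟩, hb⟩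
      · simp [h3] at hb
      · exact h4
  · simp
    nlinarith

theorem output_spec (hd : d.Valid) (hdσ : d.Stored σ)
    (hs : Solved d 1 (σ.iarr aOpt) (σ.rarr rOV)) (hW : d.n + 1 ≤ W) :
    Runs W output σ (50 * (d.n + 1)) (fun σ' => ∃ a b, a < d.n ∧ b < d.n ∧
      σ'.rvar 0 = d.xs a ∧ σ'.rvar 1 = d.xs b ∧
      ∀ a' b', a' < d.n → b' < d.n → d.cost a b ≤ d.cost a' b') := by
  have hn := hd.n_pos
  unfold output
  rw [runs_seq_iset]
  refine ⟨by simp; omega, by simp; omega, ?_⟩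
  refine Runs.mono_time (Runs.seq (T' := 11) (Runs.forVar (I := fun p σ' =>
    1 ≤ σ'.ivar vRow ∧ σ'.ivar vRow ≤ d.n ∧
      ∀ q, 1 ≤ q → q ≤ p → σ.rarr rOV (σ'.ivar vRow) ≤ σ.rarr rOV q) d.n 20 ?_ (by omega) rfl rfl
      ?_ ?_) ?_) ?_
  · simpa using hdσ.n
  · simp
    exact ⟨by omega, by omega⟩
  · rintro p σ' hF hp hvp ⟨h1, h2, h3⟩
    have e1 : σ'.rarr rOV = σ.rarr rOV := (hF.rarr rOV rfl).trans rfl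
    simp [hvp, e1]
    refine ⟨fun h4 => ⟨h1, h2, fun q hq hq' => ?_⟩,
      fun h4 => ⟨by omega, by omega, fun q hq hq' => ?_⟩⟩
    · rcases Nat.lt_or_ge p q with h | h
      · rwa [show q = p + 1 by omega]
      · exact h3 q hq h
    · rcases Nat.lt_or_ge p q with h | h
      · rw [show q = p + 1 by omega]
      · exact h4.le.trans (h3 q hq h)
  · rintro σ' hF ⟨h1, h2, h3⟩
    have e1 : σ'.rarr rXS = d.xs := (hF.rarr rXS rfl).trans hdσ.xs
    have e2 : σ'.iarr aOpt = σ.iarr aOpt := (hF.iarr aOpt rfl).trans rfl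
    obtain ⟨q, hq⟩ : ∃ q, σ'.ivar vRow = q := ⟨_, rfl⟩
    rw [hq] at h1 h2 h3
    simp [e1, e2, hq]
    have hlt := hs.lt q (by omega)
    have hv := hs.value q (by omega) (by omega)
    simp only [one_mul] at hlt hv
    refine ⟨q - 1, by omega, _, hlt, rfl, rfl, fun a' b' ha' hb' => ?_⟩
    have hv' := hs.value (a' + 1) (by omega) (by omega)
    have hb := hs.best (a' + 1) (by omega) (by omega) b' hb'
    simp only [one_mul, Nat.add_sub_cancel] at hv' hb
    rw [← hv]
    exact (h3 (a' + 1) (by omega) (by omega)).trans (hv'.le.trans hb)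
  · simp
    omega

end
end RealRAM

/-! ### The positions of the functions in the input -/

section Offsets
variable {k : ℕ} (D : Fin k → PLData)

theorem breakpointOffset_zero : breakpointOffset D 0 = 0 := by simp [breakpointOffset]

theorem breakpointOffset_last : breakpointOffset D k = totalBreakpoints D := by
  simp [breakpointOffset, totalBreakpoints]

theorem monotone_breakpointOffset : Monotone (breakpointOffset D) := fun i i' h =>
  Finset.sum_le_sum fun j _ => by split_ifs <;> omega

theorem breakpointOffset_succ (i : Fin k) :
    breakpointOffset D (i + 1) = breakpointOffset D i + (D i).size := by
  have : ∀ j : Fin k, (if (j : ℕ) < i + 1 then (D j).size else 0) =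
      (if (j : ℕ) < i then (D j).size else 0) + if j = i then (D j).size else 0 := by
    intro j
    simp only [Fin.ext_iff]
    split_ifs <;> omega
  simp only [breakpointOffset, this, Finset.sum_add_distrib]
  simp

theorem breakpointOffset_add_lt (i : Fin k) (j : Fin (D i).size) :
    breakpointOffset D i + j < totalBreakpoints D := by
  have h1 := breakpointOffset_succ D i
  have h2 := monotone_breakpointOffset D (show (i : ℕ) + 1 ≤ k from i.2)
  have h3 := breakpointOffset_last D
  have h4 := j.2
  omega

end Offsets

section Cost
variable {k : ℕ} {D : Fin k → PLData} {f : Fin k → ℝ → ℝ}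

theorem twoMedianCost_comm (a b : ℝ) : twoMedianCost f a b = twoMedianCost f b a :=
  Finset.sum_congr rfl fun _ _ => min_comm _ _

/-- A unimodal function without breakpoints is constant. -/
theorem eq_of_size_eq_zero {E : PLData} {f : ℝ → ℝ} (h : E.Represents f) (hf : Unimodal f)
    (h0 : E.size = 0) (u v : ℝ) : f u = f v := by
  obtain ⟨c, hc⟩ := hf
  have hlt : ∀ j : Fin E.size, False := fun j => by have := j.2; omega
  have h1 := first_slope_nonpos (x := fun _ => 0) (y := fun _ => 0) h
    (fun j => (hlt j).elim) (fun j => (hlt j).elim) hc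
  have h2 := last_slope_nonneg (x := fun _ => 0) (y := fun _ => 0) h
    (fun j => (hlt j).elim) (fun j => (hlt j).elim) hc
  rw [h0] at h2
  simp only [pieceSlope, if_true] at h1 h2
  have h3 := h.left u v (fun j => (hlt j).elim) (fun j => (hlt j).elim)
  rw [le_antisymm h1 h2] at h3
  linarith

theorem twoMedianCost_eq_of_totalBreakpoints_eq_zero (hD : ∀ i, (D i).Represents (f i))
    (hf : ∀ i, Unimodal (f i)) (h0 : totalBreakpoints D = 0) (a b a' b' : ℝ) :
    twoMedianCost f a b = twoMedianCost f a' b' := by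
  have h : ∀ i, (D i).size = 0 := fun i => by
    simpa using (Finset.sum_eq_zero_iff.1 h0) i (Finset.mem_univ i)
  exact Finset.sum_congr rfl fun i _ => by
    rw [eq_of_size_eq_zero (hD i) (hf i) (h i) a a', eq_of_size_eq_zero (hD i) (hf i) (h i) b b']

end Cost

namespace RealRAM

/-! ### The algorithm -/

/-- Sort and rank the breakpoints, and set up the pieces of all functions. -/
def prepare : Program := mergeSort ;; computeRanks ;; setUp

/-- The program that solves the problem. Without breakpoints all functions are constant, and there
is nothing to do. -/
def solve : Program :=
  .iset vN (.arr aOff (.var vK)) ;;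
  .branch (.ile (.var vN) (.const 0)) .skip (prepare ;; allLevels ;; output)

section
variable {W k n : ℕ} {D : Fin k → PLData} {f : Fin k → ℝ → ℝ} {c : Fin k → ℝ} {σ : State}

theorem Holds.congr {σ' : State} (h : Holds D σ) (h0 : σ'.ivar vK = σ.ivar vK)
    (h1 : σ'.iarr aOff = σ.iarr aOff) (h2 : σ'.rarr rX = σ.rarr rX) (h3 : σ'.rarr rY = σ.rarr rY)
    (h4 : σ'.rarr rS0 = σ.rarr rS0) (h5 : σ'.rarr rS1 = σ.rarr rS1) : Holds D σ' :=
  ⟨h0.trans h.count, fun i hi => by rw [h1, h.offset i hi], fun i j => by rw [h2, h.x i j],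
    fun i j => by rw [h3, h.y i j], fun i => by rw [h4, h.initialSlope i],
    fun i => by rw [h5, h.finalSlope i]⟩

/-- The table for the functions `f i` with minima at `c i` that is stored in the state `σ`. -/
noncomputable def tableOf (D : Fin k → PLData) (f : Fin k → ℝ → ℝ) (c : Fin k → ℝ) (n : ℕ)
    (σ : State) : Table where
  k := k
  n := n
  off := breakpointOffset D
  st := σ.iarr aSt
  xs := σ.rarr rXS
  ua := σ.rarr rUA
  ub := σ.rarr rUB
  da := σ.rarr rDA
  db := σ.rarr rDB
  rise i p := if h : i < k then rise (f ⟨i, h⟩) (c ⟨i, h⟩) (σ.rarr rXS p) else 0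
  fall i p := if h : i < k then fall (f ⟨i, h⟩) (c ⟨i, h⟩) (σ.rarr rXS p) else 0

/-- In the state `σ`, the breakpoints have been sorted and ranked, and the pieces of all functions
have been set up. -/
structure Prepared (D : Fin k → PLData) (n : ℕ) (σ : State) : Prop where
  holds : Holds D σ
  n_eq : σ.ivar vN = n
  sorted : ∀ p p', p ≤ p' → p' < n → σ.rarr rXS p ≤ σ.rarr rXS p'
  rank_lt : ∀ e < n, σ.iarr aRnk e < n
  xs_rank : ∀ e < n, σ.rarr rXS (σ.iarr aRnk e) = σ.rarr rX e
  setUp : ∀ i < k, IsSetUp σ n i (breakpointOffset D i)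
    (breakpointOffset D (i + 1) - breakpointOffset D i)

theorem prepare_spec (hn : totalBreakpoints D = n) (h : Holds D σ) (hN : σ.ivar vN = n)
    (hW : 2 * n + 2 * k + 1 ≤ W) :
    Runs W prepare σ (300 * (n + 1) * (Nat.log 2 n + 2) + (50 * (n + 1) + 400 * (n + k + 1)))
      (Prepared D n) := by
  subst hN
  unfold prepare
  refine Runs.seq (mergeSort_spec (W := W) (by omega)) fun σ₁ hF₁ h₁ => ?_
  have e₁ : σ₁.ivar vN = σ.ivar vN := hF₁.ivar vN rfl
  have hH₁ : Holds D σ₁ := h.congr (hF₁.ivar vK rfl) (hF₁.iarr aOff rfl) (hF₁.rarr rX rfl)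
    (hF₁.rarr rY rfl) (hF₁.rarr rS0 rfl) (hF₁.rarr rS1 rfl)
  rw [← e₁] at hn h₁ hW ⊢
  refine Runs.seq (computeRanks_spec (W := W) (by omega) h₁.2) fun σ₂ hF₂ h₂ => ?_
  have e₂ : σ₂.ivar vN = σ₁.ivar vN := hF₂.ivar vN rfl
  have hH₂ : Holds D σ₂ := hH₁.congr (hF₂.ivar vK rfl) (hF₂.iarr aOff rfl) (hF₂.rarr rX rfl)
    (hF₂.rarr rY rfl) (hF₂.rarr rS0 rfl) (hF₂.rarr rS1 rfl)
  have hrk : ∀ e < σ₁.ivar vN, σ₂.iarr aRnk e < σ₁.ivar vN ∧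
      σ₂.rarr rXS (σ₂.iarr aRnk e) = σ₂.rarr rX e := fun e he => by
    obtain ⟨p, hp, rfl⟩ := h₁.2 e he
    rw [h₂.1 p hp, h₂.2 p hp, hF₂.rarr rX rfl]
    exact ⟨hp, rfl⟩
  refine (setUp_spec (W := W) e₂ hH₂.count (monotone_breakpointOffset D) (breakpointOffset_zero D)
    ((breakpointOffset_last D).trans hn) hH₂.offset (by omega)
    fun e he => by have := (hrk e he).1; omega).mono le_rfl fun σ₃ hF₃ h₃ => ?_
  refine ⟨hH₂.congr (hF₃.ivar vK rfl) (hF₃.iarr aOff rfl) (hF₃.rarr rX rfl)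
    (hF₃.rarr rY rfl) (hF₃.rarr rS0 rfl) (hF₃.rarr rS1 rfl), (hF₃.ivar vN rfl).trans e₂,
    fun p p' hp hp' => ?_, fun e he => ?_, fun e he => ?_, h₃⟩
  · rw [hF₃.rarr rXS rfl, h₂.2 p (by omega), h₂.2 p' hp', hF₁.rarr rX rfl]
    exact h₁.1 p p' hp hp'
  · rw [hF₃.iarr aRnk rfl]
    exact (hrk e he).1
  · rw [hF₃.rarr rXS rfl, hF₃.iarr aRnk rfl, hF₃.rarr rX rfl]
    exact (hrk e he).2

theorem Prepared.stored (h : Prepared D n σ) : (tableOf D f c n σ).Stored σ :=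
  ⟨h.holds.count, h.n_eq, h.holds.offset, rfl, rfl, rfl, rfl, rfl, rfl⟩

/-- The pieces start at the ranks of the breakpoints, so the candidates that belong to a piece lie
in its interval, where the lines agree with the parts of the function. -/
theorem Prepared.valid (h : Prepared D n σ) (hn : totalBreakpoints D = n) (hn0 : 0 < n)
    (hD : ∀ i, (D i).Represents (f i)) (hc : ∀ i, UnimodalAt (f i) (c i)) :
    (tableOf D f c n σ).Valid := by
  have hcnt : ∀ i : Fin k, breakpointOffset D (i + 1) - breakpointOffset D i = (D i).size :=
    fun i => by rw [breakpointOffset_succ]; omega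
  have hX : ∀ (i : Fin k) (j : Fin (D i).size), σ.rarr rX (breakpointOffset D i + j) = (D i).x j :=
    h.holds.x
  have hlt : ∀ (i : Fin k), ∀ j < (D i).size, breakpointOffset D i + j < n := fun i j hj =>
    hn ▸ breakpointOffset_add_lt D i ⟨j, hj⟩
  have hrank : ∀ (i : Fin k) (j j' : ℕ), j ≤ j' → j' < (D i).size →
      σ.iarr aRnk (breakpointOffset D i + j) ≤ σ.iarr aRnk (breakpointOffset D i + j') := by
    intro i j j' hj hj'
    rcases hj.eq_or_lt with rfl | hjj
    · exact le_rfl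
    by_contra hlt'
    have h1 := h.sorted _ _ (not_le.1 hlt').le (h.rank_lt _ (hlt i j (by omega)))
    rw [h.xs_rank _ (hlt i j' hj'), h.xs_rank _ (hlt i j (by omega)), hX i ⟨j, by omega⟩,
      hX i ⟨j', hj'⟩] at h1
    exact absurd h1 (not_le.2 ((hD i).strictMono (by simpa using hjj)))
  have hset : ∀ i : Fin k, IsSetUp σ n i (breakpointOffset D i) (D i).size := fun i => by
    have := h.setUp i i.2
    rwa [hcnt] at this
  have hmem : ∀ (i : Fin k), ∀ j ≤ (D i).size, ∀ p,
      σ.iarr aSt (breakpointOffset D i + i + i + j) ≤ p →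
      p < σ.iarr aSt (breakpointOffset D i + i + i + j + 1) →
      σ.rarr rXS p ∈ pieceSet (D i).size (fun j => σ.rarr rX (breakpointOffset D i + j)) j := by
    intro i j hj p hp hp'
    refine ⟨fun l hl => ?_, fun l hl hlm => ?_⟩
    · obtain ⟨j, rfl⟩ : ∃ j', j = j' + 1 := ⟨j - 1, by omega⟩
      rw [← add_assoc, (hset i).st_succ j (by omega)] at hp
      have hpn : p < n := by
        rcases hj.lt_or_eq with hjm | hjm
        · rw [(hset i).st_succ _ hjm] at hp'
          exact hp'.trans (h.rank_lt _ (hlt i _ hjm))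
        · rw [hjm, (hset i).st_last] at hp'
          exact hp'
      have := h.sorted _ p ((hrank i l j (by omega) (by omega)).trans hp) hpn
      rwa [h.xs_rank _ (hlt i l (by omega))] at this
    · rw [(hset i).st_succ j (by omega)] at hp'
      have := h.sorted p _ (hp'.le.trans (hrank i j l hl hlm)) (h.rank_lt _ (hlt i l hlm))
      rwa [h.xs_rank _ (hlt i l hlm)] at this
  have hlines : ∀ i : Fin k, Lines (D i).size (fun j => σ.rarr rX (breakpointOffset D i + j))
      (pieceSlope (D i).size (fun j => σ.rarr rX (breakpointOffset D i + j))
        (fun j => σ.rarr rY (breakpointOffset D i + j)) (D i).initialSlope (D i).finalSlope)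
      (fun j => σ.rarr rUA (breakpointOffset D i + i + i + j))
      (fun j => σ.rarr rUB (breakpointOffset D i + i + i + j))
      (fun j => σ.rarr rDA (breakpointOffset D i + i + i + j))
      (fun j => σ.rarr rDB (breakpointOffset D i + i + i + j)) := fun i => by
    rw [← h.holds.initialSlope i, ← h.holds.finalSlope i]
    exact (hset i).lines
  refine ⟨hn0, monotone_breakpointOffset D, breakpointOffset_zero D,
    (breakpointOffset_last D).trans hn, fun i hi => (h.setUp i hi).st_zero,
    fun i hi => (h.setUp i hi).st_last, fun i hi j hj => ?_, fun i hi j hj p hp hp' => ?_,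
    fun i hi j hj p hp hp' => ?_, fun i hi p p' hp hp' => ?_, fun i hi p p' hp hp' => ?_⟩
  · replace hj : j ≤ (D ⟨i, hi⟩).size := hj.trans (hcnt ⟨i, hi⟩).le
    have hs := hset ⟨i, hi⟩
    change σ.iarr aSt (breakpointOffset D i + i + i + j) ≤
      σ.iarr aSt (breakpointOffset D i + i + i + j + 1)
    rcases j with _ | j
    · rw [add_zero, hs.st_zero]
      exact Nat.zero_le _
    · rw [← add_assoc, hs.st_succ j (by omega)]
      rcases hj.lt_or_eq with hjm | hjm
      · have := hs.st_succ (j + 1) hjm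
        rw [← add_assoc] at this
        rw [this]
        exact hrank ⟨i, hi⟩ j (j + 1) (by omega) hjm
      · have := hs.st_last
        rw [← hjm, ← add_assoc] at this
        rw [this]
        exact (h.rank_lt _ (hlt ⟨i, hi⟩ j (by omega))).le
  · replace hj : j ≤ (D ⟨i, hi⟩).size := hj.trans (hcnt ⟨i, hi⟩).le
    rw [show (tableOf D f c n σ).rise i p = rise (f ⟨i, hi⟩) (c ⟨i, hi⟩) (σ.rarr rXS p) from
      dif_pos hi]
    exact rise_eq_line (hD ⟨i, hi⟩) (h.holds.x ⟨i, hi⟩) (h.holds.y ⟨i, hi⟩) (hc ⟨i, hi⟩)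
      (hlines ⟨i, hi⟩) hj _ (hmem ⟨i, hi⟩ j hj p hp hp')
  · replace hj : j ≤ (D ⟨i, hi⟩).size := hj.trans (hcnt ⟨i, hi⟩).le
    rw [show (tableOf D f c n σ).fall i p = fall (f ⟨i, hi⟩) (c ⟨i, hi⟩) (σ.rarr rXS p) from
      dif_pos hi]
    exact fall_eq_line (hD ⟨i, hi⟩) (h.holds.x ⟨i, hi⟩) (h.holds.y ⟨i, hi⟩) (hc ⟨i, hi⟩)
      (hlines ⟨i, hi⟩) hj _ (hmem ⟨i, hi⟩ j hj p hp hp')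
  · replace hi : i < k := hi
    simp only [tableOf, dif_pos hi]
    exact rise_mono (hc _) (h.sorted p p' hp hp')
  · replace hi : i < k := hi
    simp only [tableOf, dif_pos hi]
    exact fall_anti (hc _) (h.sorted p p' hp hp')

theorem tableOf_cost (p q : ℕ) : (tableOf D f c n σ).cost p q =
    ∑ i, (rise (f i) (c i) (σ.rarr rXS p) + fall (f i) (c i) (σ.rarr rXS q) +
      min (fall (f i) (c i) (σ.rarr rXS p)) (rise (f i) (c i) (σ.rarr rXS q))) := by
  simp only [Table.cost, pairCost, tableOf]
  rw [Finset.sum_range]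
  simp

/-- An optimal pair of candidates is an optimal pair of points. The cost in the table is exact only
for pairs in increasing order, but the original cost is symmetric, and the cost in the table is never
too small. -/
theorem Prepared.optimal (h : Prepared D n σ) (hn : totalBreakpoints D = n) (hn0 : 0 < n)
    (hD : ∀ i, (D i).Represents (f i)) (hc : ∀ i, UnimodalAt (f i) (c i)) {p q : ℕ}
    (hpq : ∀ p' q', p' < n → q' < n →
      (tableOf D f c n σ).cost p q ≤ (tableOf D f c n σ).cost p' q') (a b : ℝ) :
    twoMedianCost f (σ.rarr rXS p) (σ.rarr rXS q) ≤ twoMedianCost f a b := by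
  have hle : ∀ p' q', p' ≤ q' → q' < n →
      twoMedianCost f (σ.rarr rXS p) (σ.rarr rXS q) ≤
        twoMedianCost f (σ.rarr rXS p') (σ.rarr rXS q') := by
    intro p' q' hle hq'
    have h1 : twoMedianCost f (σ.rarr rXS p) (σ.rarr rXS q) ≤
        ∑ i, f i (c i) + (tableOf D f c n σ).cost p q := by
      rw [tableOf_cost, ← Finset.sum_add_distrib]
      exact Finset.sum_le_sum fun i _ => min_le_rise_fall (hc i) _ _
    have h2 : twoMedianCost f (σ.rarr rXS p') (σ.rarr rXS q') =
        ∑ i, f i (c i) + (tableOf D f c n σ).cost p' q' := by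
      rw [tableOf_cost, ← Finset.sum_add_distrib]
      exact Finset.sum_congr rfl fun i _ => min_eq_rise_fall (hc i) (h.sorted p' q' hle hq')
    have h3 := hpq p' q' (by omega) hq'
    linarith
  obtain ⟨p', hp', q', hq', h1⟩ := exists_candidate_cost_le (xs := σ.rarr rXS) hD
    (fun i => ⟨c i, hc i⟩) hn0 h.sorted
    (fun i j => by
      have hlt := hn ▸ breakpointOffset_add_lt D i j
      exact ⟨_, h.rank_lt _ hlt, (h.xs_rank _ hlt).trans (h.holds.x i j)⟩) a b
  refine le_trans ?_ h1
  rcases le_total p' q' with h2 | h2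
  · exact hle p' q' h2 hq'
  · rw [twoMedianCost_comm (σ.rarr rXS p')]
    exact hle q' p' h2 hp'

theorem solve_spec (hn : totalBreakpoints D = n) (h : Holds D σ)
    (hD : ∀ i, (D i).Represents (f i)) (hf : ∀ i, Unimodal (f i)) (hW : 4 * n + 2 * k + 2 ≤ W) :
    Runs W solve σ (10 + (300 * (n + 1) * (Nat.log 2 n + 2) + (50 * (n + 1) + 400 * (n + k + 1)) +
      (((Nat.log 2 n + 1) * (3000 * (n + k + 1) + 100 * (k * (Nat.log 2 n + 3)) + 30) + 40) +
        50 * (n + 1)))) (fun σ' =>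
      ∀ a b : ℝ, twoMedianCost f (σ'.rvar 0) (σ'.rvar 1) ≤ twoMedianCost f a b) := by
  choose c hc using hf
  have hk : σ.iarr aOff (σ.ivar vK) = n := by
    rw [h.count, h.offset k le_rfl, breakpointOffset_last, hn]
  unfold solve
  rw [runs_seq_iset, runs_branch]
  simp only [IExp.eval, IExp.cost, Test.cost, Test.holds, hk]
  refine ⟨by omega, by omega, by omega, fun h0 => ?_, fun h0 => ?_⟩
  · rw [runs_skip]
    refine ⟨by omega, fun a b => (twoMedianCost_eq_of_totalBreakpoints_eq_zero hD
      (fun i => ⟨c i, hc i⟩) ?_ _ _ a b).le⟩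
    simp at h0
    omega
  · have hn0 : 0 < n := by simp at h0; omega
    refine Runs.mono_time (Runs.seq (prepare_spec (W := W) hn
      (h.congr (by simp) rfl rfl rfl rfl rfl) (by simp) (by omega)) fun σ₁ _ h₁ => ?_)
      (show 300 * (n + 1) * (Nat.log 2 n + 2) + (50 * (n + 1) + 400 * (n + k + 1)) +
        (((Nat.log 2 n + 1) * (3000 * (n + k + 1) + 100 * (k * (Nat.log 2 n + 3)) + 30) + 40) +
          50 * (n + 1)) ≤ _ by omega)
    have hd := h₁.valid hn hn0 hD hc
    have hdn : (tableOf D f c n σ₁).n = n := rfl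
    have hdk : (tableOf D f c n σ₁).k = k := rfl
    have hall := allLevels_spec (W := W) hd h₁.stored (by rw [hdn, hdk]; exact hW)
    rw [hdn, hdk] at hall
    refine Runs.seq hall fun σ₂ hF₂ h₂ => ?_
    have hout := output_spec (W := W) hd (h₁.stored.frame hF₂ rfl) h₂ (by omega)
    rw [hdn] at hout
    refine hout.mono le_rfl fun σ₃ _ h₃ a b => ?_
    obtain ⟨p, q, -, -, e0, e1, hpq⟩ := h₃
    rw [e0, e1]
    exact h₁.optimal hn hn0 hD hc hpq a b

end

/-- The running time, in closed form. -/
theorem steps_le {n k : ℕ} (L : ℕ) (hn : 1 ≤ n) :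
    10 + (300 * (n + 1) * (L + 2) + (50 * (n + 1) + 400 * (n + k + 1)) +
      (((L + 1) * (3000 * (n + k + 1) + 100 * (k * (L + 3)) + 30) + 40) + 50 * (n + 1))) ≤
    20000 * ((n + k * (L + 1)) * (L + 1)) := by
  obtain ⟨m, rfl⟩ := Nat.exists_eq_add_of_le hn
  have h1 : (1 + m + k * (L + 1)) * (L + 1) =
    1 + m + L + m * L + k * L * L + 2 * (k * L) + k := by ring
  have h2 : 300 * (1 + m + 1) * (L + 2) = 300 * (m * L) + 600 * L + 600 * m + 1200 := by ring
  have h3 : (L + 1) * (3000 * (1 + m + k + 1) + 100 * (k * (L + 3)) + 30) =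
    3000 * (m * L) + 3000 * m + 3400 * (k * L) + 3300 * k + 100 * (k * L * L) + 6030 * L +
      6030 := by ring
  rw [h1, h2, h3]
  omega

end RealRAM

theorem mainTheorem2 :
    ∃ (P : RealRAM.Program) (C : ℝ) (w : ℕ),
      ∀ (k n : ℕ) (D : Fin k → PLData) (f : Fin k → ℝ → ℝ) (σ : RealRAM.State),
        (∀ i, (D i).Represents (f i)) → (∀ i, Unimodal (f i)) →
        totalBreakpoints D = n → RealRAM.Holds D σ →
        ∃ (T : ℕ) (σ' : RealRAM.State),
          RealRAM.Exec ((n + k + 2) ^ w) P σ T σ' ∧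
          (∀ a b : ℝ, twoMedianCost f (σ'.rvar 0) (σ'.rvar 1) ≤ twoMedianCost f a b) ∧
          (2 ≤ n → (T : ℝ) ≤ C * (((n : ℝ) + k * Real.log k) * Real.log n)) := by
  refine ⟨RealRAM.solve, 600000, 4, fun k n D f σ hD hf hn h => ?_⟩
  have hW : 4 * n + 2 * k + 2 ≤ (n + k + 2) ^ 4 := by
    have h1 : 2 ^ 3 ≤ (n + k + 2) ^ 3 := Nat.pow_le_pow_left (by omega) 3
    have h2 := Nat.mul_le_mul_right (n + k + 2) h1
    rw [pow_succ]
    omega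
  obtain ⟨T, σ', hT, hE, hopt⟩ := RealRAM.solve_spec hn h hD hf hW
  refine ⟨T, σ', hE, hopt, fun hn2 => ?_⟩
  have h1 : (T : ℝ) ≤ 20000 * ((n + k * (Nat.log 2 n + 1)) * (Nat.log 2 n + 1)) := by
    exact_mod_cast hT.trans (RealRAM.steps_le (Nat.log 2 n) (by omega))
  have h2 := time_bound (k := k) hn2
  linarith
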